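/- **Conventions.** Algebras are associative complex algebras, not necessarily unital; $\sqcup$ is their free product (coproduct). Fix $m,d\in\mathbb N$. An *$m$-faced algebra* is an algebra $A$ with subalgebras $A^1,\dots,A^m$ (faces) which freely generate it, $A=A^1\sqcup\dots\sqcup A^m$; an $m$-faced homomorphism is an algebra homomorphism mapping each face into the corresponding face; the free product of $m$-faced algebras has faces $(A\sqcup B)^k=A^k\sqcup B^k$. An *$m$-$d$-universal product* $\odot$ assigns to linear maps $\varphi_i\colon A_i\to\mathbb C^d$ ($i=1,2$) on $m$-faced algebras a linear map $\varphi_1\odot\varphi_2\colon A_1\sqcup A_2\to\mathbb C^d$ such that, with the canonical identifications of free products, $(\varphi_1\circ j_1)\odot(\varphi_2\circ j_2)=(\varphi_1\odot\varphi_2)\circ(j_1\sqcup j_2)$ for $m$-faced homomorphisms $j_1,j_2$, $(\varphi_1\odot\varphi_2)\odot\varphi_3=\varphi_1\odot(\varphi_2\odot\varphi_3)$, and $\varphi\odot 0=\varphi=0\odot\varphi$ for $0\colon\{0\}\to\mathbb C^d$. An *$m$-faced dual semigroup* is an $m$-faced algebra $B$ with an $m$-faced homomorphism $\Lambda\colon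 B\to B\sqcup B$ such that $(\Lambda\sqcup\mathrm{id})\Lambda=(\mathrm{id}\sqcup\Lambda)\Lambda$ and $(\mathrm{id}\sqcup 0)\Lambda=\mathrm{id}=(0\sqcup\mathrm{id})\Lambda$. An *$m$-faced $*$-algebra* is an $m$-faced algebra with an involution such that the faces are $*$-subalgebras; a free product of $*$-algebras carries the involution extending those of the factors. A *$*$-$m$-faced dual semigroup* is an $m$-faced dual semigroup on an $m$-faced $*$-algebra whose $\Lambda$ is a $*$-homomorphism. For a linear map $\varphi=(\varphi_1,\dots,\varphi_d)\colon A\to\mathbb C^d$ put $\varphi^{\mathrm{tr}}\colon A^{\oplus d}\to\mathbb C$, $\varphi^{\mathrm{tr}}(a_1,\dots,a_d)=\sum_k\varphi_k(a_k)$; let $\mathcal L(A)=S(A^{\oplus d})$ be the symmetric tensor algebra, $S(\varphi^{\mathrm{tr}})\colon\mathcal L(A)\to\mathbb C$ the character extending $\varphi^{\mathrm{tr}}$, and $D(\varphi^{\mathrm{tr}})\colon\mathcal L(A)\to\mathbb C$ the linear functional extending $\varphi^{\mathrm{tr}}$ which vanishes on all products of $n\neq1$ elements of $A^{\oplus d}$.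 For $m$-faced algebras $A_1,A_2$ let $\sigma_{A_1,A_2}\colon\mathcal L(A_1\sqcup A_2)\to\mathcal L(A_1)\otimes\mathcal L(A_2)$ be the unique unital algebra homomorphism with $S((\varphi_1\odot\varphi_2)^{\mathrm{tr}})=(S(\varphi_1^{\mathrm{tr}})\otimes S(\varphi_2^{\mathrm{tr}}))\circ\sigma_{A_1,A_2}$ for all linear $\varphi_i\colon A_i\to\mathbb C^d$. For an $m$-faced dual semigroup $(B,\Lambda)$, $\mathcal L(B)$ is a bialgebra with comultiplication $\sigma_{B,B}\circ S(\Lambda^{\oplus d})$ and counit $S(0)$. For linear $\psi\colon B\to\mathbb C^d$, the *convolution exponential* $\exp_\odot(\psi)\colon B\to\mathbb C^d$ is the unique linear map with $$S\bigl(\exp_\odot(\psi)^{\mathrm{tr}}\bigr)(x)=\sum_{n=0}^\infty\frac{D(\psi^{\mathrm{tr}})^{*n}(x)}{n!}\qquad(x\in\mathcal L(B)),$$ where $*$ is the convolution of linear functionals on the coalgebra $\mathcal L(B)$. For a $*$-algebra $A$ with unitization $\mathbb C1\oplus A$, a linear map $\varphi\colon A\to\mathbb C^d$ is a *restricted state*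 if, for every $k$, $\lambda1+a\mapsto\lambda+\varphi_k(a)$ is nonnegative on all elements $x^*x$, $x\in\mathbb C1\oplus A$. It is a *restricted generating functional* if $\varphi_k(a^*)=\overline{\varphi_k(a)}$ and $\varphi_k(a^*a)\ge0$ for all $a\in A$ and all $k$. An $m$-$d$-universal product $\odot$ is called - *positive* if $\varphi_1\odot\varphi_2$ is a restricted state whenever $\varphi_1,\varphi_2$ are restricted states on $m$-faced $*$-algebras; - *half positive* if, for every restricted state $\varphi$ on an $m$-faced $*$-algebra, all powers $\varphi^{\odot n}$, $n\in\mathbb N$, are restricted states; - *Schoenberg* if, for every restricted generating functional $\psi$ on a $*$-$m$-faced dual semigroup, the convolution exponential $\exp_\odot(\psi)$ exists and is a restricted state. **Theorem.** For every $m$-$d$-universal product $\odot$, positive implies half positive, and half positive implies Schoenberg. -/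

import Mathlib

universe u

namespace NCProb

noncomputable section

open scoped TensorProduct ComplexOrder

set_option linter.unusedSectionVars false

/-! ## Free products of (not necessarily unital) complex algebras -/

section FreeProd

variable (A B : Type u)
  [NonUnitalRing A] [Module ℂ A] [IsScalarTower ℂ A A] [SMulCommClass ℂ A A]
  [NonUnitalRing B] [Module ℂ B] [IsScalarTower ℂ B B] [SMulCommClass ℂ B B]

/-- The relations which make the two canonical maps of `A` and `B` into the free unital algebra on
the disjoint union of `A` and `B` (nonunital) algebra homomorphisms. -/
inductive FreeProd.Rel : FreeAlgebra ℂ (A ⊕ B) → FreeAlgebra ℂ (A ⊕ B) → Prop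
  | inl_add (a a' : A) : FreeProd.Rel (FreeAlgebra.ι ℂ (Sum.inl (a + a')))
      (FreeAlgebra.ι ℂ (Sum.inl a) + FreeAlgebra.ι ℂ (Sum.inl a'))
  | inl_smul (c : ℂ) (a : A) : FreeProd.Rel (FreeAlgebra.ι ℂ (Sum.inl (c • a)))
      (c • FreeAlgebra.ι ℂ (Sum.inl a))
  | inl_mul (a a' : A) : FreeProd.Rel (FreeAlgebra.ι ℂ (Sum.inl (a * a')))
      (FreeAlgebra.ι ℂ (Sum.inl a) * FreeAlgebra.ι ℂ (Sum.inl a'))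
  | inr_add (b b' : B) : FreeProd.Rel (FreeAlgebra.ι ℂ (Sum.inr (b + b')))
      (FreeAlgebra.ι ℂ (Sum.inr b) + FreeAlgebra.ι ℂ (Sum.inr b'))
  | inr_smul (c : ℂ) (b : B) : FreeProd.Rel (FreeAlgebra.ι ℂ (Sum.inr (c • b)))
      (c • FreeAlgebra.ι ℂ (Sum.inr b))
  | inr_mul (b b' : B) : FreeProd.Rel (FreeAlgebra.ι ℂ (Sum.inr (b * b')))
      (FreeAlgebra.ι ℂ (Sum.inr b) * FreeAlgebra.ι ℂ (Sum.inr b'))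

/-- The unital algebra freely generated by the algebras `A` and `B`. -/
abbrev FreeProd.Unital : Type u := RingQuot (FreeProd.Rel A B)

/-- The canonical images of the elements of `A` and of `B`. -/
def FreeProd.gen (x : A ⊕ B) : FreeProd.Unital A B :=
  RingQuot.mkAlgHom ℂ (FreeProd.Rel A B) (FreeAlgebra.ι ℂ x)

/-- The free product (the coproduct in the category of nonunital complex algebras): the nonunital
subalgebra generated by `A` and `B` inside the unital algebra freely generated by them. -/
def FreeProd : Type u :=
  ↥(NonUnitalAlgebra.adjoin ℂ (Set.range (FreeProd.gen A B)))

namespace FreeProd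

instance : NonUnitalRing (FreeProd A B) :=
  inferInstanceAs (NonUnitalRing ↥(NonUnitalAlgebra.adjoin ℂ (Set.range (FreeProd.gen A B))))
instance : Module ℂ (FreeProd A B) :=
  inferInstanceAs (Module ℂ ↥(NonUnitalAlgebra.adjoin ℂ (Set.range (FreeProd.gen A B))))
instance : IsScalarTower ℂ (FreeProd A B) (FreeProd A B) :=
  inferInstanceAs (IsScalarTower ℂ ↥(NonUnitalAlgebra.adjoin ℂ (Set.range (FreeProd.gen A B)))
    ↥(NonUnitalAlgebra.adjoin ℂ (Set.range (FreeProd.gen A B))))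
instance : SMulCommClass ℂ (FreeProd A B) (FreeProd A B) :=
  inferInstanceAs (SMulCommClass ℂ ↥(NonUnitalAlgebra.adjoin ℂ (Set.range (FreeProd.gen A B)))
    ↥(NonUnitalAlgebra.adjoin ℂ (Set.range (FreeProd.gen A B))))

/-- The embedding of the free product into the unital algebra freely generated by `A` and `B`. -/
def incl : FreeProd A B →ₙₐ[ℂ] FreeProd.Unital A B :=
  NonUnitalSubalgebraClass.subtype (NonUnitalAlgebra.adjoin ℂ (Set.range (FreeProd.gen A B)))

variable {A B}

theorem incl_injective : Function.Injective (incl A B) := Subtype.val_injective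

theorem gen_inl_smul (c : ℂ) (a : A) :
    gen A B (Sum.inl (c • a)) = c • gen A B (Sum.inl a) := by
  simpa [gen] using RingQuot.mkAlgHom_rel ℂ (Rel.inl_smul (B := B) c a)
theorem gen_inl_add (a a' : A) :
    gen A B (Sum.inl (a + a')) = gen A B (Sum.inl a) + gen A B (Sum.inl a') := by
  simpa [gen] using RingQuot.mkAlgHom_rel ℂ (Rel.inl_add (B := B) a a')
theorem gen_inl_mul (a a' : A) :
    gen A B (Sum.inl (a * a')) = gen A B (Sum.inl a) * gen A B (Sum.inl a') := by
  simpa [gen] using RingQuot.mkAlgHom_rel ℂ (Rel.inl_mul (B := B) a a')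
theorem gen_inr_smul (c : ℂ) (b : B) :
    gen A B (Sum.inr (c • b)) = c • gen A B (Sum.inr b) := by
  simpa [gen] using RingQuot.mkAlgHom_rel ℂ (Rel.inr_smul (A := A) c b)
theorem gen_inr_add (b b' : B) :
    gen A B (Sum.inr (b + b')) = gen A B (Sum.inr b) + gen A B (Sum.inr b') := by
  simpa [gen] using RingQuot.mkAlgHom_rel ℂ (Rel.inr_add (A := A) b b')
theorem gen_inr_mul (b b' : B) :
    gen A B (Sum.inr (b * b')) = gen A B (Sum.inr b) * gen A B (Sum.inr b') := by
  simpa [gen] using RingQuot.mkAlgHom_rel ℂ (Rel.inr_mul (A := A) b b')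

/-- The canonical homomorphism `A → A ⊔ B`. -/
def inl : A →ₙₐ[ℂ] FreeProd A B where
  toFun a := ⟨gen A B (Sum.inl a), NonUnitalAlgebra.subset_adjoin ℂ ⟨_, rfl⟩⟩
  map_smul' c a := Subtype.ext (gen_inl_smul c a)
  map_zero' := Subtype.ext ((congrArg (fun a => gen A B (Sum.inl a)) (zero_smul ℂ (0 : A)).symm).trans
    ((gen_inl_smul 0 (0 : A)).trans (zero_smul ℂ _)))
  map_add' a a' := Subtype.ext (gen_inl_add a a')
  map_mul' a a' := Subtype.ext (gen_inl_mul a a')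

/-- The canonical homomorphism `B → A ⊔ B`. -/
def inr : B →ₙₐ[ℂ] FreeProd A B where
  toFun b := ⟨gen A B (Sum.inr b), NonUnitalAlgebra.subset_adjoin ℂ ⟨_, rfl⟩⟩
  map_smul' c b := Subtype.ext (gen_inr_smul c b)
  map_zero' := Subtype.ext ((congrArg (fun b => gen A B (Sum.inr b)) (zero_smul ℂ (0 : B)).symm).trans
    ((gen_inr_smul 0 (0 : B)).trans (zero_smul ℂ _)))
  map_add' b b' := Subtype.ext (gen_inr_add b b')
  map_mul' b b' := Subtype.ext (gen_inr_mul b b')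

theorem incl_inl (a : A) : incl A B (inl a) = gen A B (Sum.inl a) := rfl
theorem incl_inr (b : B) : incl A B (inr b) = gen A B (Sum.inr b) := rfl

/-- Induction: the free product is generated by the images of `A` and `B`. -/
theorem induction {p : FreeProd A B → Prop} (hl : ∀ a, p (inl a)) (hr : ∀ b, p (inr b))
    (h0 : p 0) (hadd : ∀ x y, p x → p y → p (x + y)) (hmul : ∀ x y, p x → p y → p (x * y))
    (hsmul : ∀ (c : ℂ) x, p x → p (c • x)) (x : FreeProd A B) : p x := by
  obtain ⟨x, hx⟩ := x
  induction hx using NonUnitalAlgebra.adjoin_induction with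
  | mem x hx =>
    obtain ⟨a | b, rfl⟩ := hx
    · exact hl a
    · exact hr b
  | add x y hx hy h1 h2 => exact hadd _ _ h1 h2
  | zero => exact h0
  | mul x y hx hy h1 h2 => exact hmul _ _ h1 h2
  | smul c x hx h => exact hsmul c _ h

section lift

variable {C : Type*} [NonUnitalRing C] [Module ℂ C] [IsScalarTower ℂ C C] [SMulCommClass ℂ C C]

/-- Homomorphisms on the free product agree if they agree on `A` and on `B`. -/
theorem hom_ext {f g : FreeProd A B →ₙₐ[ℂ] C} (hl : ∀ a, f (inl a) = g (inl a))
    (hr : ∀ b, f (inr b) = g (inr b)) : f = g := by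
  ext x
  induction x using FreeProd.induction with
  | hl a => exact hl a
  | hr b => exact hr b
  | h0 => simp
  | hadd x y hx hy => simp [hx, hy]
  | hmul x y hx hy => simp [hx, hy]
  | hsmul c x hx => simp [hx]

/-- The unital extension, with values in the unitization, of the homomorphism induced by
`f` and `g`. -/
def liftUnital (f : A →ₙₐ[ℂ] C) (g : B →ₙₐ[ℂ] C) :
    FreeProd.Unital A B →ₐ[ℂ] Unitization ℂ C :=
  RingQuot.liftAlgHom ℂ ⟨FreeAlgebra.lift ℂ
    (Sum.elim (fun a => (f a : Unitization ℂ C)) (fun b => (g b : Unitization ℂ C))), by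
      intro x y h
      cases h <;> simp⟩

theorem liftUnital_inl (f : A →ₙₐ[ℂ] C) (g : B →ₙₐ[ℂ] C) (a : A) :
    liftUnital f g (incl A B (inl a)) = (f a : Unitization ℂ C) := by
  simp [liftUnital, incl_inl, gen]

theorem liftUnital_inr (f : A →ₙₐ[ℂ] C) (g : B →ₙₐ[ℂ] C) (b : B) :
    liftUnital f g (incl A B (inr b)) = (g b : Unitization ℂ C) := by
  simp [liftUnital, incl_inr, gen]

theorem liftUnital_fst (f : A →ₙₐ[ℂ] C) (g : B →ₙₐ[ℂ] C) (x : FreeProd A B) :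
    (liftUnital f g (incl A B x)).fst = 0 := by
  induction x using FreeProd.induction with
  | hl a => simp [liftUnital_inl]
  | hr b => simp [liftUnital_inr]
  | h0 => simp
  | hadd x y hx hy => simp [hx, hy]
  | hmul x y hx hy => simp [hx, hy]
  | hsmul c x hx => simp [hx]

/-- The universal property of the free product: the homomorphism which extends `f` and `g`. -/
def lift (f : A →ₙₐ[ℂ] C) (g : B →ₙₐ[ℂ] C) : FreeProd A B →ₙₐ[ℂ] C where
  toFun x := (liftUnital f g (incl A B x)).snd
  map_smul' c x := by simp
  map_zero' := by simp
  map_add' x y := by simp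
  map_mul' x y := by simp [liftUnital_fst]

@[simp] theorem lift_inl (f : A →ₙₐ[ℂ] C) (g : B →ₙₐ[ℂ] C) (a : A) :
    lift f g (inl a) = f a :=
  (congrArg (fun z : Unitization ℂ C => z.snd) (liftUnital_inl f g a)).trans
    (Unitization.snd_inr ℂ (f a))

@[simp] theorem lift_inr (f : A →ₙₐ[ℂ] C) (g : B →ₙₐ[ℂ] C) (b : B) :
    lift f g (inr b) = g b :=
  (congrArg (fun z : Unitization ℂ C => z.snd) (liftUnital_inr f g b)).trans
    (Unitization.snd_inr ℂ (g b))

end lift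

section maps

variable {A' B' C : Type u}
  [NonUnitalRing A'] [Module ℂ A'] [IsScalarTower ℂ A' A'] [SMulCommClass ℂ A' A']
  [NonUnitalRing B'] [Module ℂ B'] [IsScalarTower ℂ B' B'] [SMulCommClass ℂ B' B']
  [NonUnitalRing C] [Module ℂ C] [IsScalarTower ℂ C C] [SMulCommClass ℂ C C]

/-- The free product `j₁ ⊔ j₂` of two homomorphisms. -/
def map (j₁ : A →ₙₐ[ℂ] A') (j₂ : B →ₙₐ[ℂ] B') : FreeProd A B →ₙₐ[ℂ] FreeProd A' B' :=
  lift (inl.comp j₁) (inr.comp j₂)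

variable (A B C) in
/-- The canonical identification `(A ⊔ B) ⊔ C → A ⊔ (B ⊔ C)`. -/
def assoc : FreeProd (FreeProd A B) C →ₙₐ[ℂ] FreeProd A (FreeProd B C) :=
  lift (lift inl (inr.comp inl)) (inr.comp inr)

end maps

end FreeProd

end FreeProd

/-! ## The involution of a free product -/

/-- The opposite algebra of `C` with the conjugate scalar multiplication. Conjugate linear
antihomomorphisms into `C` are homomorphisms into `ConjOp C`. -/
def ConjOp (C : Type u) : Type u := Cᵐᵒᵖ

section ConjOp

variable {C : Type u} [NonUnitalRing C] [Module ℂ C] [IsScalarTower ℂ C C] [SMulCommClass ℂ C C]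

instance : NonUnitalRing (ConjOp C) := inferInstanceAs (NonUnitalRing Cᵐᵒᵖ)
instance : Module ℂ (ConjOp C) := Module.compHom Cᵐᵒᵖ (starRingEnd ℂ)

/-- The identity map into `ConjOp C`. -/
def ConjOp.op (x : C) : ConjOp C := MulOpposite.op x
/-- The identity map from `ConjOp C`. -/
def ConjOp.unop (x : ConjOp C) : C := MulOpposite.unop (α := C) x

theorem ConjOp.unop_add (x y : ConjOp C) : (x + y).unop = x.unop + y.unop := rfl
theorem ConjOp.unop_zero : (0 : ConjOp C).unop = 0 := rfl
theorem ConjOp.unop_mul (x y : ConjOp C) : (x * y).unop = y.unop * x.unop := rfl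
theorem ConjOp.unop_smul (c : ℂ) (x : ConjOp C) : (c • x).unop = star c • x.unop := rfl
theorem ConjOp.unop_op (x : C) : (ConjOp.op x).unop = x := rfl
theorem ConjOp.unop_injective : Function.Injective (ConjOp.unop : ConjOp C → C) :=
  MulOpposite.unop_injective

instance : IsScalarTower ℂ (ConjOp C) (ConjOp C) where
  smul_assoc c x y := ConjOp.unop_injective <| by
    simp [ConjOp.unop_mul, ConjOp.unop_smul, mul_smul_comm]
instance : SMulCommClass ℂ (ConjOp C) (ConjOp C) where
  smul_comm c x y := ConjOp.unop_injective <| by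
    simp [ConjOp.unop_mul, ConjOp.unop_smul, smul_mul_assoc]

end ConjOp

namespace FreeProd

variable {A B : Type u}
  [NonUnitalRing A] [Module ℂ A] [IsScalarTower ℂ A A] [SMulCommClass ℂ A A]
  [NonUnitalRing B] [Module ℂ B] [IsScalarTower ℂ B B] [SMulCommClass ℂ B B]
  [StarRing A] [StarModule ℂ A] [StarRing B] [StarModule ℂ B]

variable (A B) in
/-- The conjugate linear antihomomorphism of `A ⊔ B` which extends the involutions of the factors,
as a homomorphism. -/
def starHom : FreeProd A B →ₙₐ[ℂ] ConjOp (FreeProd A B) :=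
  lift
    { toFun := fun a => ConjOp.op (inl (star a))
      map_smul' := fun c a => ConjOp.unop_injective <| by
        simp [ConjOp.unop_smul, ConjOp.unop_op]
      map_zero' := ConjOp.unop_injective <| by simp [ConjOp.unop_zero, ConjOp.unop_op]
      map_add' := fun a a' => ConjOp.unop_injective <| by
        simp [ConjOp.unop_add, ConjOp.unop_op]
      map_mul' := fun a a' => ConjOp.unop_injective <| by
        simp [ConjOp.unop_mul, ConjOp.unop_op] }
    { toFun := fun b => ConjOp.op (inr (star b))
      map_smul' := fun c b => ConjOp.unop_injective <| by
        simp [ConjOp.unop_smul, ConjOp.unop_op]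
      map_zero' := ConjOp.unop_injective <| by simp [ConjOp.unop_zero, ConjOp.unop_op]
      map_add' := fun b b' => ConjOp.unop_injective <| by
        simp [ConjOp.unop_add, ConjOp.unop_op]
      map_mul' := fun b b' => ConjOp.unop_injective <| by
        simp [ConjOp.unop_mul, ConjOp.unop_op] }

instance : Star (FreeProd A B) := ⟨fun x => (starHom A B x).unop⟩

theorem star_def (x : FreeProd A B) : star x = (starHom A B x).unop := rfl

theorem star_inl (a : A) : star (inl a : FreeProd A B) = inl (star a) := by
  simp [star_def, starHom, ConjOp.unop_op]

theorem star_inr (b : B) : star (inr b : FreeProd A B) = inr (star b) := by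
  simp [star_def, starHom, ConjOp.unop_op]

theorem star_smul' (c : ℂ) (x : FreeProd A B) : star (c • x) = star c • star x := by
  simp [star_def, ConjOp.unop_smul]

theorem star_add' (x y : FreeProd A B) : star (x + y) = star x + star y := by
  simp [star_def, ConjOp.unop_add]

theorem star_mul' (x y : FreeProd A B) : star (x * y) = star y * star x := by
  simp [star_def, ConjOp.unop_mul]

theorem star_zero' : star (0 : FreeProd A B) = 0 := by
  simp [star_def, ConjOp.unop_zero]

/-- The natural involution on the free product of two `*`-algebras. -/
instance : StarRing (FreeProd A B) where
  star_involutive x := by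
    induction x using FreeProd.induction with
    | hl a => simp [star_inl]
    | hr b => simp [star_inr]
    | h0 => simp [star_zero']
    | hadd x y hx hy => simp [star_add', hx, hy]
    | hmul x y hx hy => simp [star_mul', hx, hy]
    | hsmul c x hx => simp [star_smul', hx]
  star_mul := star_mul'
  star_add := star_add'

instance : StarModule ℂ (FreeProd A B) := ⟨star_smul'⟩

end FreeProd

/-! ## Faced algebras -/

/-- A family of subalgebras `F 1, …, F m` of `A` freely generates `A`: the algebra `A` with the
inclusions is the free product (the coproduct) of the subalgebras. -/
def FreelyGenerates {m : ℕ} {A : Type u} [NonUnitalRing A] [Module ℂ A] [IsScalarTower ℂ A A]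
    [SMulCommClass ℂ A A] (F : Fin m → NonUnitalSubalgebra ℂ A) : Prop :=
  ∀ (C : Type u) [NonUnitalRing C] [Module ℂ C] [IsScalarTower ℂ C C] [SMulCommClass ℂ C C]
    (f : ∀ k, F k →ₙₐ[ℂ] C), ∃! g : A →ₙₐ[ℂ] C, ∀ (k : Fin m) (a : F k), g a = f k a

/-- An `m`-faced algebra. -/
structure FacedAlg (m : ℕ) where
  /-- the underlying algebra -/
  carrier : Type u
  [instRing : NonUnitalRing carrier]
  [instModule : Module ℂ carrier]
  [instTower : IsScalarTower ℂ carrier carrier]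
  [instComm : SMulCommClass ℂ carrier carrier]
  /-- the faces -/
  face : Fin m → NonUnitalSubalgebra ℂ carrier
  freely : FreelyGenerates face

attribute [instance] FacedAlg.instRing FacedAlg.instModule FacedAlg.instTower FacedAlg.instComm

namespace FacedAlg

variable {m : ℕ}

instance : CoeSort (FacedAlg.{u} m) (Type u) := ⟨FacedAlg.carrier⟩

/-- An algebra homomorphism is `m`-faced if it maps faces to faces. -/
def IsFacedHom {A B : FacedAlg.{u} m} (j : A →ₙₐ[ℂ] B) : Prop :=
  ∀ k, ∀ a ∈ A.face k, j a ∈ B.face k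

/-- The zero algebra as an `m`-faced algebra. -/
abbrev zero : FacedAlg.{u} m where
  carrier := PUnit
  face _ := ⊤
  freely := by
    intro C _ _ _ _ f
    refine ⟨0, fun k a => ?_, fun g _ => ?_⟩
    · have : a = 0 := Subsingleton.elim _ _
      simp [this]
    · ext a
      rw [show a = 0 from Subsingleton.elim _ _, map_zero, map_zero]

/-- The `k`-th face of the free product: the subalgebra `Aᵏ ⊔ Bᵏ` generated by the `k`-th faces of
the factors. -/
def prodFace (A B : FacedAlg.{u} m) (k : Fin m) : NonUnitalSubalgebra ℂ (FreeProd A B) :=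
  NonUnitalAlgebra.adjoin ℂ
    ((FreeProd.inl : A →ₙₐ[ℂ] FreeProd A B) '' (A.face k : Set A) ∪
      (FreeProd.inr : B →ₙₐ[ℂ] FreeProd A B) '' (B.face k : Set B))

theorem inl_mem_face (A B : FacedAlg.{u} m) (k : Fin m) (a : A) (ha : a ∈ A.face k) :
    (FreeProd.inl a : FreeProd A B) ∈ prodFace A B k :=
  NonUnitalAlgebra.subset_adjoin ℂ (Or.inl ⟨a, ha, rfl⟩)

theorem inr_mem_face (A B : FacedAlg.{u} m) (k : Fin m) (b : B) (hb : b ∈ B.face k) :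
    (FreeProd.inr b : FreeProd A B) ∈ prodFace A B k :=
  NonUnitalAlgebra.subset_adjoin ℂ (Or.inr ⟨b, hb, rfl⟩)

/-- A homomorphism on a faced algebra is determined by its restrictions to the faces. -/
theorem hom_ext {A : FacedAlg.{u} m} {C : Type u} [NonUnitalRing C] [Module ℂ C]
    [IsScalarTower ℂ C C] [SMulCommClass ℂ C C] {g g' : A →ₙₐ[ℂ] C}
    (h : ∀ k, ∀ a ∈ A.face k, g a = g' a) : g = g' :=
  (A.freely C fun k => g'.comp (NonUnitalSubalgebraClass.subtype (A.face k))).unique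
    (fun k a => h k a a.2) (fun _ _ => rfl)

/-- The free product of `m`-faced algebras, with faces `(A ⊔ B)ᵏ = Aᵏ ⊔ Bᵏ`. -/
abbrev prod (A B : FacedAlg.{u} m) : FacedAlg.{u} m where
  carrier := FreeProd A B
  face := prodFace A B
  freely := by
    intro C _ _ _ _ f
    let fA : ∀ k, A.face k →ₙₐ[ℂ] C := fun k =>
      { toFun := fun a => f k ⟨FreeProd.inl a.1, inl_mem_face A B k a.1 a.2⟩
        map_smul' := fun c a => by
          simp only [MonoidHom.id_apply]
          rw [← map_smul]
          exact congrArg (f k) (Subtype.ext (map_smul (FreeProd.inl : A →ₙₐ[ℂ] FreeProd A B) _ _))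
        map_zero' := by
          rw [← map_zero (f k)]
          exact congrArg (f k) (Subtype.ext (map_zero (FreeProd.inl : A →ₙₐ[ℂ] FreeProd A B)))
        map_add' := fun a b => by
          rw [← map_add (f k)]
          exact congrArg (f k) (Subtype.ext (map_add (FreeProd.inl : A →ₙₐ[ℂ] FreeProd A B) _ _))
        map_mul' := fun a b => by
          rw [← map_mul (f k)]
          exact congrArg (f k) (Subtype.ext (map_mul (FreeProd.inl : A →ₙₐ[ℂ] FreeProd A B) _ _)) }
    let fB : ∀ k, B.face k →ₙₐ[ℂ] C := fun k =>
      { toFun := fun a => f k ⟨FreeProd.inr a.1, inr_mem_face A B k a.1 a.2⟩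
        map_smul' := fun c a => by
          simp only [MonoidHom.id_apply]
          rw [← map_smul]
          exact congrArg (f k) (Subtype.ext (map_smul (FreeProd.inr : B →ₙₐ[ℂ] FreeProd A B) _ _))
        map_zero' := by
          rw [← map_zero (f k)]
          exact congrArg (f k) (Subtype.ext (map_zero (FreeProd.inr : B →ₙₐ[ℂ] FreeProd A B)))
        map_add' := fun a b => by
          rw [← map_add (f k)]
          exact congrArg (f k) (Subtype.ext (map_add (FreeProd.inr : B →ₙₐ[ℂ] FreeProd A B) _ _))
        map_mul' := fun a b => by
          rw [← map_mul (f k)]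
          exact congrArg (f k) (Subtype.ext (map_mul (FreeProd.inr : B →ₙₐ[ℂ] FreeProd A B) _ _)) }
    obtain ⟨gA, hA, -⟩ := A.freely C fA
    obtain ⟨gB, hB, -⟩ := B.freely C fB
    refine ⟨FreeProd.lift gA gB, ?_, ?_⟩
    · rintro k ⟨x, hx⟩
      have hx' := hx
      revert hx
      induction hx' using NonUnitalAlgebra.adjoin_induction with
      | mem x hm =>
        intro hx
        rcases hm with hm | hm
        · obtain ⟨a, ha, rfl⟩ := hm
          exact (FreeProd.lift_inl gA gB a).trans (hA k ⟨a, ha⟩)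
        · obtain ⟨b, hb, rfl⟩ := hm
          exact (FreeProd.lift_inr gA gB b).trans (hB k ⟨b, hb⟩)
      | add x y hx hy h1 h2 =>
        intro h
        rw [map_add, h1 hx, h2 hy, ← map_add]
        rfl
      | zero =>
        intro h
        rw [map_zero, ← map_zero (f k)]
        rfl
      | mul x y hx hy h1 h2 =>
        intro h
        rw [map_mul, h1 hx, h2 hy, ← map_mul]
        rfl
      | smul c x hx h1 =>
        intro h
        rw [map_smul, h1 hx, ← map_smul]
        rfl
    · intro g hg
      have e1 : g.comp FreeProd.inl = gA := hom_ext fun k a ha =>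
        (hg k ⟨_, inl_mem_face A B k a ha⟩).trans (hA k ⟨a, ha⟩).symm
      have e2 : g.comp FreeProd.inr = gB := hom_ext fun k b hb =>
        (hg k ⟨_, inr_mem_face A B k b hb⟩).trans (hB k ⟨b, hb⟩).symm
      refine FreeProd.hom_ext (fun a => ?_) (fun b => ?_)
      · rw [FreeProd.lift_inl, ← e1]; rfl
      · rw [FreeProd.lift_inr, ← e2]; rfl

end FacedAlg

/-- An `m`-faced `*`-algebra: an `m`-faced algebra with an involution such that the faces are
`*`-subalgebras. -/
structure FacedStarAlg (m : ℕ) extends FacedAlg.{u} m where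
  [instStar : StarRing carrier]
  [instStarModule : StarModule ℂ carrier]
  star_mem_face : ∀ k, ∀ a ∈ face k, star a ∈ face k

attribute [instance] FacedStarAlg.instStar FacedStarAlg.instStarModule

namespace FacedStarAlg

variable {m : ℕ}

instance : CoeSort (FacedStarAlg.{u} m) (Type u) := ⟨fun A => A.carrier⟩

/-- The zero algebra as an `m`-faced `*`-algebra. -/
abbrev zero : FacedStarAlg.{u} m where
  toFacedAlg := FacedAlg.zero
  instStar :=
    { star := fun x => x
      star_involutive := fun _ => rfl
      star_mul := fun _ _ => rfl
      star_add := fun _ _ => rfl }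
  instStarModule :=
    letI : Star (FacedAlg.zero : FacedAlg.{u} m).carrier := ⟨fun x => x⟩
    ⟨fun _ _ => rfl⟩
  star_mem_face _ _ _ := trivial

theorem star_mem_prodFace (A B : FacedStarAlg.{u} m) (k : Fin m) (x : FreeProd A B)
    (hx : x ∈ FacedAlg.prodFace A.toFacedAlg B.toFacedAlg k) :
    star x ∈ FacedAlg.prodFace A.toFacedAlg B.toFacedAlg k := by
  induction hx using NonUnitalAlgebra.adjoin_induction with
  | mem x hm =>
    rcases hm with hm | hm
    · obtain ⟨a, ha, rfl⟩ := hm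
      rw [FreeProd.star_inl]
      exact FacedAlg.inl_mem_face _ _ k _ (A.star_mem_face k a ha)
    · obtain ⟨b, hb, rfl⟩ := hm
      rw [FreeProd.star_inr]
      exact FacedAlg.inr_mem_face _ _ k _ (B.star_mem_face k b hb)
  | add x y hx hy h1 h2 => rw [star_add]; exact add_mem h1 h2
  | zero => rw [star_zero]; exact zero_mem _
  | mul x y hx hy h1 h2 => rw [star_mul]; exact mul_mem h2 h1
  | smul c x hx h => rw [star_smul]; exact SMulMemClass.smul_mem _ h

/-- The free product of `m`-faced `*`-algebras. -/
abbrev prod (A B : FacedStarAlg.{u} m) : FacedStarAlg.{u} m where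
  toFacedAlg := A.toFacedAlg.prod B.toFacedAlg
  instStar := inferInstanceAs (StarRing (FreeProd A B))
  instStarModule := inferInstanceAs (StarModule ℂ (FreeProd A B))
  star_mem_face k x hx := star_mem_prodFace A B k x hx

/-- The free power `A ⊔ ⋯ ⊔ A` (`n` factors). -/
def pow (A : FacedStarAlg.{u} m) : ℕ → FacedStarAlg.{u} m
  | 0 => zero
  | n + 1 => (A.pow n).prod A

end FacedStarAlg

/-! ## Universal products -/

/-- `d`-valued linear functionals on an algebra. -/
abbrev Functional (d : ℕ) (A : Type u) [NonUnitalRing A] [Module ℂ A] : Type u :=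
  A →ₗ[ℂ] (Fin d → ℂ)

/-- The composition of a `d`-valued linear functional with an algebra homomorphism. -/
def Functional.pullback {d : ℕ} {A B : Type u} [NonUnitalRing A] [Module ℂ A]
    [NonUnitalRing B] [Module ℂ B] (φ : Functional d B) (j : A →ₙₐ[ℂ] B) : Functional d A :=
  φ ∘ₗ (j : A →ₗ[ℂ] B)

/-- An `m`-`d`-universal product: an associative product of `d`-valued linear functionals on
`m`-faced algebras, with values in the functionals on the free product, which is functorial with
respect to `m`-faced homomorphisms and for which the functional on the zero algebra is a unit (up to
the canonical identifications `A ⊔ {0} ≅ A ≅ {0} ⊔ A` and `(A₁ ⊔ A₂) ⊔ A₃ ≅ A₁ ⊔ (A₂ ⊔ A₃)`). -/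
structure UniversalProduct (m d : ℕ) where
  /-- the product `φ₁ ⊙ φ₂` -/
  prod : ∀ (A₁ A₂ : FacedAlg.{u} m), Functional d A₁ → Functional d A₂ →
    Functional d (FreeProd A₁ A₂)
  universality : ∀ (A₁ A₂ B₁ B₂ : FacedAlg.{u} m) (φ₁ : Functional d B₁) (φ₂ : Functional d B₂)
    (j₁ : A₁ →ₙₐ[ℂ] B₁) (j₂ : A₂ →ₙₐ[ℂ] B₂), FacedAlg.IsFacedHom j₁ → FacedAlg.IsFacedHom j₂ →
    prod A₁ A₂ (φ₁.pullback j₁) (φ₂.pullback j₂) =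
      (prod B₁ B₂ φ₁ φ₂).pullback (FreeProd.map j₁ j₂)
  associativity : ∀ (A₁ A₂ A₃ : FacedAlg.{u} m) (φ₁ : Functional d A₁) (φ₂ : Functional d A₂)
    (φ₃ : Functional d A₃),
    prod (A₁.prod A₂) A₃ (prod A₁ A₂ φ₁ φ₂) φ₃ =
      (prod A₁ (A₂.prod A₃) φ₁ (prod A₂ A₃ φ₂ φ₃)).pullback (FreeProd.assoc A₁ A₂ A₃)
  prod_zero : ∀ (A : FacedAlg.{u} m) (φ : Functional d A),
    (prod A FacedAlg.zero φ 0).pullback FreeProd.inl = φ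
  zero_prod : ∀ (A : FacedAlg.{u} m) (φ : Functional d A),
    (prod FacedAlg.zero A 0 φ).pullback FreeProd.inr = φ

/-- A comultiplication `Λ` which turns the `m`-faced algebra `B` into an `m`-faced dual semigroup:
a coassociative `m`-faced homomorphism with the counit property. -/
structure IsDualSemigroup {m : ℕ} (B : FacedAlg.{u} m) (Λ : B →ₙₐ[ℂ] FreeProd B B) : Prop where
  faced : FacedAlg.IsFacedHom (A := B) (B := B.prod B) Λ
  coassoc : (FreeProd.assoc B B B).comp ((FreeProd.map Λ (NonUnitalAlgHom.id ℂ B)).comp Λ) =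
    (FreeProd.map (NonUnitalAlgHom.id ℂ B) Λ).comp Λ
  counit_right : (FreeProd.lift (NonUnitalAlgHom.id ℂ B) 0).comp Λ = NonUnitalAlgHom.id ℂ B
  counit_left : (FreeProd.lift 0 (NonUnitalAlgHom.id ℂ B)).comp Λ = NonUnitalAlgHom.id ℂ B

/-- A comultiplication which turns the `m`-faced `*`-algebra `B` into a `*`-`m`-faced dual
semigroup. -/
structure IsStarDualSemigroup {m : ℕ} (B : FacedStarAlg.{u} m) (Λ : B →ₙₐ[ℂ] FreeProd B B) : Prop
    extends IsDualSemigroup B.toFacedAlg Λ where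
  map_star : ∀ b : B, Λ (star b) = star (Λ b)

/-! ## The Lachs functor and convolution exponentials -/

section Lachs

variable {m d : ℕ}

/-- The transpose `Aᵈ → ℂ`, `(a₁, …, a_d) ↦ φ₁(a₁) + ⋯ + φ_d(a_d)`, of a `d`-valued functional. -/
def Functional.tr {A : Type u} [NonUnitalRing A] [Module ℂ A] (φ : Functional d A) :
    (Fin d → A) →ₗ[ℂ] ℂ :=
  ∑ k, LinearMap.proj k ∘ₗ φ ∘ₗ LinearMap.proj k

/-- The Lachs functor on algebras: the symmetric tensor algebra over `Aᵈ`. -/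
abbrev LachsAlg (d : ℕ) (A : Type u) [NonUnitalRing A] [Module ℂ A] : Type u :=
  SymmetricAlgebra ℂ (Fin d → A)

/-- The Lachs functor on algebra homomorphisms. -/
def lachsMap (d : ℕ) {A B : Type u} [NonUnitalRing A] [Module ℂ A] [NonUnitalRing B] [Module ℂ B]
    (j : A →ₙₐ[ℂ] B) : LachsAlg d A →ₐ[ℂ] LachsAlg d B :=
  SymmetricAlgebra.lift
    (SymmetricAlgebra.ι ℂ (Fin d → B) ∘ₗ (j : A →ₗ[ℂ] B).compLeft (Fin d))

/-- The Lachs functor on functionals: the character `S(φᵗʳ)` of the symmetric tensor algebra which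
extends the transpose of `φ`. -/
def lachs {A : Type u} [NonUnitalRing A] [Module ℂ A] (φ : Functional d A) :
    LachsAlg d A →ₐ[ℂ] ℂ :=
  SymmetricAlgebra.lift φ.tr

/-- The differential Lachs functor: the linear functional `D(ψᵗʳ)` on the symmetric tensor algebra
which extends the transpose of `ψ` and vanishes on products of `n ≠ 1` elements of `Aᵈ`, obtained as
the coefficient of `ε` of the homomorphism to the dual numbers `ℂ[ε]` with `a ↦ ψᵗʳ(a) ε`. -/
def diffLachs {A : Type u} [NonUnitalRing A] [Module ℂ A] (ψ : Functional d A) :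
    LachsAlg d A →ₗ[ℂ] ℂ :=
  TrivSqZeroExt.sndHom ℂ ℂ ∘ₗ
    (SymmetricAlgebra.lift (TrivSqZeroExt.inrHom ℂ ℂ ∘ₗ ψ.tr) :
      LachsAlg d A →ₐ[ℂ] DualNumber ℂ).toLinearMap

/-- The functional `D(ψᵗʳ)` on products of elements of `Aᵈ`. -/
theorem diffLachs_prod {A : Type u} [NonUnitalRing A] [Module ℂ A] (ψ : Functional d A)
    (l : List (Fin d → A)) :
    diffLachs ψ (l.map (SymmetricAlgebra.ι ℂ (Fin d → A))).prod =
      match l with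
      | [a] => ψ.tr a
      | _ => 0 := by
  rcases l with _ | ⟨a, _ | ⟨b, l⟩⟩
  · simp [diffLachs]
  · simp [diffLachs]
  · simp [diffLachs, ← mul_assoc]

/-- The functional `f₁ ⊗ f₂` for characters `f₁`, `f₂`, with `ℂ ⊗ ℂ ≅ ℂ`. -/
def charTensor {S T : Type u} [CommRing S] [Algebra ℂ S] [CommRing T] [Algebra ℂ T]
    (f₁ : S →ₐ[ℂ] ℂ) (f₂ : T →ₐ[ℂ] ℂ) : S ⊗[ℂ] T →ₐ[ℂ] ℂ :=
  (Algebra.TensorProduct.lmul' ℂ (S := ℂ)).comp (Algebra.TensorProduct.map f₁ f₂)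

/-- The component `σ : L(A₁ ⊔ A₂) → L(A₁) ⊗ L(A₂)` of the natural transformation which makes the
Lachs functor colax monoidal with respect to the universal product `P`. It is determined by
`S((φ₁ ⊙ φ₂)ᵗʳ) = (S(φ₁ᵗʳ) ⊗ S(φ₂ᵗʳ)) ∘ σ` for all `φ₁`, `φ₂`. -/
def UniversalProduct.IsLachsTransformation (P : UniversalProduct.{u} m d) (A₁ A₂ : FacedAlg.{u} m)
    (σ : LachsAlg d (FreeProd A₁ A₂) →ₐ[ℂ] LachsAlg d A₁ ⊗[ℂ] LachsAlg d A₂) : Prop :=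
  ∀ (φ₁ : Functional d A₁) (φ₂ : Functional d A₂),
    lachs (P.prod A₁ A₂ φ₁ φ₂) = (charTensor (lachs φ₁) (lachs φ₂)).comp σ

/-- The convolution `f * g = (f ⊗ g) ∘ Δ` of linear functionals with respect to `Δ`. -/
def conv {C : Type u} [AddCommGroup C] [Module ℂ C] (Δ : C →ₗ[ℂ] C ⊗[ℂ] C) (f g : C →ₗ[ℂ] ℂ) :
    C →ₗ[ℂ] ℂ :=
  LinearMap.mul' ℂ ℂ ∘ₗ TensorProduct.map f g ∘ₗ Δ

/-- Convolution powers with respect to `Δ` and the counit `δ`. -/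
def convPow {C : Type u} [AddCommGroup C] [Module ℂ C] (Δ : C →ₗ[ℂ] C ⊗[ℂ] C) (δ f : C →ₗ[ℂ] ℂ) :
    ℕ → C →ₗ[ℂ] ℂ
  | 0 => δ
  | n + 1 => conv Δ (convPow Δ δ f n) f

/-- The comultiplication `Δ = σ ∘ L(Λ)` of the bialgebra `L(B)` of a dual semigroup `(B, Λ)`; its
counit is `S(0)`. -/
def lachsComul {B : FacedAlg.{u} m}
    (σ : LachsAlg d (FreeProd B B) →ₐ[ℂ] LachsAlg d B ⊗[ℂ] LachsAlg d B)
    (Λ : B →ₙₐ[ℂ] FreeProd B B) : LachsAlg d B →ₗ[ℂ] LachsAlg d B ⊗[ℂ] LachsAlg d B :=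
  (σ.comp (lachsMap d Λ)).toLinearMap

/-- `η = exp_⊙(ψ)` is the convolution exponential of `ψ` on the dual semigroup `(B, Λ)`:
`S(ηᵗʳ)` is the convolution exponential, given by the (pointwise convergent) exponential series, of
`D(ψᵗʳ)` on the bialgebra `L(B)`. -/
def UniversalProduct.IsConvExp (P : UniversalProduct.{u} m d) {B : FacedAlg.{u} m}
    (Λ : B →ₙₐ[ℂ] FreeProd B B) (ψ η : Functional d B) : Prop :=
  ∃ σ, P.IsLachsTransformation B B σ ∧
    ∀ x : LachsAlg d B, HasSum
      (fun n : ℕ => ((n.factorial : ℂ))⁻¹ *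
        convPow (lachsComul σ Λ) (lachs (0 : Functional d B)).toLinearMap (diffLachs ψ) n x)
      (lachs η x)

end Lachs

/-! ### Uniqueness of the Lachs transformation and of the convolution exponential -/

section Uniqueness

variable {m d : ℕ}

theorem Functional.exists_tr_eq {A : Type u} [NonUnitalRing A] [Module ℂ A]
    (f : (Fin d → A) →ₗ[ℂ] ℂ) : ∃ φ : Functional d A, φ.tr = f := by
  refine ⟨LinearMap.pi fun k => f ∘ₗ LinearMap.single ℂ (fun _ => A) k, ?_⟩
  refine LinearMap.pi_ext fun k a => ?_
  simp only [Functional.tr, LinearMap.sum_apply, LinearMap.comp_apply, LinearMap.proj_apply,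
    LinearMap.pi_apply, LinearMap.coe_single]
  rw [Finset.sum_eq_single k]
  · simp
  · intro j _ hj
    simp [Pi.single_eq_of_ne hj]
  · simp

theorem Functional.tr_single {A : Type u} [NonUnitalRing A] [Module ℂ A]
    (φ : Functional d A) (k : Fin d) (a : A) : φ.tr (Pi.single k a) = φ a k := by
  simp only [Functional.tr, LinearMap.sum_apply, LinearMap.comp_apply, LinearMap.proj_apply]
  rw [Finset.sum_eq_single k]
  · simp
  · intro j _ hj
    simp [Pi.single_eq_of_ne hj]
  · simp

/-- The characters separate the points of a symmetric tensor algebra. -/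
theorem symm_separating {V : Type u} [AddCommGroup V] [Module ℂ V] (x : SymmetricAlgebra ℂ V)
    (h : ∀ f : V →ₗ[ℂ] ℂ, SymmetricAlgebra.lift f x = 0) : x = 0 := by
  let b := Module.Basis.ofVectorSpace ℂ V
  apply (SymmetricAlgebra.equivMvPolynomial b).injective
  rw [map_zero]
  refine MvPolynomial.funext fun y => ?_
  have key : (MvPolynomial.aeval y).comp (SymmetricAlgebra.equivMvPolynomial b).toAlgHom =
      SymmetricAlgebra.lift (b.constr ℂ y) := by
    apply SymmetricAlgebra.algHom_ext
    refine b.ext fun i => ?_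
    simp
  have := congrArg (fun F => F x) key
  rw [map_zero, ← MvPolynomial.coe_aeval_eq_eval]
  exact this.trans (h _)

theorem tensor_separating {V W : Type u} [AddCommGroup V] [Module ℂ V] [AddCommGroup W]
    [Module ℂ W] (t : SymmetricAlgebra ℂ V ⊗[ℂ] SymmetricAlgebra ℂ W)
    (h : ∀ (f : V →ₗ[ℂ] ℂ) (g : W →ₗ[ℂ] ℂ),
      charTensor (SymmetricAlgebra.lift f) (SymmetricAlgebra.lift g) t = 0) : t = 0 := by
  classical
  let b := Module.Basis.ofVectorSpace ℂ (SymmetricAlgebra ℂ W)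
  have h1 : ∀ f : V →ₗ[ℂ] ℂ, TensorProduct.lid ℂ (SymmetricAlgebra ℂ W)
      (LinearMap.rTensor _ (SymmetricAlgebra.lift f).toLinearMap t) = 0 := by
    intro f
    refine symm_separating _ fun g => ?_
    have key : (SymmetricAlgebra.lift g).toLinearMap ∘ₗ
        (TensorProduct.lid ℂ (SymmetricAlgebra ℂ W)).toLinearMap ∘ₗ
          LinearMap.rTensor _ (SymmetricAlgebra.lift f).toLinearMap =
        (charTensor (SymmetricAlgebra.lift f) (SymmetricAlgebra.lift g)).toLinearMap := by
      refine TensorProduct.ext' fun x y => ?_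
      simp [charTensor]
    exact (congrArg (fun F => F t) key).trans (h f g)
  apply (TensorProduct.equivFinsuppOfBasisRight b).injective
  rw [map_zero]
  ext i
  refine symm_separating _ fun f => ?_
  have key : (SymmetricAlgebra.lift f).toLinearMap ∘ₗ Finsupp.lapply i ∘ₗ
      (TensorProduct.equivFinsuppOfBasisRight (M := SymmetricAlgebra ℂ V) b).toLinearMap =
      b.coord i ∘ₗ (TensorProduct.lid ℂ (SymmetricAlgebra ℂ W)).toLinearMap ∘ₗ
          LinearMap.rTensor _ (SymmetricAlgebra.lift f).toLinearMap := by
    refine TensorProduct.ext' fun x y => ?_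
    simp [mul_comm]
  refine (congrArg (fun F => F t) key).trans ?_
  simp only [LinearMap.comp_apply, LinearEquiv.coe_coe, h1, map_zero]

theorem UniversalProduct.IsLachsTransformation.unique {P : UniversalProduct.{u} m d}
    {A₁ A₂ : FacedAlg.{u} m}
    {σ σ' : LachsAlg d (FreeProd A₁ A₂) →ₐ[ℂ] LachsAlg d A₁ ⊗[ℂ] LachsAlg d A₂}
    (h : P.IsLachsTransformation A₁ A₂ σ) (h' : P.IsLachsTransformation A₁ A₂ σ') : σ = σ' := by
  refine AlgHom.ext fun x => sub_eq_zero.1 (tensor_separating _ fun f g => ?_)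
  obtain ⟨φ, rfl⟩ := Functional.exists_tr_eq f
  obtain ⟨φ', rfl⟩ := Functional.exists_tr_eq g
  have := congrArg (fun F => F x) ((h φ φ').symm.trans (h' φ φ'))
  rw [map_sub, sub_eq_zero]
  exact this

theorem UniversalProduct.IsConvExp.unique {P : UniversalProduct.{u} m d} {B : FacedAlg.{u} m}
    {Λ : B →ₙₐ[ℂ] FreeProd B B} {ψ η η' : Functional d B} (h : P.IsConvExp Λ ψ η)
    (h' : P.IsConvExp Λ ψ η') : η = η' := by
  obtain ⟨σ, hσ, h⟩ := h
  obtain ⟨σ', hσ', h'⟩ := h'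
  obtain rfl := hσ.unique hσ'
  ext b k
  have := (h (SymmetricAlgebra.ι ℂ _ (Pi.single k b))).unique
    (h' (SymmetricAlgebra.ι ℂ _ (Pi.single k b)))
  simpa [lachs, Functional.tr_single] using this

end Uniqueness

/-! ## Positivity -/

section Positivity

variable {m d : ℕ}

/-- The `k`-th component of the unital extension of `φ` to the unitization `ℂ 1 ⊕ A` of `A`. -/
def unitalExt {A : Type u} [NonUnitalRing A] [Module ℂ A] (φ : Functional d A) (k : Fin d)
    (x : Unitization ℂ A) : ℂ :=
  x.fst + φ x.snd k

/-- Restricted states: the unital extension (of every component) is positive. -/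
def IsRestrictedState {A : Type u} [NonUnitalRing A] [Module ℂ A] [StarRing A]
    (φ : Functional d A) : Prop :=
  ∀ (k : Fin d) (x : Unitization ℂ A), 0 ≤ unitalExt φ k (star x * x)

/-- Restricted generating functionals: hermitian and positive on `A` (in every component). -/
def IsRestrictedGenerating {A : Type u} [NonUnitalRing A] [Module ℂ A] [StarRing A]
    (ψ : Functional d A) : Prop :=
  (∀ (k : Fin d) (a : A), ψ (star a) k = star (ψ a k)) ∧
    ∀ (k : Fin d) (a : A), 0 ≤ ψ (star a * a) k

/-- An `m`-`d`-`*`-distribution: a restricted state on an `m`-faced `*`-algebra. -/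
def IsDistribution (A : FacedStarAlg.{u} m) (φ : Functional d A) : Prop :=
  IsRestrictedState φ

namespace UniversalProduct

/-- The powers `φ ⊙ ⋯ ⊙ φ` (`n` factors) with respect to the universal product `P`. -/
def pow (P : UniversalProduct.{u} m d) {A : FacedStarAlg.{u} m} (φ : Functional d A) :
    ∀ n : ℕ, Functional d (A.pow n)
  | 0 => (0 : Functional d (FacedAlg.zero : FacedAlg.{u} m))
  | n + 1 => P.prod (A.pow n).toFacedAlg A.toFacedAlg (P.pow φ n) φ

/-- A universal product is positive if products of `m`-`d`-`*`-distributions are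
`m`-`d`-`*`-distributions. -/
def IsPositive (P : UniversalProduct.{u} m d) : Prop :=
  ∀ (A₁ A₂ : FacedStarAlg.{u} m) (φ₁ : Functional d A₁) (φ₂ : Functional d A₂),
    IsDistribution A₁ φ₁ → IsDistribution A₂ φ₂ → IsDistribution (A₁.prod A₂) (P.prod A₁.toFacedAlg A₂.toFacedAlg φ₁ φ₂)

/-- A universal product is half positive if all powers of an `m`-`d`-`*`-distribution are
`m`-`d`-`*`-distributions. -/
def IsHalfPositive (P : UniversalProduct.{u} m d) : Prop :=
  ∀ (A : FacedStarAlg.{u} m) (φ : Functional d A), IsDistribution A φ →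
    ∀ n : ℕ, IsDistribution (A.pow n) (P.pow φ n)

/-- A universal product is Schoenberg if, on every `*`-`m`-faced dual semigroup, the convolution
exponential of every restricted generating functional is a restricted state. (The convolution
exponential is unique by `IsConvExp.unique`; its existence is part of the assertion.) -/
def IsSchoenberg (P : UniversalProduct.{u} m d) : Prop :=
  ∀ (B : FacedStarAlg.{u} m) (Λ : B →ₙₐ[ℂ] FreeProd B B), IsStarDualSemigroup B Λ →
    ∀ ψ : Functional d B, IsRestrictedGenerating ψ →
      ∃ η : Functional d B, P.IsConvExp (B := B.toFacedAlg) Λ ψ η ∧ IsRestrictedState η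

end UniversalProduct

end Positivity

end

end NCProb

/-! That positive implies half positive is an induction on the number of factors. The substance is
that half positive implies Schoenberg, and the guiding formula is exp_⊙(ψ) = lim φₙ^{⋆n}, where ⋆ is
the convolution of functionals on the dual semigroup and φₙ is any sequence with n φₙ → ψ pointwise.
If the φₙ can be chosen to be restricted states, then half positivity, pulled back along the
iterated comultiplication (a faced *-homomorphism), makes every φₙ^{⋆n} a restricted state, and
positivity survives the pointwise limit.

Existence of σ. It must be shown that (φ₁ ⊙ φ₂)(x) is a polynomial in values of φ₁ and φ₂. By
naturality the question reduces to free algebras with one letter per factor. There each letter is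
replaced by a sum of decorated copies, and the functional by one supported on a single decoration of
each word. Expanding the multilinear expression over the decorations leaves functionals with values
0 and 1 and rescaled letters; the scalars come out by multilinearity and are values of φ
(`natural_multilinear_expansion`). Characters separate the points of L(A₁) ⊗ L(A₂), which turns
these polynomials into an algebra homomorphism (`exists_isLachsTransformation`).

The limit formula. The operators T_φ = (id ⊗ S(φᵗʳ)) ∘ Δ satisfy T_φ T_χ = T_{φ⋆χ} and T_0 = id, so
the orbit of a point spans a finite-dimensional invariant space. Since n (T_{φₙ} − 1) tends to D =
(id ⊗ D(ψᵗʳ)) ∘ Δ there, T_{φₙ}ⁿ tends to exp D by the matrix fact (1 + Aₙ/n)ⁿ → exp A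
(`tendsto_iterate_exp`, `exists_hasSum_and_tendsto`). The limit does not depend on the choice of φₙ,
and as a limit of characters it is a character, so it has the form S(ηᵗʳ) (`exists_isConvExp`).

The approximating states. On B itself such φₙ are not at hand: ψ/n need not be a restricted state,
because ψ(b*b) may vanish while ψ(b) does not. The remedy is to forget the multiplication of the
faces. Let F be the free algebra on the vector spaces underlying the faces of B. Since F is free,
linear maps on the faces extend to F, so F acts by Fock-type operators on ℂ ⊕ B, equipped with the
form z̄w + t ψ(c*c'); the vacuum functional is a restricted state and equals t ψ + O(t²) on words,
with ψ pulled back to F. Taking t = 1/n gives the φₙ, on F (`isRestrictedState_genState`,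
`tendsto_genState`).

Transport. For F to be useful it must be a *-faced dual semigroup over B. The inclusions of a face
into F ⊔ F are now only linear, so they cannot be combined by the universal property of the free
product; the Boolean product of linear maps replaces it. It is associative, natural, unital,
compatible with involutions, and agrees with the universal extension when the maps are
multiplicative; these facts give coassociativity, counits, the *-property and compatibility with F →
B (`boolProd_assoc`, `coverComul_coassoc`, `map_coverMap_coverComul`). Consequently exp_⊙(ψ) pulled
back to F is the convolution exponential of ψ pulled back to F. The latter is a restricted state,
and since F → B is a surjective *-homomorphism, so is exp_⊙(ψ). -/

namespace NCProb

noncomputable section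

set_option linter.unusedSectionVars false

open scoped TensorProduct ComplexOrder

/-! ## Products of nonempty lists in nonunital algebras -/

section ListProd

variable {A B : Type*} [NonUnitalRing A] [NonUnitalRing B]

/-- The product of a nonempty list in a nonunital ring (and `0` for the empty list). -/
def nprod : List A → A
  | [] => 0
  | [a] => a
  | a :: b :: l => a * nprod (b :: l)

@[simp] theorem nprod_nil : nprod ([] : List A) = 0 := rfl

@[simp] theorem nprod_singleton (a : A) : nprod [a] = a := rfl

theorem nprod_cons (a : A) {l : List A} (h : l ≠ []) : nprod (a :: l) = a * nprod l := by
  cases l with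
  | nil => exact absurd rfl h
  | cons b l => rfl

theorem nprod_append {l l' : List A} (h : l ≠ []) (h' : l' ≠ []) :
    nprod (l ++ l') = nprod l * nprod l' := by
  induction l with
  | nil => exact absurd rfl h
  | cons a l ih =>
    rcases eq_or_ne l [] with rfl | hl
    · simp [nprod_cons _ h']
    · rw [List.cons_append, nprod_cons _ (by simp [hl]), ih hl, nprod_cons _ hl, mul_assoc]

variable [Module ℂ A] [Module ℂ B]

theorem map_nprod (j : A →ₙₐ[ℂ] B) (l : List A) : j (nprod l) = nprod (l.map j) := by
  induction l with
  | nil => simp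
  | cons a l ih =>
    rcases eq_or_ne l [] with rfl | hl
    · simp
    · rw [nprod_cons _ hl, map_mul, ih, List.map_cons, nprod_cons _ (by simpa using hl)]

variable [IsScalarTower ℂ A A] [SMulCommClass ℂ A A]

theorem inr_nprod {l : List A} (h : l ≠ []) :
    (Unitization.inr (nprod l) : Unitization ℂ A) = (l.map Unitization.inr).prod := by
  induction l with
  | nil => exact absurd rfl h
  | cons a l ih =>
    rcases eq_or_ne l [] with rfl | hl
    · simp
    · rw [nprod_cons _ hl, Unitization.inr_mul, ih hl, List.map_cons, List.prod_cons]

theorem snd_prod_map_inr (l : List A) :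
    ((l.map (Unitization.inr : A → Unitization ℂ A)).prod).snd = nprod l := by
  rcases eq_or_ne l [] with rfl | h
  · simp
  · rw [← inr_nprod h, Unitization.snd_inr]

variable (A) in
/-- The product of `n` elements as a multilinear map. -/
def nprodMultilinear (n : ℕ) : MultilinearMap ℂ (fun _ : Fin n => A) A :=
  (Unitization.sndHom ℂ ℂ A).compMultilinearMap
    ((MultilinearMap.mkPiAlgebraFin ℂ n (Unitization ℂ A)).compLinearMap
      fun _ => Unitization.inrHom ℂ ℂ A)

@[simp] theorem nprodMultilinear_apply {n : ℕ} (a : Fin n → A) :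
    nprodMultilinear A n a = nprod (List.ofFn a) := by
  rw [← snd_prod_map_inr, List.map_ofFn]
  rfl

end ListProd

/-! ## The nonunital algebra of words -/

/-- The free nonunital algebra generated by `X`. -/
abbrev WordAlg (X : Type u) : Type u := MonoidAlgebra ℂ (FreeSemigroup X)

namespace WordAlg

variable {X Y : Type u}

/-- The generators of the free nonunital algebra. -/
def letter (x : X) : WordAlg X := MonoidAlgebra.single (FreeSemigroup.of x) 1

/-- The product of the letters of a list. -/
def word (l : List X) : WordAlg X := nprod (l.map letter)

theorem word_singleton (x : X) : word [x] = letter x := rfl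

theorem word_cons (x : X) {l : List X} (h : l ≠ []) : word (x :: l) = letter x * word l := by
  simp [word, nprod_cons _ (show l.map letter ≠ [] by simpa using h)]

theorem word_eq_single (x : X) (l : List X) :
    word (x :: l) = MonoidAlgebra.single (⟨x, l⟩ : FreeSemigroup X) 1 := by
  induction l generalizing x with
  | nil => rfl
  | cons y l ih =>
    rw [word_cons _ (by simp), ih, letter, MonoidAlgebra.single_mul_single, one_mul]
    rfl

section lift

variable {C : Type*} [NonUnitalRing C] [Module ℂ C] [IsScalarTower ℂ C C] [SMulCommClass ℂ C C]

/-- The homomorphism which extends a map on the letters. -/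
def lift (g : X → C) : WordAlg X →ₙₐ[ℂ] C := MonoidAlgebra.liftMagma ℂ (FreeSemigroup.lift g)

@[simp] theorem lift_letter (g : X → C) (x : X) : lift g (letter x) = g x := by
  simp [lift, letter]

theorem lift_word (g : X → C) (l : List X) : lift g (word l) = nprod (l.map g) := by
  simp [word, map_nprod, Function.comp_def]

end lift

/-- The linear map with prescribed values on words. -/
def ofWords {M : Type*} [AddCommGroup M] [Module ℂ M] (c : List X → M) : WordAlg X →ₗ[ℂ] M :=
  (MonoidAlgebra.basis (FreeSemigroup X) ℂ).constr ℂ fun w => c (w.head :: w.tail)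

theorem ofWords_word {M : Type*} [AddCommGroup M] [Module ℂ M] (c : List X → M) {l : List X}
    (h : l ≠ []) : ofWords c (word l) = c l := by
  obtain ⟨x, l, rfl⟩ := List.exists_cons_of_ne_nil h
  rw [word_eq_single, ofWords]
  exact (MonoidAlgebra.basis (FreeSemigroup X) ℂ).constr_basis ℂ _ _

theorem linearMap_ext {M : Type*} [AddCommGroup M] [Module ℂ M] {f g : WordAlg X →ₗ[ℂ] M}
    (h : ∀ l ≠ [], f (word l) = g (word l)) : f = g := by
  refine (MonoidAlgebra.basis (FreeSemigroup X) ℂ).ext fun w => ?_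
  have := h (w.head :: w.tail) (by simp)
  rw [word_eq_single] at this
  exact this

/-- Induction: the algebra is spanned by the words. -/
theorem word_induction {p : WordAlg X → Prop} (hw : ∀ l ≠ [], p (word l)) (h0 : p 0)
    (hadd : ∀ x y, p x → p y → p (x + y)) (hsmul : ∀ (c : ℂ) x, p x → p (c • x))
    (x : WordAlg X) : p x := by
  have hx : x ∈ Submodule.span ℂ (Set.range (MonoidAlgebra.basis (FreeSemigroup X) ℂ)) := by
    rw [Module.Basis.span_eq]; trivial
  induction hx using Submodule.span_induction with
  | mem x hx =>
    obtain ⟨w, rfl⟩ := hx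
    have := hw (w.head :: w.tail) (by simp)
    rw [word_eq_single] at this
    exact this
  | zero => exact h0
  | add x y _ _ hx hy => exact hadd x y hx hy
  | smul c x _ hx => exact hsmul c x hx

/-- Induction: the algebra is generated by the letters. -/
theorem letter_induction {p : WordAlg X → Prop} (hl : ∀ x, p (letter x)) (h0 : p 0)
    (hadd : ∀ x y, p x → p y → p (x + y)) (hmul : ∀ x y, p x → p y → p (x * y))
    (hsmul : ∀ (c : ℂ) x, p x → p (c • x)) (x : WordAlg X) : p x := by
  refine word_induction (fun l hl' => ?_) h0 hadd hsmul x
  induction l with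
  | nil => exact absurd rfl hl'
  | cons y l ih =>
    rcases eq_or_ne l [] with rfl | h
    · exact hl y
    · rw [word_cons _ h]
      exact hmul _ _ (hl y) (ih h)

theorem hom_ext {C : Type*} [NonUnitalRing C] [Module ℂ C] {f g : WordAlg X →ₙₐ[ℂ] C}
    (h : ∀ x, f (letter x) = g (letter x)) : f = g := by
  refine NonUnitalAlgHom.ext fun x => ?_
  induction x using letter_induction with
  | hl x => exact h x
  | h0 => simp
  | hadd x y hx hy => simp [hx, hy]
  | hmul x y hx hy => simp [hx, hy]
  | hsmul c x hx => simp [hx]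

/-- The subalgebra generated by the letters of colour `k`. -/
def face {m : ℕ} (κ : X → Fin m) (k : Fin m) : NonUnitalSubalgebra ℂ (WordAlg X) :=
  NonUnitalAlgebra.adjoin ℂ (letter '' {x | κ x = k})

theorem letter_mem_face {m : ℕ} (κ : X → Fin m) (x : X) : letter x ∈ face κ (κ x) :=
  NonUnitalAlgebra.subset_adjoin ℂ ⟨x, rfl, rfl⟩

/-- The free nonunital algebra on coloured letters as a faced algebra. -/
abbrev faced {m : ℕ} (κ : X → Fin m) : FacedAlg.{u} m where
  carrier := WordAlg X
  face := face κ
  freely := by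
    intro C _ _ _ _ f
    refine ⟨lift fun x => f (κ x) ⟨letter x, letter_mem_face κ x⟩, ?_, ?_⟩
    · rintro k ⟨x, hx⟩
      have hx' := hx
      revert hx
      unfold face at hx'
      induction hx' using NonUnitalAlgebra.adjoin_induction with
      | mem x hm =>
        intro hx
        obtain ⟨x, rfl, rfl⟩ := hm
        simp
      | add x y hx hy h1 h2 =>
        intro h
        rw [map_add, h1 hx, h2 hy, ← map_add]
        rfl
      | zero =>
        intro h
        rw [map_zero, ← map_zero (f k)]
        rfl
      | mul x y hx hy h1 h2 =>
        intro h
        rw [map_mul, h1 hx, h2 hy, ← map_mul]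
        rfl
      | smul c x hx h1 =>
        intro h
        rw [map_smul, h1 hx, ← map_smul]
        rfl
    · intro g hg
      refine hom_ext fun x => ?_
      rw [lift_letter]
      exact hg (κ x) ⟨_, letter_mem_face κ x⟩

/-- A homomorphism on the algebra of words is faced if it maps letters into the right faces. -/
theorem isFacedHom {m : ℕ} {κ : X → Fin m} {A : FacedAlg.{u} m} {j : WordAlg X →ₙₐ[ℂ] A}
    (h : ∀ x, j (letter x) ∈ A.face (κ x)) : FacedAlg.IsFacedHom (A := faced κ) j := by
  intro k a ha
  change a ∈ face κ k at ha
  unfold face at ha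
  induction ha using NonUnitalAlgebra.adjoin_induction with
  | mem x hm =>
    obtain ⟨x, rfl, rfl⟩ := hm
    exact h x
  | add x y hx hy h1 h2 => rw [map_add]; exact add_mem h1 h2
  | zero => rw [map_zero]; exact zero_mem _
  | mul x y hx hy h1 h2 => rw [map_mul]; exact mul_mem h1 h2
  | smul c x hx h1 => rw [map_smul]; exact SMulMemClass.smul_mem _ h1

end WordAlg

end

end NCProb

namespace NCProb

noncomputable section

open scoped TensorProduct ComplexOrder

set_option linter.unusedSectionVars false

/-! ## Natural multilinear functions of a functional are polynomials -/

theorem nprod_map_smul {A X : Type*} [NonUnitalRing A] [Module ℂ A] [IsScalarTower ℂ A A]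
    [SMulCommClass ℂ A A] (c : X → ℂ) (g : X → A) (l : List X) :
    nprod (l.map fun x => c x • g x) = (l.map c).prod • nprod (l.map g) := by
  induction l with
  | nil => simp
  | cons x l ih =>
    rcases eq_or_ne l [] with rfl | h
    · simp
    · rw [List.map_cons, nprod_cons _ (by simpa using h), ih, List.map_cons, List.map_cons,
        nprod_cons _ (by simpa using h), List.prod_cons, smul_mul_smul_comm]

/-- A word with a repeated letter can be decorated in such a way that the decoration is not a
function of the letter. -/
theorem exists_inconsistent_decoration {X I : Type*} {α β : I} (hαβ : α ≠ β) {w : List X}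
    (hw : ¬ w.Nodup) :
    ∃ v : List (X × I), v.map Prod.fst = w ∧ ∀ f : X → I, v ≠ w.map fun x => (x, f x) := by
  induction w with
  | nil => simp at hw
  | cons x w ih =>
    by_cases h : w.Nodup
    · have hx : x ∈ w := by
        by_contra hx
        exact hw (List.nodup_cons.2 ⟨hx, h⟩)
      -- `x` occurs again in the tail, where it carries `β`, so its two occurrences are decorated
      -- differently.
      refine ⟨(x, α) :: w.map fun y => (y, β), by simp [Function.comp_def], fun f hf => ?_⟩
      rw [List.map_cons, List.cons.injEq, Prod.mk.injEq] at hf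
      have h1 : β = f x := by
        have := List.map_inj_left.1 hf.2 x hx
        exact (Prod.mk.inj this).2
      exact hαβ (hf.1.2.trans h1.symm)
    · obtain ⟨v, hv, hf⟩ := ih h
      refine ⟨(x, α) :: v, by simp [hv], fun f hf' => ?_⟩
      rw [List.map_cons, List.cons.injEq] at hf'
      exact hf f hf'.2

/-! ### Expansion of a natural multilinear function over decorations -/

section Expansion

variable {ι : Type u} [Fintype ι] [DecidableEq ι] {m d : ℕ}

variable (ι d) in
/-- The possible arguments of the components of a functional on words without repetitions. -/
abbrev Slot : Type u := {l : List ι // l.Nodup} × Fin d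

/-- All letters of `w` are assigned to the slot `(w, k)`. -/
def Filled (f : ι → Slot ι d) (w : List ι) (k : Fin d) : Prop :=
  ∃ h : w.Nodup, ∀ x ∈ w, f x = (⟨w, h⟩, k)

/-- A word without repetitions is decorated constantly by the slot that it defines. A word with
repetitions is decorated inconsistently, so that no choice of one slot per letter ever produces it:
such words do not matter for a function that is linear in each letter separately. -/
theorem exists_decoration (k : Fin d) (w : List ι) :
    ∃ v : List (ι × Slot ι d), v.map Prod.fst = w ∧
      ∀ f : ι → Slot ι d, (v = w.map fun x => (x, f x)) ↔ Filled f w k := by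
  by_cases h : w.Nodup
  · refine ⟨w.map fun x => (x, (⟨w, h⟩, k)), by simp [Function.comp_def], fun f => ?_⟩
    rw [List.map_inj_left]
    constructor
    · intro hf
      exact ⟨h, fun x hx => ((Prod.mk.inj (hf x hx)).2).symm⟩
    · rintro ⟨_, hf⟩ x hx
      rw [hf x hx]
  · obtain ⟨x, hx⟩ : ∃ x, x ∈ w := by
      refine List.exists_mem_of_ne_nil w ?_
      rintro rfl
      exact h List.nodup_nil
    -- Any two different slots will do; the empty word and a one-letter word provide them.
    obtain ⟨v, hv, hf⟩ := exists_inconsistent_decoration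
      (α := ((⟨[], List.nodup_nil⟩, k) : Slot ι d)) (β := (⟨[x], List.nodup_singleton x⟩, k))
      (by simp) h
    exact ⟨v, hv, fun f => ⟨fun h' => absurd h' (hf f), fun h' => absurd h'.1 h⟩⟩

/-- A decoration of the letters of `w` by slots which is a function `f` of the letter if and only if
`f` assigns all letters of `w` to the slot `(w, k)`. -/
def decoration (k : Fin d) (w : List ι) : List (ι × Slot ι d) := (exists_decoration k w).choose

theorem decoration_fst (k : Fin d) (w : List ι) : (decoration k w).map Prod.fst = w :=
  (exists_decoration k w).choose_spec.1

theorem decoration_eq_iff (k : Fin d) (w : List ι) (f : ι → Slot ι d) :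
    (decoration k w = w.map fun x => (x, f x)) ↔ Filled f w k :=
  (exists_decoration k w).choose_spec.2 f

open Classical in
/-- The functional with value `1` on the slots which are filled by `f`. -/
def slotFunctional (f : ι → Slot ι d) : Functional d (WordAlg ι) :=
  WordAlg.ofWords fun w k => if Filled f w k then 1 else 0

open Classical in
/-- The value of `φ` on the slot `f i` if this slot is filled and `i` is its first letter. -/
def slotCoeff (φ : Functional d (WordAlg ι)) (f : ι → Slot ι d) (i : ι) : ℂ :=
  if (f i).1.1.head? = some i then φ (WordAlg.word (f i).1.1) (f i).2 else 1

open Classical in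
/-- The functional on decorated words which is `φ` on the words with the chosen decoration. -/
def decorated (φ : Functional d (WordAlg ι)) : Functional d (WordAlg (ι × Slot ι d)) :=
  WordAlg.ofWords fun v k =>
    if v = decoration k (v.map Prod.fst) then φ (WordAlg.word (v.map Prod.fst)) k else 0

/-- Replacing each letter by the sum of its decorated copies turns a word into the sum of all its
decorations, and for a given component `k` the functional `decorated φ` sees exactly one of them.
Hence nothing of `φ` is lost. -/
theorem decorated_pullback_sum (φ : Functional d (WordAlg ι)) :
    (decorated φ).pullback
      (WordAlg.lift fun i => ∑ α : Slot ι d, WordAlg.letter (i, α)) = φ := by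
  classical
  refine WordAlg.linearMap_ext fun w hw => funext fun k => ?_
  have h1 : WordAlg.lift (fun i => ∑ α : Slot ι d, WordAlg.letter (i, α)) (WordAlg.word w) =
      ∑ r : Fin w.length → Slot ι d, WordAlg.word (List.ofFn fun i => (w.get i, r i)) := by
    rw [WordAlg.lift_word]
    have e : (w.map fun i => ∑ α : Slot ι d, WordAlg.letter (i, α)) =
        List.ofFn fun j : Fin w.length => ∑ α : Slot ι d, WordAlg.letter (w.get j, α) := by
      conv_lhs => rw [← List.ofFn_get w, List.map_ofFn]
      rfl
    rw [e, ← nprodMultilinear_apply, MultilinearMap.map_sum]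
    refine Finset.sum_congr rfl fun r _ => ?_
    rw [nprodMultilinear_apply, WordAlg.word, List.map_ofFn]
    rfl
  have h2 : ∀ r : Fin w.length → Slot ι d,
      (List.ofFn fun i => (w.get i, r i)).map Prod.fst = w := by
    intro r
    rw [List.map_ofFn]
    exact List.ofFn_get w
  have hl : (decoration k w).length = w.length := by
    conv_rhs => rw [← decoration_fst k w, List.length_map]
  have h3 : ∀ r : Fin w.length → Slot ι d,
      (List.ofFn fun i => (w.get i, r i)) = decoration k w ↔
        r = fun i => ((decoration k w).get (i.cast hl.symm)).2 := by
    intro r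
    constructor
    · intro h
      funext i
      simp [← h]
    · rintro rfl
      apply List.ext_get
      · simp [hl]
      · intro n hn hn'
        refine Prod.ext ?_ ?_
        · simp [← (List.getElem_map Prod.fst : ((decoration k w).map Prod.fst)[n]'(by
            simpa using hn') = _), decoration_fst]
        · simp
  simp only [Functional.pullback, LinearMap.comp_apply]
  change decorated φ (WordAlg.lift _ (WordAlg.word w)) k = _
  -- By `h3`, the surviving summand is the one that reads off the slots of `decoration k w`.
  rw [h1, map_sum, Finset.sum_apply,
    Finset.sum_eq_single fun i => ((decoration k w).get (i.cast hl.symm)).2]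
  · rw [decorated, WordAlg.ofWords_word _ (by simpa using hw)]
    simp only [h2]
    rw [if_pos ((h3 _).2 rfl)]
  · intro r _ hr
    rw [decorated, WordAlg.ofWords_word _ (by simpa using hw)]
    simp only [h2]
    rw [if_neg fun h => hr ((h3 r).1 h)]
  · intro h
    exact absurd (Finset.mem_univ _) h

/-- Once a slot is chosen for every letter, a word contributes only if its letters fill the slot
that it defines. The value of `φ` there is charged to the first letter of the word and the other
letters receive the factor 1, so the dependence on `φ` becomes a mere rescaling of letters. Letters
of unfilled slots may be rescaled too, but there both sides vanish. -/
theorem decorated_pullback_choice (φ : Functional d (WordAlg ι)) (f : ι → Slot ι d) :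
    (decorated φ).pullback (WordAlg.lift fun i => WordAlg.letter (i, f i)) =
      (slotFunctional f).pullback
        (WordAlg.lift fun i => slotCoeff φ f i • WordAlg.letter i) := by
  classical
  refine WordAlg.linearMap_ext fun w hw => funext fun k => ?_
  change decorated φ (WordAlg.lift _ (WordAlg.word w)) k =
    slotFunctional f (WordAlg.lift _ (WordAlg.word w)) k
  have e1 : WordAlg.lift (fun i => WordAlg.letter (i, f i)) (WordAlg.word w) =
      WordAlg.word (w.map fun i => (i, f i)) := by
    rw [WordAlg.lift_word, WordAlg.word, List.map_map]
    rfl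
  have e2 : WordAlg.lift (fun i => slotCoeff φ f i • WordAlg.letter i) (WordAlg.word w) =
      (w.map (slotCoeff φ f)).prod • WordAlg.word w := by
    rw [WordAlg.lift_word, nprod_map_smul]
    rfl
  have e3 : (w.map fun i => (i, f i)).map Prod.fst = w := by simp [Function.comp_def]
  rw [e1, e2, map_smul, decorated, slotFunctional, WordAlg.ofWords_word _ (by simpa using hw),
    WordAlg.ofWords_word _ hw]
  simp only [e3, Pi.smul_apply, smul_eq_mul, eq_comm (b := decoration k w), decoration_eq_iff]
  by_cases hf : Filled f w k
  · rw [if_pos hf, if_pos hf, mul_one]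
    obtain ⟨hn, hf⟩ := hf
    obtain ⟨x, l, rfl⟩ := List.exists_cons_of_ne_nil hw
    have hx : slotCoeff φ f x = φ (WordAlg.word (x :: l)) k := by
      simp [slotCoeff, hf x (by simp)]
    have hl : (l.map (slotCoeff φ f)).prod = 1 := by
      refine List.prod_eq_one fun c hc => ?_
      obtain ⟨y, hy, rfl⟩ := List.mem_map.1 hc
      have hxy : x ≠ y := by
        rintro rfl
        exact (List.nodup_cons.1 hn).1 hy
      simp [slotCoeff, hf y (by simp [hy]), hxy]
    rw [List.map_cons, List.prod_cons, hl, mul_one, hx]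
  · rw [if_neg hf, if_neg hf, mul_zero]

/-- A natural multilinear function of a functional is a polynomial in its values: the expansion. -/
theorem natural_multilinear_expansion (κ : ι → Fin m)
    (T : ∀ A : FacedAlg.{u} m, Functional d A → MultilinearMap ℂ (fun _ : ι => A.carrier) ℂ)
    (hT : ∀ (A B : FacedAlg.{u} m) (φ : Functional d B) (j : A →ₙₐ[ℂ] B),
      FacedAlg.IsFacedHom j → ∀ a, T A (φ.pullback j) a = T B φ fun i => j (a i))
    (A : FacedAlg.{u} m) (φ : Functional d A) (a : ι → A) (ha : ∀ i, a i ∈ A.face (κ i)) :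
    T A φ a = ∑ f : ι → Slot ι d,
      (∏ i, slotCoeff (φ.pullback (WordAlg.lift a)) f i) *
        T (WordAlg.faced κ) (slotFunctional f) WordAlg.letter := by
  -- Naturality along the homomorphism that sends the letter `i` to `a i` reduces the claim to the
  -- free algebra.
  have h0 : T A φ a = T (WordAlg.faced κ) (φ.pullback (WordAlg.lift a)) WordAlg.letter := by
    rw [hT (WordAlg.faced κ) A φ (WordAlg.lift a) (WordAlg.isFacedHom fun x => by
      rw [WordAlg.lift_letter]; exact ha x)]
    simp
  rw [h0]
  set χ : Functional d (WordAlg ι) := φ.pullback (WordAlg.lift a) with hχ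
  have hκ : ∀ (i : ι) (α : Slot ι d), (WordAlg.letter (i, α) : WordAlg (ι × Slot ι d)) ∈
      (WordAlg.faced fun z : ι × Slot ι d => κ z.1).face (κ i) := fun i α =>
    WordAlg.letter_mem_face (fun z : ι × Slot ι d => κ z.1) (i, α)
  -- The arguments become sums over slots, so multilinearity yields one term for each choice `f` of
  -- a slot per letter.
  have h1 := hT (WordAlg.faced κ) (WordAlg.faced fun z : ι × Slot ι d => κ z.1) (decorated χ)
    (WordAlg.lift fun i => ∑ α : Slot ι d, WordAlg.letter (i, α))
    (WordAlg.isFacedHom fun x => by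
      rw [WordAlg.lift_letter]
      exact sum_mem fun α _ => hκ x α) WordAlg.letter
  rw [decorated_pullback_sum] at h1
  rw [h1]
  simp only [WordAlg.lift_letter]
  rw [MultilinearMap.map_sum]
  refine Finset.sum_congr rfl fun f _ => ?_
  -- Naturality again: a single term is the value of `T` at the functional pulled back along the
  -- choice `f`.
  have h2 := hT (WordAlg.faced κ) (WordAlg.faced fun z : ι × Slot ι d => κ z.1) (decorated χ)
    (WordAlg.lift fun i => WordAlg.letter (i, f i))
    (WordAlg.isFacedHom fun x => by
      rw [WordAlg.lift_letter]
      exact hκ x (f x)) WordAlg.letter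
  simp only [WordAlg.lift_letter] at h2
  rw [← h2, decorated_pullback_choice]
  -- Rescaling letters is a faced homomorphism, so the scalars move from the functional to the
  -- arguments and come out by multilinearity.
  have h3 := hT (WordAlg.faced κ) (WordAlg.faced κ) (slotFunctional f)
    (WordAlg.lift fun i => slotCoeff χ f i • WordAlg.letter i)
    (WordAlg.isFacedHom fun x => by
      rw [WordAlg.lift_letter]
      exact SMulMemClass.smul_mem _ (WordAlg.letter_mem_face κ x)) WordAlg.letter
  simp only [WordAlg.lift_letter] at h3
  rw [h3, MultilinearMap.map_smul_univ, smul_eq_mul]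

end Expansion

end

end NCProb

namespace NCProb

noncomputable section

open scoped TensorProduct ComplexOrder

set_option linter.unusedSectionVars false

/-! ## Existence of the Lachs transformation -/

/-! ### Polynomial functions of two functionals -/

section PolynomialFunctions

variable {d : ℕ} {A₁ A₂ : Type u} [NonUnitalRing A₁] [Module ℂ A₁] [NonUnitalRing A₂] [Module ℂ A₂]

/-- Functions of two functionals which are polynomials in their values. -/
def IsPolynomial (h : Functional d A₁ → Functional d A₂ → ℂ) : Prop :=
  ∃ t : LachsAlg d A₁ ⊗[ℂ] LachsAlg d A₂, ∀ φ₁ φ₂, h φ₁ φ₂ = charTensor (lachs φ₁) (lachs φ₂) t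

namespace IsPolynomial

theorem const (c : ℂ) : IsPolynomial fun (_ : Functional d A₁) (_ : Functional d A₂) => c :=
  ⟨algebraMap ℂ _ c, fun φ₁ φ₂ => by simp [-Algebra.TensorProduct.algebraMap_apply]⟩

theorem add {h h' : Functional d A₁ → Functional d A₂ → ℂ} (H : IsPolynomial h)
    (H' : IsPolynomial h') : IsPolynomial fun φ₁ φ₂ => h φ₁ φ₂ + h' φ₁ φ₂ := by
  obtain ⟨t, ht⟩ := H
  obtain ⟨t', ht'⟩ := H'
  exact ⟨t + t', fun φ₁ φ₂ => by simp only [map_add, ht, ht']⟩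

theorem mul {h h' : Functional d A₁ → Functional d A₂ → ℂ} (H : IsPolynomial h)
    (H' : IsPolynomial h') : IsPolynomial fun φ₁ φ₂ => h φ₁ φ₂ * h' φ₁ φ₂ := by
  obtain ⟨t, ht⟩ := H
  obtain ⟨t', ht'⟩ := H'
  exact ⟨t * t', fun φ₁ φ₂ => by simp only [map_mul, ht, ht']⟩

theorem sum {I : Type*} (s : Finset I) {h : I → Functional d A₁ → Functional d A₂ → ℂ}
    (H : ∀ i, IsPolynomial (h i)) : IsPolynomial fun φ₁ φ₂ => ∑ i ∈ s, h i φ₁ φ₂ := by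
  classical
  induction s using Finset.induction_on with
  | empty => simpa using const 0
  | insert i s hi ih => simpa only [Finset.sum_insert hi] using (H i).add ih

theorem prod {I : Type*} (s : Finset I) {h : I → Functional d A₁ → Functional d A₂ → ℂ}
    (H : ∀ i, IsPolynomial (h i)) : IsPolynomial fun φ₁ φ₂ => ∏ i ∈ s, h i φ₁ φ₂ := by
  classical
  induction s using Finset.induction_on with
  | empty => simpa using const 1
  | insert i s hi ih => simpa only [Finset.prod_insert hi] using (H i).mul ih

theorem left (a : A₁) (k : Fin d) :
    IsPolynomial fun (φ₁ : Functional d A₁) (_ : Functional d A₂) => φ₁ a k :=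
  ⟨SymmetricAlgebra.ι ℂ _ (Pi.single k a) ⊗ₜ 1, fun φ₁ φ₂ => by
    simp [charTensor, lachs, Functional.tr_single]⟩

theorem right (a : A₂) (k : Fin d) :
    IsPolynomial fun (_ : Functional d A₁) (φ₂ : Functional d A₂) => φ₂ a k :=
  ⟨1 ⊗ₜ SymmetricAlgebra.ι ℂ _ (Pi.single k a), fun φ₁ φ₂ => by
    simp [charTensor, lachs, Functional.tr_single]⟩

end IsPolynomial

end PolynomialFunctions

/-! ### Words in a free product as multilinear functions of each group of factors -/

section MixedWords

variable {A₁ A₂ : Type u}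
  [NonUnitalRing A₁] [Module ℂ A₁] [IsScalarTower ℂ A₁ A₁] [SMulCommClass ℂ A₁ A₁]
  [NonUnitalRing A₂] [Module ℂ A₂] [IsScalarTower ℂ A₂ A₂] [SMulCommClass ℂ A₂ A₂]

/-- The product of the elements `a i` at the positions in `s` and `b i` at the other positions, in
the free product. -/
def mixedWord {n : ℕ} (s : Fin n → Prop) [DecidablePred s]
    (a : ULift.{u} {i // s i} → A₁) (b : ULift.{u} {i // ¬ s i} → A₂) : FreeProd A₁ A₂ :=
  nprod (List.ofFn fun i => if h : s i then FreeProd.inl (a ⟨i, h⟩) else FreeProd.inr (b ⟨i, h⟩))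

/-- `mixedWord` as a multilinear map in the elements of the left factor. -/
def mixedWordLeft {n : ℕ} (s : Fin n → Prop) [DecidablePred s]
    (b : ULift.{u} {i // ¬ s i} → A₂) :
    MultilinearMap ℂ (fun _ : ULift.{u} {i // s i} => A₁) (FreeProd A₁ A₂) :=
  (((nprodMultilinear (FreeProd A₁ A₂) n).domDomRestrict s
    fun i => FreeProd.inr (b ⟨i⟩)).domDomCongr Equiv.ulift.symm).compLinearMap
      fun _ => ((FreeProd.inl : A₁ →ₙₐ[ℂ] FreeProd A₁ A₂) : A₁ →ₗ[ℂ] FreeProd A₁ A₂)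

/-- `mixedWord` as a multilinear map in the elements of the right factor. -/
def mixedWordRight {n : ℕ} (s : Fin n → Prop) [DecidablePred s]
    (a : ULift.{u} {i // s i} → A₁) :
    MultilinearMap ℂ (fun _ : ULift.{u} {i // ¬ s i} => A₂) (FreeProd A₁ A₂) :=
  (((nprodMultilinear (FreeProd A₁ A₂) n).domDomRestrict (fun i => ¬ s i)
    fun i => FreeProd.inl (a ⟨i, not_not.1 i.2⟩)).domDomCongr Equiv.ulift.symm).compLinearMap
      fun _ => ((FreeProd.inr : A₂ →ₙₐ[ℂ] FreeProd A₁ A₂) : A₂ →ₗ[ℂ] FreeProd A₁ A₂)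

theorem mixedWordLeft_apply {n : ℕ} (s : Fin n → Prop) [DecidablePred s]
    (a : ULift.{u} {i // s i} → A₁) (b : ULift.{u} {i // ¬ s i} → A₂) :
    mixedWordLeft s b a = mixedWord s a b := by
  simp [mixedWordLeft, mixedWord, MultilinearMap.domDomRestrict_apply]

theorem mixedWordRight_apply {n : ℕ} (s : Fin n → Prop) [DecidablePred s]
    (a : ULift.{u} {i // s i} → A₁) (b : ULift.{u} {i // ¬ s i} → A₂) :
    mixedWordRight s a b = mixedWord s a b := by
  simp only [mixedWordRight, mixedWord, MultilinearMap.compLinearMap_apply,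
    MultilinearMap.domDomCongr_apply, MultilinearMap.domDomRestrict_apply, nprodMultilinear_apply]
  congr 2
  funext i
  by_cases h : s i <;> simp [h]

theorem map_mixedWord {B₁ B₂ : Type u}
    [NonUnitalRing B₁] [Module ℂ B₁] [IsScalarTower ℂ B₁ B₁] [SMulCommClass ℂ B₁ B₁]
    [NonUnitalRing B₂] [Module ℂ B₂] [IsScalarTower ℂ B₂ B₂] [SMulCommClass ℂ B₂ B₂]
    {n : ℕ} (s : Fin n → Prop) [DecidablePred s] (j₁ : A₁ →ₙₐ[ℂ] B₁) (j₂ : A₂ →ₙₐ[ℂ] B₂)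
    (a : ULift.{u} {i // s i} → A₁) (b : ULift.{u} {i // ¬ s i} → A₂) :
    FreeProd.map j₁ j₂ (mixedWord s a b) =
      mixedWord s (fun i => j₁ (a i)) (fun i => j₂ (b i)) := by
  simp only [mixedWord, map_nprod, List.map_ofFn]
  congr 2
  funext i
  by_cases h : s i <;> simp [h, FreeProd.map]

end MixedWords

/-- The universal property gives a homomorphism into the subalgebra generated by the faces; followed
by the inclusion it fixes every face, so by uniqueness it is the identity. -/
theorem FacedAlg.adjoin_faces {m : ℕ} (A : FacedAlg.{u} m) :
    NonUnitalAlgebra.adjoin ℂ (⋃ k, (A.face k : Set A)) = ⊤ := by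
  set S := NonUnitalAlgebra.adjoin ℂ (⋃ k, (A.face k : Set A)) with hS
  have hk : ∀ k, A.face k ≤ S := fun k a ha =>
    NonUnitalAlgebra.subset_adjoin ℂ (Set.mem_iUnion.2 ⟨k, ha⟩)
  obtain ⟨g, hg, -⟩ := A.freely S fun k => NonUnitalSubalgebra.inclusion (hk k)
  have : (NonUnitalSubalgebraClass.subtype S).comp g = NonUnitalAlgHom.id ℂ A :=
    FacedAlg.hom_ext fun k a ha => congrArg Subtype.val (hg k ⟨a, ha⟩)
  rw [eq_top_iff]
  intro a _
  have h := congrArg (fun F => F a) this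
  rw [← show ((g a : S) : A) = a from h]
  exact (g a).2

/-- The free product is spanned by products of elements of the faces. -/
theorem FacedAlg.span_nprod {m : ℕ} (A₁ A₂ : FacedAlg.{u} m) :
    Submodule.span ℂ {x : FreeProd A₁ A₂ | ∃ l : List (FreeProd A₁ A₂), l ≠ [] ∧
      (∀ y ∈ l, (∃ k, ∃ a ∈ A₁.face k, FreeProd.inl a = y) ∨
        ∃ k, ∃ b ∈ A₂.face k, FreeProd.inr b = y) ∧ nprod l = x} = ⊤ := by
  set G : Set (FreeProd A₁ A₂) := {y | (∃ k, ∃ a ∈ A₁.face k, FreeProd.inl a = y) ∨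
        ∃ k, ∃ b ∈ A₂.face k, FreeProd.inr b = y} with hG
  have h1 : NonUnitalAlgebra.adjoin ℂ G = ⊤ := by
    rw [eq_top_iff]
    intro x hmem
    induction x using FreeProd.induction with
    | hl a =>
      have ha : a ∈ NonUnitalAlgebra.adjoin ℂ (⋃ k, (A₁.face k : Set A₁)) := by
        rw [A₁.adjoin_faces]; trivial
      clear hmem
      induction ha using NonUnitalAlgebra.adjoin_induction with
      | mem x hm =>
        obtain ⟨k, hk⟩ := Set.mem_iUnion.1 hm
        exact NonUnitalAlgebra.subset_adjoin ℂ (Or.inl ⟨k, x, hk, rfl⟩)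
      | add x y hx hy h1 h2 => rw [map_add]; exact add_mem h1 h2
      | zero => rw [map_zero]; exact zero_mem _
      | mul x y hx hy h1 h2 => rw [map_mul]; exact mul_mem h1 h2
      | smul c x hx h => rw [map_smul]; exact SMulMemClass.smul_mem _ h
    | hr b =>
      have hb : b ∈ NonUnitalAlgebra.adjoin ℂ (⋃ k, (A₂.face k : Set A₂)) := by
        rw [A₂.adjoin_faces]; trivial
      clear hmem
      induction hb using NonUnitalAlgebra.adjoin_induction with
      | mem x hm =>
        obtain ⟨k, hk⟩ := Set.mem_iUnion.1 hm
        exact NonUnitalAlgebra.subset_adjoin ℂ (Or.inr ⟨k, x, hk, rfl⟩)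
      | add x y hx hy h1 h2 => rw [map_add]; exact add_mem h1 h2
      | zero => rw [map_zero]; exact zero_mem _
      | mul x y hx hy h1 h2 => rw [map_mul]; exact mul_mem h1 h2
      | smul c x hx h => rw [map_smul]; exact SMulMemClass.smul_mem _ h
    | h0 => exact zero_mem _
    | hadd x y hx hy => exact add_mem (hx trivial) (hy trivial)
    | hmul x y hx hy => exact mul_mem (hx trivial) (hy trivial)
    | hsmul c x hx => exact SMulMemClass.smul_mem _ (hx trivial)
  rw [eq_top_iff]
  intro x _
  have hx : x ∈ (NonUnitalAlgebra.adjoin ℂ G).toSubmodule := by rw [h1]; trivial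
  rw [NonUnitalAlgebra.adjoin_eq_span] at hx
  refine Submodule.span_mono ?_ hx
  intro y hy
  induction hy using Subsemigroup.closure_induction with
  | mem y hy => exact ⟨[y], by simp, fun z hz => by rw [List.mem_singleton.1 hz]; exact hy, rfl⟩
  | mul x y _ _ hx hy =>
    obtain ⟨l, hl, hl', rfl⟩ := hx
    obtain ⟨l', hl1, hl1', rfl⟩ := hy
    refine ⟨l ++ l', by simp [hl], fun z hz => ?_, nprod_append hl hl1⟩
    rcases List.mem_append.1 hz with hz | hz
    · exact hl' z hz
    · exact hl1' z hz

/-! ### Universal products are polynomial, and the Lachs transformation exists -/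

namespace UniversalProduct

variable {m d : ℕ} (P : UniversalProduct.{u} m d)

theorem map_slotCoeff_isPolynomial_left {A₁ A₂ : FacedAlg.{u} m} {ι : Type u} [Fintype ι]
    [DecidableEq ι] (a : ι → A₁) (f : ι → Slot ι d) (i : ι) :
    IsPolynomial fun (φ₁ : Functional d A₁) (_ : Functional d A₂) =>
      slotCoeff (φ₁.pullback (WordAlg.lift a)) f i := by
  unfold slotCoeff
  split_ifs with h
  · exact IsPolynomial.left _ _
  · exact IsPolynomial.const 1

theorem map_slotCoeff_isPolynomial_right {A₁ A₂ : FacedAlg.{u} m} {ι : Type u} [Fintype ι]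
    [DecidableEq ι] (a : ι → A₂) (f : ι → Slot ι d) (i : ι) :
    IsPolynomial fun (_ : Functional d A₁) (φ₂ : Functional d A₂) =>
      slotCoeff (φ₂.pullback (WordAlg.lift a)) f i := by
  unfold slotCoeff
  split_ifs with h
  · exact IsPolynomial.right _ _
  · exact IsPolynomial.const 1

theorem id_isFacedHom (A : FacedAlg.{u} m) : FacedAlg.IsFacedHom (NonUnitalAlgHom.id ℂ A) :=
  fun _ _ ha => ha

theorem prod_pullback_left {A B A₂ : FacedAlg.{u} m} (φ : Functional d B) (φ₂ : Functional d A₂)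
    {j : A →ₙₐ[ℂ] B} (hj : FacedAlg.IsFacedHom j) :
    P.prod A A₂ (φ.pullback j) φ₂ =
      (P.prod B A₂ φ φ₂).pullback (FreeProd.map j (NonUnitalAlgHom.id ℂ A₂)) :=
  P.universality A A₂ B A₂ φ φ₂ j (NonUnitalAlgHom.id ℂ A₂) hj (id_isFacedHom A₂)

theorem prod_pullback_right {A₁ A B : FacedAlg.{u} m} (φ₁ : Functional d A₁) (φ : Functional d B)
    {j : A →ₙₐ[ℂ] B} (hj : FacedAlg.IsFacedHom j) :
    P.prod A₁ A φ₁ (φ.pullback j) =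
      (P.prod A₁ B φ₁ φ).pullback (FreeProd.map (NonUnitalAlgHom.id ℂ A₁) j) :=
  P.universality A₁ A A₁ B φ₁ φ (NonUnitalAlgHom.id ℂ A₁) j (id_isFacedHom A₁) hj

/-- The expansion is applied twice, first in the factors from `A₁` with `φ₂` fixed, then in the
factors from `A₂` with the first functional already replaced by a slot functional. What remains
besides coefficients is a constant that depends on neither functional. -/
theorem isPolynomial_mixedWord {A₁ A₂ : FacedAlg.{u} m} {n : ℕ} (s : Fin n → Prop)
    [DecidablePred s] (a : ULift.{u} {i // s i} → A₁) (b : ULift.{u} {i // ¬ s i} → A₂)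
    (κ : ULift.{u} {i // s i} → Fin m) (κ' : ULift.{u} {i // ¬ s i} → Fin m)
    (ha : ∀ i, a i ∈ A₁.face (κ i)) (hb : ∀ i, b i ∈ A₂.face (κ' i)) (k : Fin d) :
    IsPolynomial fun φ₁ φ₂ => P.prod A₁ A₂ φ₁ φ₂ (mixedWord s a b) k := by
  classical
  have hl : ∀ φ₁ φ₂, P.prod A₁ A₂ φ₁ φ₂ (mixedWord s a b) k =
      ∑ f, (∏ i, slotCoeff (φ₁.pullback (WordAlg.lift a)) f i) *
        P.prod (WordAlg.faced κ) A₂ (slotFunctional f) φ₂ (mixedWord s WordAlg.letter b) k := by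
    intro φ₁ φ₂
    have := natural_multilinear_expansion κ (fun A φ => (LinearMap.proj k ∘ₗ
      P.prod A A₂ φ φ₂).compMultilinearMap (mixedWordLeft s b)) (by
        intro A B φ j hj a
        simp only [LinearMap.compMultilinearMap_apply, mixedWordLeft_apply, LinearMap.comp_apply,
          LinearMap.proj_apply]
        rw [prod_pullback_left P φ φ₂ hj]
        change P.prod B A₂ φ φ₂ (FreeProd.map j _ _) k = _
        rw [map_mixedWord]
        rfl) A₁ φ₁ a ha
    simpa only [LinearMap.compMultilinearMap_apply, mixedWordLeft_apply, LinearMap.comp_apply,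
          LinearMap.proj_apply] using this
  have hr : ∀ f φ₂,
      P.prod (WordAlg.faced κ) A₂ (slotFunctional f) φ₂ (mixedWord s WordAlg.letter b) k =
      ∑ g, (∏ i, slotCoeff (φ₂.pullback (WordAlg.lift b)) g i) *
        P.prod (WordAlg.faced κ) (WordAlg.faced κ') (slotFunctional f) (slotFunctional g)
          (mixedWord s WordAlg.letter WordAlg.letter) k := by
    intro f φ₂
    have := natural_multilinear_expansion κ' (fun A φ => (LinearMap.proj k ∘ₗ
      P.prod (WordAlg.faced κ) A (slotFunctional f) φ).compMultilinearMap
        (mixedWordRight s WordAlg.letter)) (by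
        intro A B φ j hj a
        simp only [LinearMap.compMultilinearMap_apply, mixedWordRight_apply, LinearMap.comp_apply,
          LinearMap.proj_apply]
        rw [prod_pullback_right P (A₁ := WordAlg.faced κ) (slotFunctional f) φ hj]
        change P.prod (WordAlg.faced κ) B (slotFunctional f) φ (FreeProd.map _ j _) k = _
        rw [map_mixedWord]
        rfl) A₂ φ₂ b hb
    simpa only [LinearMap.compMultilinearMap_apply, mixedWordRight_apply, LinearMap.comp_apply,
          LinearMap.proj_apply] using this
  simp only [hl, hr]
  refine IsPolynomial.sum _ fun f => IsPolynomial.mul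
    (IsPolynomial.prod _ fun i => map_slotCoeff_isPolynomial_left a f i)
    (IsPolynomial.sum _ fun g => IsPolynomial.mul
      (IsPolynomial.prod _ fun i => map_slotCoeff_isPolynomial_right b g i)
      (IsPolynomial.const _))

/-- The values of universal products are polynomials in the values of the factors. -/
theorem isPolynomial_prod (A₁ A₂ : FacedAlg.{u} m) (x : FreeProd A₁ A₂) (k : Fin d) :
    IsPolynomial fun φ₁ φ₂ => P.prod A₁ A₂ φ₁ φ₂ x k := by
  classical
  have hx := Submodule.mem_top (R := ℂ) (x := x)
  rw [← FacedAlg.span_nprod] at hx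
  induction hx using Submodule.span_induction with
  | mem x hx =>
    obtain ⟨l, hl, h, rfl⟩ := hx
    -- The positions whose factor comes from a face of `A₁`; by `h` all others come from a face of
    -- `A₂`.
    let s : Fin l.length → Prop := fun i => ∃ k, ∃ a ∈ A₁.face k, FreeProd.inl a = l.get i
    have h1 : ∀ i : ULift.{u} {i // s i}, ∃ k, ∃ a ∈ A₁.face k, FreeProd.inl a = l.get i.down :=
      fun i => i.down.2
    have h2 : ∀ i : ULift.{u} {i // ¬ s i}, ∃ k, ∃ b ∈ A₂.face k, FreeProd.inr b = l.get i.down :=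
      fun i => (h _ (List.get_mem l _)).resolve_left i.down.2
    choose κ a ha ha' using h1
    choose κ' b hb hb' using h2
    have e : nprod l = mixedWord s a b := by
      rw [mixedWord]
      congr 1
      conv_lhs => rw [← List.ofFn_get l]
      congr 1
      funext i
      by_cases hi : s i
      · rw [dif_pos hi]
        exact (ha' ⟨i, hi⟩).symm
      · rw [dif_neg hi]
        exact (hb' ⟨i, hi⟩).symm
    rw [e]
    exact isPolynomial_mixedWord P s a b κ κ' ha hb k
  | zero => simpa using IsPolynomial.const 0
  | add x y _ _ hx hy => simpa using hx.add hy
  | smul c x _ hx => simpa using (IsPolynomial.const c).mul hx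

theorem charTensor_lachs_separating {A₁ A₂ : Type u} [NonUnitalRing A₁] [Module ℂ A₁]
    [NonUnitalRing A₂] [Module ℂ A₂] {t t' : LachsAlg d A₁ ⊗[ℂ] LachsAlg d A₂}
    (h : ∀ φ₁ φ₂, charTensor (lachs φ₁) (lachs φ₂) t = charTensor (lachs φ₁) (lachs φ₂) t') :
    t = t' := by
  refine sub_eq_zero.1 (tensor_separating _ fun f g => ?_)
  obtain ⟨φ, rfl⟩ := Functional.exists_tr_eq f
  obtain ⟨φ', rfl⟩ := Functional.exists_tr_eq g
  rw [map_sub, sub_eq_zero]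
  exact h φ φ'

/-- The polynomials expressing the values of the product at `x` form an element of the tensor
product. Pairs of characters separate points, so this element is unique, hence linear in `x`, and
the universal property of the symmetric algebra extends it to a homomorphism. -/
theorem exists_isLachsTransformation (A₁ A₂ : FacedAlg.{u} m) :
    ∃ σ, P.IsLachsTransformation A₁ A₂ σ := by
  choose t ht' using P.isPolynomial_prod A₁ A₂
  have ht : ∀ x k φ₁ φ₂, P.prod A₁ A₂ φ₁ φ₂ x k = charTensor (lachs φ₁) (lachs φ₂) (t x k) := ht'
  let τ : Fin d → FreeProd A₁ A₂ →ₗ[ℂ] LachsAlg d A₁ ⊗[ℂ] LachsAlg d A₂ := fun k =>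
    { toFun := fun x => t x k
      map_add' := fun x y => charTensor_lachs_separating fun φ₁ φ₂ => by
        rw [map_add, ← ht, ← ht, ← ht, map_add, Pi.add_apply]
      map_smul' := fun c x => charTensor_lachs_separating fun φ₁ φ₂ => by
        rw [RingHom.id_apply, map_smul, ← ht, ← ht, map_smul, Pi.smul_apply] }
  refine ⟨SymmetricAlgebra.lift (∑ k, τ k ∘ₗ LinearMap.proj k), fun φ₁ φ₂ => ?_⟩
  refine SymmetricAlgebra.algHom_ext (LinearMap.ext fun v => ?_)
  change SymmetricAlgebra.lift _ (SymmetricAlgebra.ι ℂ _ v) =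
    charTensor _ _ (SymmetricAlgebra.lift _ (SymmetricAlgebra.ι ℂ _ v))
  rw [SymmetricAlgebra.lift_ι_apply, SymmetricAlgebra.lift_ι_apply, LinearMap.sum_apply, map_sum,
    Functional.tr, LinearMap.sum_apply]
  exact Finset.sum_congr rfl fun k _ => ht (v k) k φ₁ φ₂

end UniversalProduct

end

end NCProb

namespace NCProb

noncomputable section

open scoped TensorProduct ComplexOrder

set_option linter.unusedSectionVars false

/-! ## Exponential limits of locally finite operators -/

section Exponential

open Filter Topology

/-- Telescoping. The norm of 1 is only assumed to be at most 1, so that operators on the zero space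
are included. -/
theorem norm_pow_sub_pow_le_mul {𝔸 : Type*} [NormedRing 𝔸] (h1 : ‖(1 : 𝔸)‖ ≤ 1) {X Y : 𝔸} {M : ℝ}
    (hM : 1 ≤ M) (hX : ‖X‖ ≤ M) (hY : ‖Y‖ ≤ M) (n : ℕ) :
    ‖X ^ n - Y ^ n‖ ≤ M ^ n * (n * ‖X - Y‖) := by
  have hM0 : 0 ≤ M := zero_le_one.trans hM
  have hYn : ∀ n : ℕ, ‖Y ^ n‖ ≤ M ^ n := by
    intro n
    induction n with
    | zero => simpa using h1
    | succ n ih =>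
      rw [pow_succ, pow_succ]
      exact (norm_mul_le _ _).trans (mul_le_mul ih hY (norm_nonneg _) (pow_nonneg hM0 n))
  induction n with
  | zero => simp
  | succ n ih =>
    have e : X ^ (n + 1) - Y ^ (n + 1) = X * (X ^ n - Y ^ n) + (X - Y) * Y ^ n := by
      rw [pow_succ', pow_succ']
      noncomm_ring
    have a1 : ‖X * (X ^ n - Y ^ n)‖ ≤ M * (M ^ n * (n * ‖X - Y‖)) :=
      (norm_mul_le _ _).trans (mul_le_mul hX ih (norm_nonneg _) hM0)
    have a2 : ‖(X - Y) * Y ^ n‖ ≤ ‖X - Y‖ * M ^ n :=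
      (norm_mul_le _ _).trans (mul_le_mul_of_nonneg_left (hYn n) (norm_nonneg _))
    have a3 : ‖X - Y‖ * M ^ n ≤ ‖X - Y‖ * M ^ (n + 1) :=
      mul_le_mul_of_nonneg_left (pow_le_pow_right₀ hM (Nat.le_succ n)) (norm_nonneg _)
    rw [e]
    refine (norm_add_le _ _).trans ((add_le_add a1 (a2.trans a3)).trans (le_of_eq ?_))
    push_cast
    ring

/-- The derivative at 0 of s ↦ exp(sA), evaluated along s = 1/n. -/
theorem tendsto_nat_smul_exp_sub_one {𝔸 : Type*} [NormedRing 𝔸] [NormedAlgebra ℂ 𝔸]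
    [CompleteSpace 𝔸] (A : 𝔸) :
    Tendsto (fun n : ℕ => (n : ℂ) • (NormedSpace.exp (((n : ℂ)⁻¹) • A) - 1)) atTop (𝓝 A) := by
  have h := (hasDerivAt_exp_smul_const A (0 : ℂ)).tendsto_slope_zero
  simp only [zero_smul, NormedSpace.exp_zero, one_mul, zero_add] at h
  have h2 : Tendsto (fun n : ℕ => ((n : ℂ))⁻¹) atTop (𝓝[≠] 0) := by
    refine tendsto_nhdsWithin_iff.2 ⟨tendsto_inv_atTop_nhds_zero_nat, ?_⟩
    filter_upwards [eventually_ne_atTop 0] with n hn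
    simpa using hn
  simpa [Function.comp_def] using h.comp h2

/-- `(1 + Aₙ / n) ^ n → exp A` if `Aₙ → A`. -/
theorem tendsto_pow_exp {𝔸 : Type*} [NormedRing 𝔸] [NormedAlgebra ℂ 𝔸]
    [CompleteSpace 𝔸] (h1 : ‖(1 : 𝔸)‖ ≤ 1) {X : ℕ → 𝔸} {A : 𝔸}
    (h : Tendsto (fun n : ℕ => (n : ℂ) • (X n - 1)) atTop (𝓝 A)) :
    Tendsto (fun n => X n ^ n) atTop (𝓝 (NormedSpace.exp A)) := by
  -- The comparison sequence exp(A/n) satisfies `Y n ^ n = exp A` exactly for `n ≠ 0`, and n (X n −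
  -- Y n) tends to 0.
  set Y : ℕ → 𝔸 := fun n => NormedSpace.exp (((n : ℂ)⁻¹) • A) with hY
  have hYA := tendsto_nat_smul_exp_sub_one A
  have hYn : ∀ n : ℕ, n ≠ 0 → Y n ^ n = NormedSpace.exp A := by
    intro n hn
    let _ : NormedAlgebra ℚ 𝔸 := NormedAlgebra.restrictScalars ℚ ℂ 𝔸
    rw [hY, ← NormedSpace.exp_nsmul, ← Nat.cast_smul_eq_nsmul ℂ, smul_smul,
      mul_inv_cancel₀ (by exact_mod_cast hn), one_smul]
  -- Any number larger than ‖A‖ eventually bounds n ‖Z n − 1‖. The powers are then controlled by (1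
  -- + c/n)ⁿ ≤ exp c.
  set c : ℝ := ‖A‖ + 1 with hc
  have hc0 : 0 ≤ c := by positivity
  have bound : ∀ {Z : ℕ → 𝔸}, Tendsto (fun n : ℕ => (n : ℂ) • (Z n - 1)) atTop (𝓝 A) →
      ∀ᶠ n : ℕ in atTop, ‖Z n‖ ≤ 1 + c / n := by
    intro Z hZ
    have h2 : ∀ᶠ n : ℕ in atTop, ‖(n : ℂ) • (Z n - 1)‖ < c :=
      hZ.norm.eventually (gt_mem_nhds (by simp [hc]))
    filter_upwards [h2, eventually_gt_atTop 0] with n hn hn0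
    rw [norm_smul, Complex.norm_natCast] at hn
    have hn0' : (0 : ℝ) < n := by exact_mod_cast hn0
    have h3 : ‖Z n - 1‖ ≤ c / n := by
      rw [le_div_iff₀ hn0', mul_comm]
      exact hn.le
    calc ‖Z n‖ = ‖1 + (Z n - 1)‖ := by congr 1; abel
      _ ≤ ‖(1 : 𝔸)‖ + ‖Z n - 1‖ := norm_add_le _ _
      _ ≤ 1 + c / n := add_le_add h1 h3
  have hd : Tendsto (fun n : ℕ => Real.exp c * ‖(n : ℂ) • (X n - 1) - (n : ℂ) • (Y n - 1)‖)
      atTop (𝓝 0) := by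
    have := (h.sub hYA).norm.const_mul (Real.exp c)
    simpa using this
  rw [tendsto_iff_norm_sub_tendsto_zero]
  refine squeeze_zero' (Eventually.of_forall fun n => norm_nonneg _) ?_ hd
  filter_upwards [bound h, bound hYA, eventually_gt_atTop 0] with n hX hY' hn
  have hn0' : (0 : ℝ) < n := by exact_mod_cast hn
  rw [← hYn n hn.ne', ← smul_sub, sub_sub_sub_cancel_right, norm_smul, Complex.norm_natCast]
  refine (norm_pow_sub_pow_le_mul h1 (by
    have : 0 ≤ c / n := by positivity
    linarith) hX hY' n).trans ?_
  refine mul_le_mul_of_nonneg_right ?_ (by positivity)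
  calc (1 + c / n) ^ n ≤ Real.exp (c / n) ^ n := by
        gcongr
        rw [add_comm]
        exact Real.add_one_le_exp _
    _ = Real.exp c := by
        rw [← Real.exp_nat_mul]
        congr 1
        field_simp

/-- In finite dimension convergence of all matrix coefficients is convergence in norm, so
`tendsto_pow_exp` applies. Evaluating exp D at `x` and `g` gives both the exponential series and the
limit of powers. -/
theorem tendsto_iterate_exp_of_finiteDimensional {E : Type*} [NormedAddCommGroup E]
    [NormedSpace ℂ E] [FiniteDimensional ℂ E] {S : ℕ → Module.End ℂ E} {D : Module.End ℂ E}
    (h : ∀ (v : E) (g : E →ₗ[ℂ] ℂ),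
      Tendsto (fun n : ℕ => (n : ℂ) * (g (S n v) - g v)) atTop (𝓝 (g (D v))))
    (x : E) (g : E →ₗ[ℂ] ℂ) :
    ∃ s, HasSum (fun n : ℕ => ((n.factorial : ℂ))⁻¹ * g ((D ^ n) x)) s ∧
      Tendsto (fun n => g ((S n ^ n) x)) atTop (𝓝 s) := by
  classical
  have : CompleteSpace E := FiniteDimensional.complete ℂ E
  let Ψ := Module.End.toContinuousLinearMap (𝕜 := ℂ) E
  let b := Module.finBasis ℂ E
  have hΨ : Tendsto (fun n : ℕ => (n : ℂ) • (Ψ (S n) - 1)) atTop (𝓝 (Ψ D)) := by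
    -- The matrix entries converge by hypothesis, and the passage from matrices to operators is
    -- linear on a finite-dimensional space, hence continuous.
    let Φ : Matrix (Fin (Module.finrank ℂ E)) (Fin (Module.finrank ℂ E)) ℂ →ₗ[ℂ] (E →L[ℂ] E) :=
      Ψ.toLinearMap ∘ₗ (LinearMap.toMatrix b b).symm.toLinearMap
    have hΦ : Continuous Φ := LinearMap.continuous_of_finiteDimensional Φ
    have hΦS : ∀ S : Module.End ℂ E, Φ (LinearMap.toMatrix b b S) = Ψ S := fun S => by simp [Φ]
    have h1 : Tendsto (fun n : ℕ => LinearMap.toMatrix b b ((n : ℂ) • (S n - 1))) atTop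
        (𝓝 (LinearMap.toMatrix b b D)) := by
      refine tendsto_pi_nhds.2 fun i => tendsto_pi_nhds.2 fun j => ?_
      simpa [LinearMap.toMatrix_apply] using h (b j) (b.coord i)
    have h2 := (hΦ.tendsto _).comp h1
    rw [hΦS] at h2
    refine h2.congr fun n => ?_
    simp only [Function.comp_apply]
    rw [hΦS, map_smul, map_sub, map_one]
  have hX := tendsto_pow_exp ContinuousLinearMap.norm_id_le hΨ
  let ev : (E →L[ℂ] E) →ₗ[ℂ] ℂ :=
    g ∘ₗ LinearMap.applyₗ x ∘ₗ Ψ.symm.toLinearMap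
  have hev : Continuous ev := LinearMap.continuous_of_finiteDimensional ev
  have hevS : ∀ S : Module.End ℂ E, ev (Ψ S) = g (S x) := fun S => by simp [ev]
  refine ⟨ev (NormedSpace.exp (Ψ D)), ?_, ?_⟩
  · have h3 := (NormedSpace.exp_series_hasSum_exp' (𝕂 := ℂ) (Ψ D)).map ev hev
    refine h3.congr_fun fun n => ?_
    simp only [Function.comp_apply]
    rw [map_smul, ← map_pow, hevS, smul_eq_mul]
  · refine ((hev.tendsto _).comp hX).congr fun n => ?_
    simp only [Function.comp_apply]
    rw [← map_pow, hevS]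

/-- Convergence of powers of operators with a common finite dimensional invariant subspace. -/
theorem tendsto_iterate_exp {C : Type*} [AddCommGroup C] [Module ℂ C] (V : Submodule ℂ C)
    [FiniteDimensional ℂ V] {T : ℕ → Module.End ℂ C} {D : Module.End ℂ C}
    (hT : ∀ n, ∀ v ∈ V, T n v ∈ V)
    (h : ∀ v ∈ V, ∀ g : C →ₗ[ℂ] ℂ,
      Tendsto (fun n : ℕ => (n : ℂ) * (g (T n v) - g v)) atTop (𝓝 (g (D v))))
    {x : C} (hx : x ∈ V) (g : C →ₗ[ℂ] ℂ) :
    ∃ s, HasSum (fun n : ℕ => ((n.factorial : ℂ))⁻¹ * g ((D ^ n) x)) s ∧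
      Tendsto (fun n => g ((T n ^ n) x)) atTop (𝓝 s) := by
  -- A functional that vanishes on `V` also vanishes on the limit `D v`. If `D v` were outside `V`,
  -- some such functional would be nonzero on it.
  have hD : ∀ v ∈ V, D v ∈ V := by
    intro v hv
    by_contra hDv
    obtain ⟨g, hg, hgV⟩ := Submodule.exists_dual_map_eq_bot_of_notMem hDv inferInstance
    have hgV' : ∀ w ∈ V, g w = 0 := fun w hw => by
      have : g w ∈ V.map g := ⟨w, hw, rfl⟩
      rwa [hgV, Submodule.mem_bot] at this
    have h1 := h v hv g
    simp only [hgV' _ (hT _ v hv), hgV' v hv, sub_zero, mul_zero] at h1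
    exact hg (tendsto_nhds_unique h1 tendsto_const_nhds)
  let e := Module.finBasis ℂ V
  -- Only convergence of coefficients matters, so any norm serves; this one comes from coordinates.
  let _ : NormedAddCommGroup V := NormedAddCommGroup.induced V (Fin (Module.finrank ℂ V) → ℂ)
    e.equivFun e.equivFun.injective
  let _ : NormedSpace ℂ V := NormedSpace.induced ℂ V (Fin (Module.finrank ℂ V) → ℂ) e.equivFun
  obtain ⟨s, hs, hs'⟩ := tendsto_iterate_exp_of_finiteDimensional
    (S := fun n => (T n).restrict (hT n)) (D := D.restrict hD) (by
      intro v g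
      obtain ⟨g', rfl⟩ := LinearMap.exists_extend g
      exact h v v.2 g') ⟨x, hx⟩ (g ∘ₗ V.subtype)
  refine ⟨s, ?_, ?_⟩
  · refine hs.congr_fun fun n => ?_
    rw [Module.End.pow_restrict]
    rfl
  · refine hs'.congr fun n => ?_
    rw [Module.End.pow_restrict]
    rfl

end Exponential

end

end NCProb

namespace NCProb

noncomputable section

open scoped TensorProduct ComplexOrder

set_option linter.unusedSectionVars false

/-! ## Convolution of functionals on dual semigroups -/

section FreeProdMaps

variable {A B A' B' A'' B'' : Type u}
  [NonUnitalRing A] [Module ℂ A] [IsScalarTower ℂ A A] [SMulCommClass ℂ A A]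
  [NonUnitalRing B] [Module ℂ B] [IsScalarTower ℂ B B] [SMulCommClass ℂ B B]
  [NonUnitalRing A'] [Module ℂ A'] [IsScalarTower ℂ A' A'] [SMulCommClass ℂ A' A']
  [NonUnitalRing B'] [Module ℂ B'] [IsScalarTower ℂ B' B'] [SMulCommClass ℂ B' B']
  [NonUnitalRing A''] [Module ℂ A''] [IsScalarTower ℂ A'' A''] [SMulCommClass ℂ A'' A'']
  [NonUnitalRing B''] [Module ℂ B''] [IsScalarTower ℂ B'' B''] [SMulCommClass ℂ B'' B'']

@[simp] theorem FreeProd.map_inl (j₁ : A →ₙₐ[ℂ] A') (j₂ : B →ₙₐ[ℂ] B') (a : A) :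
    FreeProd.map j₁ j₂ (FreeProd.inl a) = FreeProd.inl (j₁ a) := by
  simp [FreeProd.map]

@[simp] theorem FreeProd.map_inr (j₁ : A →ₙₐ[ℂ] A') (j₂ : B →ₙₐ[ℂ] B') (b : B) :
    FreeProd.map j₁ j₂ (FreeProd.inr b) = FreeProd.inr (j₂ b) := by
  simp [FreeProd.map]

theorem FreeProd.map_map (i₁ : A' →ₙₐ[ℂ] A'') (i₂ : B' →ₙₐ[ℂ] B'') (j₁ : A →ₙₐ[ℂ] A')
    (j₂ : B →ₙₐ[ℂ] B') (x : FreeProd A B) :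
    FreeProd.map i₁ i₂ (FreeProd.map j₁ j₂ x) = FreeProd.map (i₁.comp j₁) (i₂.comp j₂) x :=
  congrArg (fun F => F x) (FreeProd.hom_ext
    (f := (FreeProd.map i₁ i₂).comp (FreeProd.map j₁ j₂)) (by simp) (by simp))

theorem FreeProd.map_id (x : FreeProd A B) :
    FreeProd.map (NonUnitalAlgHom.id ℂ A) (NonUnitalAlgHom.id ℂ B) x = x :=
  congrArg (fun F => F x) (FreeProd.hom_ext
    (f := FreeProd.map (NonUnitalAlgHom.id ℂ A) (NonUnitalAlgHom.id ℂ B))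
    (g := NonUnitalAlgHom.id ℂ _) (by simp) (by simp))

end FreeProdMaps

/-! ### Convolution operators on the Lachs coalgebra -/

section Operators

variable {m d : ℕ}

theorem lachs_lachsMap {A B : Type u} [NonUnitalRing A] [Module ℂ A] [NonUnitalRing B]
    [Module ℂ B] (φ : Functional d B) (j : A →ₙₐ[ℂ] B) (x : LachsAlg d A) :
    lachs φ (lachsMap d j x) = lachs (φ.pullback j) x := by
  have : (lachs φ).comp (lachsMap d j) = lachs (φ.pullback j) := by
    refine SymmetricAlgebra.algHom_ext (LinearMap.ext fun v => ?_)
    change lachs φ (lachsMap d j (SymmetricAlgebra.ι ℂ _ v)) =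
      lachs (φ.pullback j) (SymmetricAlgebra.ι ℂ _ v)
    simp only [lachs, lachsMap, SymmetricAlgebra.lift_ι_apply, LinearMap.comp_apply,
      Functional.tr, LinearMap.sum_apply]
    rfl
  exact congrArg (fun F => F x) this

/-- The operator `(id ⊗ f) ∘ Δ`. -/
def convOp {C : Type u} [AddCommGroup C] [Module ℂ C] (Δ : C →ₗ[ℂ] C ⊗[ℂ] C) (f : C →ₗ[ℂ] ℂ) :
    Module.End ℂ C :=
  (TensorProduct.rid ℂ C).toLinearMap ∘ₗ LinearMap.lTensor C f ∘ₗ Δ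

theorem conv_eq_comp_convOp {C : Type u} [AddCommGroup C] [Module ℂ C]
    (Δ : C →ₗ[ℂ] C ⊗[ℂ] C) (g f : C →ₗ[ℂ] ℂ) : conv Δ g f = g ∘ₗ convOp Δ f := by
  have : LinearMap.mul' ℂ ℂ ∘ₗ TensorProduct.map g f =
      g ∘ₗ (TensorProduct.rid ℂ C).toLinearMap ∘ₗ LinearMap.lTensor C f :=
    TensorProduct.ext' fun x y => by simp [mul_comm]
  rw [conv, ← LinearMap.comp_assoc, this]
  rfl

theorem convPow_eq {C : Type u} [AddCommGroup C] [Module ℂ C]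
    (Δ : C →ₗ[ℂ] C ⊗[ℂ] C) (δ f : C →ₗ[ℂ] ℂ) (n : ℕ) (x : C) :
    convPow Δ δ f n x = δ ((convOp Δ f ^ n) x) := by
  induction n generalizing x with
  | zero => rfl
  | succ n ih =>
    rw [convPow, conv_eq_comp_convOp, LinearMap.comp_apply, ih, pow_succ, Module.End.mul_apply]

/-- The values of the operators `(id ⊗ f) ∘ Δ` at a point span a finite dimensional space. -/
theorem exists_finiteDimensional_convOp {C : Type u} [AddCommGroup C] [Module ℂ C]
    (Δ : C →ₗ[ℂ] C ⊗[ℂ] C) (x : C) :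
    ∃ W : Submodule ℂ C, FiniteDimensional ℂ W ∧ ∀ f, convOp Δ f x ∈ W := by
  classical
  obtain ⟨S, hS⟩ := TensorProduct.exists_finset (Δ x)
  refine ⟨Submodule.span ℂ (S.image Prod.fst : Finset C),
    FiniteDimensional.span_finset ℂ _, fun f => ?_⟩
  simp only [convOp, LinearMap.comp_apply, hS, map_sum]
  refine sum_mem fun i hi => ?_
  simp only [LinearMap.lTensor_tmul, LinearEquiv.coe_coe, TensorProduct.rid_tmul]
  exact Submodule.smul_mem _ _ (Submodule.subset_span (by
    simpa using ⟨i.2, hi⟩))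

theorem charTensor_eq {S T : Type u} [CommRing S] [Algebra ℂ S] [CommRing T] [Algebra ℂ T]
    (f : S →ₐ[ℂ] ℂ) (g : T →ₐ[ℂ] ℂ) (t : S ⊗[ℂ] T) :
    charTensor f g t =
      f (TensorProduct.rid ℂ S (LinearMap.lTensor S g.toLinearMap t)) := by
  have : (charTensor f g).toLinearMap =
      f.toLinearMap ∘ₗ (TensorProduct.rid ℂ S).toLinearMap ∘ₗ LinearMap.lTensor S g.toLinearMap :=
    TensorProduct.ext' fun x y => by simp [charTensor, mul_comm]
  exact congrArg (fun F => F t) this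

theorem lachs_separating {A : Type u} [NonUnitalRing A] [Module ℂ A] {x y : LachsAlg d A}
    (h : ∀ φ : Functional d A, lachs φ x = lachs φ y) : x = y := by
  refine sub_eq_zero.1 (symm_separating _ fun f => ?_)
  obtain ⟨φ, rfl⟩ := Functional.exists_tr_eq f
  rw [map_sub, sub_eq_zero]
  exact h φ

/-- The homomorphism into the dual numbers has the counit as its constant part, so its coefficient
of ε is a derivation with respect to the counit. -/
theorem diffLachs_mul {A : Type u} [NonUnitalRing A] [Module ℂ A] (ψ : Functional d A)
    (x y : LachsAlg d A) :
    diffLachs ψ (x * y) = diffLachs ψ x * lachs (0 : Functional d A) y +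
      lachs (0 : Functional d A) x * diffLachs ψ y := by
  set F : LachsAlg d A →ₐ[ℂ] DualNumber ℂ :=
    SymmetricAlgebra.lift (TrivSqZeroExt.inrHom ℂ ℂ ∘ₗ ψ.tr) with hF
  have h : ∀ z, (F z).fst = lachs (0 : Functional d A) z := by
    intro z
    have : (TrivSqZeroExt.fstHom ℂ ℂ ℂ).comp F = lachs (0 : Functional d A) := by
      refine SymmetricAlgebra.algHom_ext (LinearMap.ext fun v => ?_)
      change (F (SymmetricAlgebra.ι ℂ _ v)).fst = lachs 0 (SymmetricAlgebra.ι ℂ _ v)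
      rw [hF, lachs, SymmetricAlgebra.lift_ι_apply, SymmetricAlgebra.lift_ι_apply]
      rw [LinearMap.comp_apply, TrivSqZeroExt.inrHom_apply, TrivSqZeroExt.fst_inr]
      simp [Functional.tr]
    exact congrArg (fun G => G z) this
  change (F (x * y)).snd = (F x).snd * _ + _ * (F y).snd
  rw [← h, ← h, map_mul, TrivSqZeroExt.snd_mul]
  simp [mul_comm, add_comm]

end Operators

/-! ### Convolution powers and the exponential limit -/

namespace UniversalProduct

open Filter Topology

variable {m d : ℕ} (P : UniversalProduct.{u} m d)

/-- The convolution of functionals on a dual semigroup. -/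
def star {B : FacedAlg.{u} m} (Λ : B →ₙₐ[ℂ] FreeProd B B) (θ φ : Functional d B) :
    Functional d B :=
  (P.prod B B θ φ).pullback Λ

/-- Convolution powers of functionals on a dual semigroup. -/
def starPow (P : UniversalProduct.{u} m d) {B : FacedAlg.{u} m} (Λ : B →ₙₐ[ℂ] FreeProd B B)
    (φ : Functional d B) :
    ℕ → Functional d B
  | 0 => 0
  | n + 1 => P.star Λ (P.starPow Λ φ n) φ

variable {B : FacedAlg.{u} m} {Λ : B →ₙₐ[ℂ] FreeProd B B}

/-- Universality moves both comultiplications out of the product; associativity of the product and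
coassociativity of `Λ` then identify the two sides. -/
theorem star_assoc (hΛ : IsDualSemigroup B Λ) (θ φ χ : Functional d B) :
    P.star Λ (P.star Λ θ φ) χ = P.star Λ θ (P.star Λ φ χ) := by
  have h1 := P.universality B B (B.prod B) B (P.prod B B θ φ) χ Λ (NonUnitalAlgHom.id ℂ B)
    hΛ.faced (id_isFacedHom B)
  have h2 := P.universality B B B (B.prod B) θ (P.prod B B φ χ) (NonUnitalAlgHom.id ℂ B) Λ
    (id_isFacedHom B) hΛ.faced
  have h3 := P.associativity B B B θ φ χ
  ext b k
  change P.prod B B ((P.prod B B θ φ).pullback Λ) (χ.pullback (NonUnitalAlgHom.id ℂ B)) (Λ b) k =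
    P.prod B B (θ.pullback (NonUnitalAlgHom.id ℂ B)) ((P.prod B B φ χ).pullback Λ) (Λ b) k
  rw [h1, h2]
  change P.prod (B.prod B) B (P.prod B B θ φ) χ _ k = _
  rw [h3]
  exact congrArg (fun F => P.prod B (B.prod B) θ (P.prod B B φ χ) (F b) k) hΛ.coassoc

/-- The zero functional on `B` is the pullback of the zero functional on the zero algebra along the
zero homomorphism, so universality reduces the claim to the unit law. -/
theorem prod_zero_eq (A : FacedAlg.{u} m) (φ : Functional d A) :
    P.prod A B φ 0 = φ.pullback (FreeProd.lift (NonUnitalAlgHom.id ℂ A) 0) := by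
  have h := P.universality A B A FacedAlg.zero φ 0 (NonUnitalAlgHom.id ℂ A) 0 (id_isFacedHom A)
    (fun k a _ => trivial)
  change P.prod A B φ 0 = _ at h
  rw [h]
  ext x k
  have hx : FreeProd.map (NonUnitalAlgHom.id ℂ A) (0 : B →ₙₐ[ℂ] (FacedAlg.zero : FacedAlg.{u} m)) x =
      FreeProd.inl (FreeProd.lift (NonUnitalAlgHom.id ℂ A) 0 x) :=
    congrArg (fun F => F x) (FreeProd.hom_ext
      (f := FreeProd.map (NonUnitalAlgHom.id ℂ A) (0 : B →ₙₐ[ℂ] (FacedAlg.zero : FacedAlg.{u} m)))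
      (g := FreeProd.inl.comp (FreeProd.lift (NonUnitalAlgHom.id ℂ A) 0)) (by simp) (by simp))
  change P.prod A FacedAlg.zero φ 0 (FreeProd.map _ _ x) k = _
  rw [hx]
  exact congrArg (fun F => F (FreeProd.lift (NonUnitalAlgHom.id ℂ A) 0 x) k) (P.prod_zero A φ)

theorem star_zero (hΛ : IsDualSemigroup B Λ) (θ : Functional d B) : P.star Λ θ 0 = θ := by
  rw [star, prod_zero_eq]
  ext b k
  exact congrArg (fun F => θ (F b) k) hΛ.counit_right

variable {σ : LachsAlg d (FreeProd B B) →ₐ[ℂ] LachsAlg d B ⊗[ℂ] LachsAlg d B}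

/-- The defining property of σ, read as a statement about operators. Together with the separation of
points by characters it makes φ ↦ (id ⊗ S(φᵗʳ)) ∘ Δ compatible with convolution. -/
theorem lachs_convOp (hσ : P.IsLachsTransformation B B σ) (θ φ : Functional d B)
    (x : LachsAlg d B) :
    lachs θ (convOp (lachsComul σ Λ) (lachs φ).toLinearMap x) = lachs (P.star Λ θ φ) x := by
  have h := congrArg (fun F => F (lachsMap d Λ x)) (hσ θ φ)
  rw [star, ← lachs_lachsMap]
  refine Eq.trans ?_ h.symm
  exact (charTensor_eq (lachs θ) (lachs φ) (σ (lachsMap d Λ x))).symm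

theorem convPow_lachs (hσ : P.IsLachsTransformation B B σ) (φ : Functional d B) (n : ℕ)
    (x : LachsAlg d B) :
    lachs 0 ((convOp (lachsComul σ Λ) (lachs φ).toLinearMap ^ n) x) =
      lachs (P.starPow Λ φ n) x := by
  induction n generalizing x with
  | zero => rfl
  | succ n ih => rw [pow_succ, Module.End.mul_apply, ih, lachs_convOp P hσ, starPow]

/-- The functional D(ψᵗʳ) is the derivative at the counit along ψ. The claim holds on generators by
hypothesis and passes to products by the Leibniz rule on both sides. -/
theorem tendsto_lachs_sub {φ : ℕ → Functional d B} {ψ : Functional d B}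
    (h : ∀ b k, Tendsto (fun n : ℕ => (n : ℂ) * φ n b k) atTop (𝓝 (ψ b k))) (x : LachsAlg d B) :
    Tendsto (fun n : ℕ => (n : ℂ) * (lachs (φ n) x - lachs (0 : Functional d B) x)) atTop
      (𝓝 (diffLachs ψ x)) := by
  -- If n times the difference converges, then the difference tends to 0; this is the continuity
  -- needed in the product rule.
  have hlim : ∀ z : LachsAlg d B, Tendsto (fun n : ℕ => (n : ℂ) * (lachs (φ n) z -
      lachs (0 : Functional d B) z)) atTop (𝓝 (diffLachs ψ z)) →
      Tendsto (fun n => lachs (φ n) z) atTop (𝓝 (lachs (0 : Functional d B) z)) := by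
    intro z hz
    have h1 := (tendsto_inv_atTop_nhds_zero_nat (𝕜 := ℂ)).mul hz
    rw [zero_mul] at h1
    have h2 := h1.add_const (lachs (0 : Functional d B) z)
    rw [zero_add] at h2
    refine h2.congr' ?_
    filter_upwards [eventually_ne_atTop 0] with n hn
    have hn' : (n : ℂ) ≠ 0 := by exact_mod_cast hn
    rw [inv_mul_cancel_left₀ hn', sub_add_cancel]
  induction x using SymmetricAlgebra.induction with
  | algebraMap r =>
    have h0 : diffLachs ψ (algebraMap ℂ (LachsAlg d B) r) = 0 := by
      simp [diffLachs, TrivSqZeroExt.algebraMap_eq_inl]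
    simp [h0]
  | ι v =>
    have h0 : diffLachs ψ (SymmetricAlgebra.ι ℂ _ v) = ψ.tr v := by simp [diffLachs]
    rw [h0]
    simp only [lachs, SymmetricAlgebra.lift_ι_apply, Functional.tr, LinearMap.sum_apply,
      LinearMap.comp_apply, LinearMap.proj_apply, LinearMap.zero_apply, Pi.zero_apply,
      Finset.sum_const_zero, sub_zero, Finset.mul_sum]
    exact tendsto_finsetSum _ fun k _ => h (v k) k
  | mul a b ha hb =>
    rw [diffLachs_mul]
    refine ((ha.mul (hlim b hb)).add (hb.const_mul (lachs (0 : Functional d B) a))).congr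
      fun n => ?_
    rw [map_mul, map_mul]
    ring
  | add a b ha hb =>
    have hab := ha.add hb
    rw [← map_add] at hab
    refine hab.congr fun n => ?_
    rw [map_add, map_add]
    ring

/-- The convolution exponential is a limit of convolution powers. -/
theorem exists_hasSum_and_tendsto (hΛ : IsDualSemigroup B Λ) (hσ : P.IsLachsTransformation B B σ)
    {φ : ℕ → Functional d B} {ψ : Functional d B}
    (h : ∀ b k, Tendsto (fun n : ℕ => (n : ℂ) * φ n b k) atTop (𝓝 (ψ b k))) (x : LachsAlg d B) :
    ∃ s, HasSum (fun n : ℕ => ((n.factorial : ℂ))⁻¹ *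
        convPow (lachsComul σ Λ) (lachs (0 : Functional d B)).toLinearMap (diffLachs ψ) n x) s ∧
      Tendsto (fun n => lachs (P.starPow Λ (φ n) n) x) atTop (𝓝 s) := by
  obtain ⟨T, hT⟩ : ∃ T : Functional d B → Module.End ℂ (LachsAlg d B),
      ∀ φ, T φ = convOp (lachsComul σ Λ) (lachs φ).toLinearMap := ⟨_, fun _ => rfl⟩
  have hTl : ∀ θ φ y, lachs θ (T φ y) = lachs (P.star Λ θ φ) y := fun θ φ y => by
    rw [hT, lachs_convOp P hσ]
  have hTT : ∀ φ χ y, T φ (T χ y) = T (P.star Λ φ χ) y := fun φ χ y =>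
    lachs_separating fun θ => by rw [hTl, hTl, hTl, star_assoc P hΛ]
  have hT0 : ∀ y, T 0 y = y := fun y =>
    lachs_separating fun θ => by rw [hTl, star_zero P hΛ]
  obtain ⟨W, hW, hxW⟩ := exists_finiteDimensional_convOp (lachsComul σ Λ) x
  -- The span of the orbit of `x` under all operators `T φ`. It is invariant because `T φ (T χ x)`
  -- is again in the orbit, it lies in the finite-dimensional `W`, and it contains `x` because `T 0`
  -- is the identity.
  set V : Submodule ℂ (LachsAlg d B) := Submodule.span ℂ (Set.range fun φ => T φ x) with hV
  have hVW : V ≤ W := by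
    rw [hV, Submodule.span_le]
    rintro _ ⟨φ, rfl⟩
    change T φ x ∈ W
    rw [hT]
    exact hxW _
  have : FiniteDimensional ℂ V := Submodule.finiteDimensional_of_le hVW
  have hVT : ∀ φ, ∀ v ∈ V, T φ v ∈ V := by
    intro φ v hv
    have : V ≤ V.comap (T φ) := by
      conv_lhs => rw [hV]
      rw [Submodule.span_le]
      rintro _ ⟨χ, rfl⟩
      change T φ (T χ x) ∈ V
      rw [hTT]
      exact Submodule.subset_span ⟨_, rfl⟩
    exact this hv
  have hxV : x ∈ V := Submodule.subset_span ⟨0, hT0 x⟩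
  obtain ⟨s, hs, hs'⟩ := tendsto_iterate_exp V (T := fun n => T (φ n))
    (D := convOp (lachsComul σ Λ) (diffLachs ψ)) (fun n => hVT (φ n)) (by
      intro v _ g
      -- Exchanging the two tensor legs: applying `g` first turns the dependence on `f` into
      -- evaluation at one fixed element, to which `tendsto_lachs_sub` applies.
      have key : ∀ f : LachsAlg d B →ₗ[ℂ] ℂ, g (convOp (lachsComul σ Λ) f v) =
          f (TensorProduct.lid ℂ _ (LinearMap.rTensor _ g (lachsComul σ Λ v))) := by
        intro f
        have : g ∘ₗ (TensorProduct.rid ℂ _).toLinearMap ∘ₗ LinearMap.lTensor (LachsAlg d B) f =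
            f ∘ₗ (TensorProduct.lid ℂ _).toLinearMap ∘ₗ LinearMap.rTensor (LachsAlg d B) g :=
          TensorProduct.ext' fun x y => by simp [mul_comm]
        exact congrArg (fun F => F (lachsComul σ Λ v)) this
      have h1 := tendsto_lachs_sub h
        (TensorProduct.lid ℂ _ (LinearMap.rTensor _ g (lachsComul σ Λ v)))
      rw [key]
      refine h1.congr fun n => ?_
      have e : g v = g (convOp (lachsComul σ Λ) (lachs (0 : Functional d B)).toLinearMap v) := by
        rw [← hT, hT0]
      rw [hT, e, key, key, AlgHom.toLinearMap_apply, AlgHom.toLinearMap_apply]) hxV (lachs (0 : Functional d B)).toLinearMap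
  refine ⟨s, ?_, ?_⟩
  · refine hs.congr_fun fun n => ?_
    rw [convPow_eq]
  · refine hs'.congr fun n => ?_
    rw [← convPow_lachs P hσ (φ n) n x, hT, AlgHom.toLinearMap_apply]

end UniversalProduct

end

end NCProb

namespace NCProb

noncomputable section

open scoped TensorProduct ComplexOrder

set_option linter.unusedSectionVars false

/-! ## The Boolean product of algebra valued linear maps -/

/-! ### Alternating words and Boolean independence -/

section AltWord

variable {A B R : Type u}
  [NonUnitalRing A] [Module ℂ A] [IsScalarTower ℂ A A] [SMulCommClass ℂ A A]
  [NonUnitalRing B] [Module ℂ B] [IsScalarTower ℂ B B] [SMulCommClass ℂ B B]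
  [NonUnitalRing R] [Module ℂ R] [IsScalarTower ℂ R R] [SMulCommClass ℂ R R]

/-- `AltWord f g ε δ w r` says that `w` is an alternating product of elements of `A` and `B`, with
first factor in `A` if `ε` holds and last factor in `A` if `δ` holds, and that `r` is the
corresponding product of values of `f` and `g`. -/
inductive AltWord (f : A →ₗ[ℂ] R) (g : B →ₗ[ℂ] R) : Bool → Bool → FreeProd A B → R → Prop
  | inl (a : A) : AltWord f g true true (FreeProd.inl a) (f a)
  | inr (b : B) : AltWord f g false false (FreeProd.inr b) (g b)
  | inl_mul (a : A) {δ : Bool} {w : FreeProd A B} {r : R} : AltWord f g false δ w r →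
      AltWord f g true δ (FreeProd.inl a * w) (f a * r)
  | inr_mul (b : B) {δ : Bool} {w : FreeProd A B} {r : R} : AltWord f g true δ w r →
      AltWord f g false δ (FreeProd.inr b * w) (g b * r)

variable {f : A →ₗ[ℂ] R} {g : B →ₗ[ℂ] R}

theorem AltWord.mul_inl {ε δ : Bool} {w : FreeProd A B} {r : R} (h : AltWord f g ε δ w r)
    (hδ : δ = false) (a : A) : AltWord f g ε true (w * FreeProd.inl a) (r * f a) := by
  induction h with
  | inl a' => exact absurd hδ (by simp)
  | inr b => exact .inr_mul b (.inl a)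
  | inl_mul a' h ih => rw [mul_assoc, mul_assoc]; exact .inl_mul a' (ih hδ)
  | inr_mul b h ih => rw [mul_assoc, mul_assoc]; exact .inr_mul b (ih hδ)

theorem AltWord.mul_inr {ε δ : Bool} {w : FreeProd A B} {r : R} (h : AltWord f g ε δ w r)
    (hδ : δ = true) (b : B) : AltWord f g ε false (w * FreeProd.inr b) (r * g b) := by
  induction h with
  | inl a => exact .inl_mul a (.inr b)
  | inr b' => exact absurd hδ (by simp)
  | inl_mul a' h ih => rw [mul_assoc, mul_assoc]; exact .inl_mul a' (ih hδ)
  | inr_mul b h ih => rw [mul_assoc, mul_assoc]; exact .inr_mul b (ih hδ)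

/-- Induction: the free product is spanned by alternating words. -/
theorem AltWord.span_induction (f : A →ₗ[ℂ] R) (g : B →ₗ[ℂ] R) {p : FreeProd A B → Prop}
    (halt : ∀ ε δ w r, AltWord f g ε δ w r → p w) (h0 : p 0)
    (hadd : ∀ x y, p x → p y → p (x + y)) (hsmul : ∀ (c : ℂ) x, p x → p (c • x))
    (x : FreeProd A B) : p x := by
  set S : Submodule ℂ (FreeProd A B) :=
    Submodule.span ℂ {w | ∃ ε δ r, AltWord f g ε δ w r} with hS
  have hmem : ∀ {ε δ w r}, AltWord f g ε δ w r → w ∈ S := fun h =>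
    Submodule.subset_span ⟨_, _, _, h⟩
  have hgen : ∀ y : FreeProd A B, (∀ ε δ w r, AltWord f g ε δ w r → y * w ∈ S) →
      ∀ s ∈ S, y * s ∈ S := by
    intro y hy s hs
    rw [hS] at hs
    induction hs using Submodule.span_induction with
    | mem w hw => obtain ⟨ε, δ, r, h⟩ := hw; exact hy _ _ _ _ h
    | zero => rw [mul_zero]; exact zero_mem _
    | add x y _ _ hx hy => rw [mul_add]; exact add_mem hx hy
    | smul c x _ hx => rw [mul_smul_comm]; exact Submodule.smul_mem _ _ hx
  -- The induction needs stability of the span under left multiplication as well; multiplying by a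
  -- generator either lengthens an alternating word or merges with its first factor.
  have key : x ∈ S ∧ ∀ s ∈ S, x * s ∈ S := by
    induction x using FreeProd.induction with
    | hl a =>
      refine ⟨hmem (.inl a), hgen _ fun ε δ w r h => ?_⟩
      cases h with
      | inl a' => rw [← map_mul]; exact hmem (.inl _)
      | inr b => exact hmem (.inl_mul a (.inr b))
      | inl_mul a' h => rw [← mul_assoc, ← map_mul]; exact hmem (.inl_mul _ h)
      | inr_mul b h => exact hmem (.inl_mul a (.inr_mul b h))
    | hr b =>
      refine ⟨hmem (.inr b), hgen _ fun ε δ w r h => ?_⟩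
      cases h with
      | inl a => exact hmem (.inr_mul b (.inl a))
      | inr b' => rw [← map_mul]; exact hmem (.inr _)
      | inl_mul a h => exact hmem (.inr_mul b (.inl_mul a h))
      | inr_mul b' h => rw [← mul_assoc, ← map_mul]; exact hmem (.inr_mul _ h)
    | h0 => exact ⟨zero_mem _, fun s _ => by rw [zero_mul]; exact zero_mem _⟩
    | hadd x y hx hy =>
      exact ⟨add_mem hx.1 hy.1, fun s hs => by
        rw [add_mul]; exact add_mem (hx.2 s hs) (hy.2 s hs)⟩
    | hmul x y hx hy =>
      exact ⟨hx.2 _ hy.1, fun s hs => by rw [mul_assoc]; exact hx.2 _ (hy.2 s hs)⟩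
    | hsmul c x hx =>
      exact ⟨Submodule.smul_mem _ _ hx.1, fun s hs => by
        rw [smul_mul_assoc]; exact Submodule.smul_mem _ _ (hx.2 s hs)⟩
  have hx := key.1
  clear key
  rw [hS] at hx
  induction hx using Submodule.span_induction with
  | mem w hw => obtain ⟨ε, δ, r, h⟩ := hw; exact halt _ _ _ _ h
  | zero => exact h0
  | add x y _ _ hx hy => exact hadd x y hx hy
  | smul c x _ hx => exact hsmul c x hx

/-- Two homomorphisms `π₁`, `π₂` into an algebra with idempotent `p` which are Boolean independent
with respect to the conditional expectation `x ↦ p x p`, with distributions `f` and `g`. -/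
structure IsBoolean {E : Type u} [NonUnitalRing E] [Module ℂ E] (p : E) (ρ : R →ₗ[ℂ] E)
    (f : A →ₗ[ℂ] R) (g : B →ₗ[ℂ] R) (π₁ : A →ₙₐ[ℂ] E) (π₂ : B →ₙₐ[ℂ] E) : Prop where
  idem : p * p = p
  map_mul : ∀ r s, ρ (r * s) = ρ r * ρ s
  left : ∀ a, p * π₁ a * p = ρ (f a)
  right : ∀ b, p * π₂ b * p = ρ (g b)
  left_right : ∀ a b, π₁ a * π₂ b = π₁ a * p * π₂ b
  right_left : ∀ b a, π₂ b * π₁ a = π₂ b * p * π₁ a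

section Boolean

variable {E : Type u} [NonUnitalRing E] [Module ℂ E] [IsScalarTower ℂ E E] [SMulCommClass ℂ E E]
  {p : E} {ρ : R →ₗ[ℂ] E} {π₁ : A →ₙₐ[ℂ] E} {π₂ : B →ₙₐ[ℂ] E}

/-- At each change of factor the idempotent `p` may be inserted, so the compression of an
alternating product is the product of the compressions of its factors. -/
theorem IsBoolean.altWord (H : IsBoolean p ρ f g π₁ π₂) {ε δ : Bool} {w : FreeProd A B} {r : R}
    (h : AltWord f g ε δ w r) : p * FreeProd.lift π₁ π₂ w * p = ρ r := by
  have hl : ∀ {ε δ w r}, AltWord f g ε δ w r → ε = false → ∀ a,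
      π₁ a * FreeProd.lift π₁ π₂ w = π₁ a * p * FreeProd.lift π₁ π₂ w := by
    intro ε δ w r h hε a
    cases h with
    | inl a' => exact absurd hε (by simp)
    | inr b => rw [FreeProd.lift_inr]; exact H.left_right a b
    | inl_mul a' h => exact absurd hε (by simp)
    | inr_mul b h => rw [_root_.map_mul, FreeProd.lift_inr, ← mul_assoc, H.left_right, mul_assoc]
  have hr : ∀ {ε δ w r}, AltWord f g ε δ w r → ε = true → ∀ b,
      π₂ b * FreeProd.lift π₁ π₂ w = π₂ b * p * FreeProd.lift π₁ π₂ w := by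
    intro ε δ w r h hε b
    cases h with
    | inl a => rw [FreeProd.lift_inl]; exact H.right_left b a
    | inr b' => exact absurd hε (by simp)
    | inl_mul a h => rw [_root_.map_mul, FreeProd.lift_inl, ← mul_assoc, H.right_left, mul_assoc]
    | inr_mul b' h => exact absurd hε (by simp)
  -- The inserted `p` is doubled by idempotence, so that each half carries its own pair.
  have hsplit : ∀ x y : E, p * (x * p * y) * p = p * x * p * (p * y * p) := by
    intro x y
    calc p * (x * p * y) * p = p * x * p * y * p := by noncomm_ring
      _ = p * x * (p * p) * y * p := by rw [H.idem]
      _ = p * x * p * (p * y * p) := by noncomm_ring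
  induction h with
  | inl a => rw [FreeProd.lift_inl]; exact H.left a
  | inr b => rw [FreeProd.lift_inr]; exact H.right b
  | inl_mul a h ih =>
    rw [_root_.map_mul, FreeProd.lift_inl, hl h rfl, hsplit, ih, H.left, H.map_mul]
  | inr_mul b h ih =>
    rw [_root_.map_mul, FreeProd.lift_inr, hr h rfl, hsplit, ih, H.right, H.map_mul]

end Boolean

end AltWord

/-! ### Dilation of a linear map to operators -/

section Dilation

variable {A A' A'' R : Type u}
  [NonUnitalRing A] [Module ℂ A] [IsScalarTower ℂ A A] [SMulCommClass ℂ A A]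
  [NonUnitalRing A'] [Module ℂ A'] [IsScalarTower ℂ A' A'] [SMulCommClass ℂ A' A']
  [NonUnitalRing A''] [Module ℂ A''] [IsScalarTower ℂ A'' A''] [SMulCommClass ℂ A'' A'']
  [NonUnitalRing R] [Module ℂ R] [IsScalarTower ℂ R R] [SMulCommClass ℂ R R]

/-- The space `R ⊕ A ⊗ R` (with unitized `R`), on which `A` acts by a dilation of a linear map
from `A` to `R`; an elementary tensor stands for a product whose first factor is not yet
evaluated. -/
abbrev DilationSpace (A R : Type u) [NonUnitalRing A] [Module ℂ A] [NonUnitalRing R] [Module ℂ R]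
    [IsScalarTower ℂ R R] [SMulCommClass ℂ R R] : Type u :=
  Unitization ℂ R × (A ⊗[ℂ] Unitization ℂ R)

/-- The map `a ⊗ m ↦ f(a) m`. -/
def evalFirst (f : A →ₗ[ℂ] R) : A ⊗[ℂ] Unitization ℂ R →ₗ[ℂ] Unitization ℂ R :=
  TensorProduct.lift (LinearMap.mul ℂ (Unitization ℂ R) ∘ₗ Unitization.inrHom ℂ ℂ R ∘ₗ f)

@[simp] theorem evalFirst_tmul (f : A →ₗ[ℂ] R) (a : A) (m : Unitization ℂ R) :
    evalFirst f (a ⊗ₜ m) = (f a : Unitization ℂ R) * m := rfl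

/-- The idempotent which evaluates the first factor. -/
def dilationProj (f : A →ₗ[ℂ] R) : Module.End ℂ (DilationSpace A R) :=
  LinearMap.inl ℂ _ _ ∘ₗ (LinearMap.fst ℂ _ _ + evalFirst f ∘ₗ LinearMap.snd ℂ _ _)

theorem dilationProj_apply (f : A →ₗ[ℂ] R) (v : DilationSpace A R) :
    dilationProj f v = (v.1 + evalFirst f v.2, 0) := rfl

/-- The embedding of `R` into the operators. -/
def dilationScalar (f : A →ₗ[ℂ] R) : R →ₗ[ℂ] Module.End ℂ (DilationSpace A R) where
  toFun r := LinearMap.inl ℂ _ _ ∘ₗ LinearMap.mulLeft ℂ (r : Unitization ℂ R) ∘ₗ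
    (LinearMap.fst ℂ _ _ + evalFirst f ∘ₗ LinearMap.snd ℂ _ _)
  map_add' r s := LinearMap.ext fun v => Prod.ext (by simp [add_mul]) (by simp)
  map_smul' c r := LinearMap.ext fun v => Prod.ext (by simp) (by simp)

theorem dilationScalar_apply (f : A →ₗ[ℂ] R) (r : R) (v : DilationSpace A R) :
    dilationScalar f r v = ((r : Unitization ℂ R) * (v.1 + evalFirst f v.2), 0) := rfl

/-- The action of a subalgebra `α : A' → A` with projection `e`: the first factor is evaluated,
except for its component in `A'`, which is multiplied. -/
def dilation (f : A →ₗ[ℂ] R) (α : A' →ₙₐ[ℂ] A) (e : A →ₗ[ℂ] A) (he : ∀ a, e (α a) = α a)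
    (he' : ∀ a x, e (α a * x) = α a * x) : A' →ₙₐ[ℂ] Module.End ℂ (DilationSpace A R) where
  toFun a := LinearMap.inr ℂ _ _ ∘ₗ
    (TensorProduct.mk ℂ A (Unitization ℂ R) (α a) ∘ₗ
      (LinearMap.fst ℂ _ _ + evalFirst f ∘ₗ
        (LinearMap.id - LinearMap.rTensor _ e) ∘ₗ LinearMap.snd ℂ _ _) +
      LinearMap.rTensor _ (LinearMap.mulLeft ℂ (α a)) ∘ₗ LinearMap.snd ℂ _ _)
  map_smul' c a := LinearMap.ext fun v => Prod.ext (by simp) (by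
    have : LinearMap.mulLeft ℂ (c • α a) = c • LinearMap.mulLeft ℂ (α a) :=
      LinearMap.ext fun x => smul_mul_assoc c (α a) x
    simp [TensorProduct.smul_tmul', this, LinearMap.rTensor_smul])
  map_zero' := LinearMap.ext fun v => Prod.ext (by simp) (by simp)
  map_add' a b := LinearMap.ext fun v => Prod.ext (by simp) (by
    have : LinearMap.mulLeft ℂ (α a + α b) = LinearMap.mulLeft ℂ (α a) + LinearMap.mulLeft ℂ (α b) := by
      ext; simp [add_mul]
    simp only [map_add, LinearMap.add_apply, LinearMap.comp_apply, this, LinearMap.rTensor_add,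
      LinearMap.inr_apply, Prod.snd_add]
    abel)
  map_mul' a b := LinearMap.ext fun v => Prod.ext (by simp) (by
    have h1 : ∀ z, LinearMap.rTensor (Unitization ℂ R) e
        (LinearMap.rTensor _ (LinearMap.mulLeft ℂ (α b)) z) =
        LinearMap.rTensor _ (LinearMap.mulLeft ℂ (α b)) z := by
      intro z
      rw [← LinearMap.comp_apply, ← LinearMap.rTensor_comp]
      congr 2
      exact LinearMap.ext fun x => he' b x
    have h2 : ∀ z, LinearMap.rTensor (Unitization ℂ R) (LinearMap.mulLeft ℂ (α a))
        (LinearMap.rTensor _ (LinearMap.mulLeft ℂ (α b)) z) =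
        LinearMap.rTensor _ (LinearMap.mulLeft ℂ (α a * α b)) z := by
      intro z
      rw [← LinearMap.comp_apply, ← LinearMap.rTensor_comp]
      congr 2
      exact LinearMap.ext fun x => (mul_assoc _ _ _).symm
    simp [he, h1, h2])

theorem dilation_apply (f : A →ₗ[ℂ] R) (α : A' →ₙₐ[ℂ] A) (e : A →ₗ[ℂ] A)
    (he : ∀ a, e (α a) = α a) (he' : ∀ a x, e (α a * x) = α a * x) (a : A')
    (v : DilationSpace A R) :
    dilation f α e he he' a v = (0, α a ⊗ₜ (v.1 + evalFirst f (v.2 - LinearMap.rTensor _ e v.2)) +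
      LinearMap.rTensor _ (LinearMap.mulLeft ℂ (α a)) v.2) := rfl

theorem dilationProj_idem (f : A →ₗ[ℂ] R) :
    dilationProj f * dilationProj f = dilationProj f :=
  LinearMap.ext fun v => by simp [dilationProj_apply]

theorem dilationScalar_mul (f : A →ₗ[ℂ] R) (r s : R) :
    dilationScalar f (r * s) = dilationScalar f r * dilationScalar f s :=
  LinearMap.ext fun v => by simp [dilationScalar_apply, mul_assoc]

/-- On vectors with no pending factor, the action creates the pending factor `α a`, and the
idempotent then evaluates it by `f`. -/
theorem dilation_compress (f : A →ₗ[ℂ] R) (α : A' →ₙₐ[ℂ] A) (e : A →ₗ[ℂ] A)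
    (he : ∀ a, e (α a) = α a) (he' : ∀ a x, e (α a * x) = α a * x) (a : A') :
    dilationProj f * dilation f α e he he' a * dilationProj f = dilationScalar f (f (α a)) :=
  LinearMap.ext fun v => by
    simp [dilationProj_apply, dilation_apply, dilationScalar_apply]

/-- After the second algebra has acted, the pending factor lies in its summand. The projection `e`
and multiplication by `α a` annihilate it, so the first algebra has to evaluate it, which is just
what the inserted idempotent does. -/
theorem dilation_mul_dilation (f : A →ₗ[ℂ] R) (α : A' →ₙₐ[ℂ] A) (e : A →ₗ[ℂ] A)
    (he : ∀ a, e (α a) = α a) (he' : ∀ a x, e (α a * x) = α a * x)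
    (β : A'' →ₙₐ[ℂ] A) (e₂ : A →ₗ[ℂ] A)
    (he₂ : ∀ a, e₂ (β a) = β a) (he₂' : ∀ a x, e₂ (β a * x) = β a * x)
    (h : ∀ b, e (β b) = 0) (h' : ∀ b x, e (β b * x) = 0) (hαβ : ∀ a b, α a * β b = 0)
    (a : A') (b : A'') :
    dilation f α e he he' a * dilation f β e₂ he₂ he₂' b =
      dilation f α e he he' a * dilationProj f * dilation f β e₂ he₂ he₂' b :=
  LinearMap.ext fun v => by
    have h1 : ∀ z, LinearMap.rTensor (Unitization ℂ R) e
        (LinearMap.rTensor _ (LinearMap.mulLeft ℂ (β b)) z) = 0 := by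
      intro z
      rw [← LinearMap.comp_apply, ← LinearMap.rTensor_comp,
        show e ∘ₗ LinearMap.mulLeft ℂ (β b) = 0 from LinearMap.ext fun x => h' b x]
      simp
    have h2 : ∀ z, LinearMap.rTensor (Unitization ℂ R) (LinearMap.mulLeft ℂ (α a))
        (LinearMap.rTensor _ (LinearMap.mulLeft ℂ (β b)) z) = 0 := by
      intro z
      rw [← LinearMap.comp_apply, ← LinearMap.rTensor_comp,
        show LinearMap.mulLeft ℂ (α a) ∘ₗ LinearMap.mulLeft ℂ (β b) = 0 from
          LinearMap.ext fun x => by simp [← mul_assoc, hαβ]]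
      simp
    simp [dilationProj_apply, dilation_apply, h, h1, h2, hαβ]

end Dilation

/-! ### The Boolean product and its algebraic properties -/

section BoolProd

variable {A B C R : Type u}
  [NonUnitalRing A] [Module ℂ A] [IsScalarTower ℂ A A] [SMulCommClass ℂ A A]
  [NonUnitalRing B] [Module ℂ B] [IsScalarTower ℂ B B] [SMulCommClass ℂ B B]
  [NonUnitalRing C] [Module ℂ C] [IsScalarTower ℂ C C] [SMulCommClass ℂ C C]
  [NonUnitalRing R] [Module ℂ R] [IsScalarTower ℂ R R] [SMulCommClass ℂ R R]

/-- Three linear maps have Boolean independent dilations. -/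
theorem exists_isBoolean (f : A →ₗ[ℂ] R) (g : B →ₗ[ℂ] R) (h : C →ₗ[ℂ] R) :
    ∃ (E : Type u) (_ : Ring E) (_ : Algebra ℂ E) (p : E) (ρ : R →ₗ[ℂ] E) (ev : E →ₗ[ℂ] R)
      (π₁ : A →ₙₐ[ℂ] E) (π₂ : B →ₙₐ[ℂ] E) (π₃ : C →ₙₐ[ℂ] E), (∀ r, ev (ρ r) = r) ∧
      IsBoolean p ρ f g π₁ π₂ ∧ IsBoolean p ρ f h π₁ π₃ ∧ IsBoolean p ρ g h π₂ π₃ := by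
  -- In the direct product the three algebras annihilate each other and `F` restricts to the three
  -- given maps; one dilation space for `F` then carries all three representations.
  let F : A × B × C →ₗ[ℂ] R := f.coprod (g.coprod h)
  let α : A →ₙₐ[ℂ] A × B × C := NonUnitalAlgHom.inl ℂ A (B × C)
  let β : B →ₙₐ[ℂ] A × B × C := (NonUnitalAlgHom.inr ℂ A (B × C)).comp (NonUnitalAlgHom.inl ℂ B C)
  let γ : C →ₙₐ[ℂ] A × B × C := (NonUnitalAlgHom.inr ℂ A (B × C)).comp (NonUnitalAlgHom.inr ℂ B C)
  have hα : ∀ a, α a = (a, 0, 0) := fun _ => rfl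
  have hβ : ∀ b, β b = (0, b, 0) := fun _ => rfl
  have hγ : ∀ c, γ c = (0, 0, c) := fun _ => rfl
  let e₁ : A × B × C →ₗ[ℂ] A × B × C := LinearMap.inl ℂ A (B × C) ∘ₗ LinearMap.fst ℂ A (B × C)
  let e₂ : A × B × C →ₗ[ℂ] A × B × C := LinearMap.inr ℂ A (B × C) ∘ₗ LinearMap.inl ℂ B C ∘ₗ
    LinearMap.fst ℂ B C ∘ₗ LinearMap.snd ℂ A (B × C)
  let e₃ : A × B × C →ₗ[ℂ] A × B × C := LinearMap.inr ℂ A (B × C) ∘ₗ LinearMap.inr ℂ B C ∘ₗ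
    LinearMap.snd ℂ B C ∘ₗ LinearMap.snd ℂ A (B × C)
  have he₁ : ∀ x, e₁ x = (x.1, 0, 0) := fun _ => rfl
  have he₂ : ∀ x, e₂ x = (0, x.2.1, 0) := fun _ => rfl
  have he₃ : ∀ x, e₃ x = (0, 0, x.2.2) := fun _ => rfl
  have hF : ∀ x, F x = f x.1 + (g x.2.1 + h x.2.2) := fun _ => rfl
  -- Evaluation at the unit vector recovers `r` from the operator that represents it.
  let ev : Module.End ℂ (DilationSpace (A × B × C) R) →ₗ[ℂ] R :=
    Unitization.sndHom ℂ ℂ R ∘ₗ LinearMap.fst ℂ _ _ ∘ₗ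
      LinearMap.applyₗ ((1, 0) : DilationSpace (A × B × C) R)
  refine ⟨Module.End ℂ (DilationSpace (A × B × C) R), inferInstance, inferInstance,
    dilationProj F, dilationScalar F, ev,
    dilation F α e₁ (by simp [hα, he₁]) (by simp [hα, he₁]),
    dilation F β e₂ (by simp [hβ, he₂]) (by simp [hβ, he₂]),
    dilation F γ e₃ (by simp [hγ, he₃]) (by simp [hγ, he₃]), ?_, ?_, ?_, ?_⟩
  · intro r
    simp [ev, dilationScalar_apply]
  · exact
    { idem := dilationProj_idem F
      map_mul := dilationScalar_mul F
      left := fun a => by rw [dilation_compress, hF]; simp [hα]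
      right := fun b => by rw [dilation_compress, hF]; simp [hβ]
      left_right := dilation_mul_dilation F _ _ _ _ _ _ _ _ (by simp [he₁, hβ])
        (by simp [he₁, hβ]) (by simp [hα, hβ])
      right_left := dilation_mul_dilation F _ _ _ _ _ _ _ _ (by simp [he₂, hα])
        (by simp [he₂, hα]) (by simp [hα, hβ]) }
  · exact
    { idem := dilationProj_idem F
      map_mul := dilationScalar_mul F
      left := fun a => by rw [dilation_compress, hF]; simp [hα]
      right := fun b => by rw [dilation_compress, hF]; simp [hγ]
      left_right := dilation_mul_dilation F _ _ _ _ _ _ _ _ (by simp [he₁, hγ])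
        (by simp [he₁, hγ]) (by simp [hα, hγ])
      right_left := dilation_mul_dilation F _ _ _ _ _ _ _ _ (by simp [he₃, hα])
        (by simp [he₃, hα]) (by simp [hα, hγ]) }
  · exact
    { idem := dilationProj_idem F
      map_mul := dilationScalar_mul F
      left := fun a => by rw [dilation_compress, hF]; simp [hβ]
      right := fun b => by rw [dilation_compress, hF]; simp [hγ]
      left_right := dilation_mul_dilation F _ _ _ _ _ _ _ _ (by simp [he₂, hγ])
        (by simp [he₂, hγ]) (by simp [hβ, hγ])
      right_left := dilation_mul_dilation F _ _ _ _ _ _ _ _ (by simp [he₃, hβ])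
        (by simp [he₃, hβ]) (by simp [hβ, hγ]) }

/-- Alternating words are not treated as a basis; the compression of a homomorphism by `p` is
automatically a well-defined linear map and has the right values on them. -/
theorem exists_boolProd (f : A →ₗ[ℂ] R) (g : B →ₗ[ℂ] R) :
    ∃ F : FreeProd A B →ₗ[ℂ] R, ∀ ε δ w r, AltWord f g ε δ w r → F w = r := by
  -- The third algebra plays no role here; the zero map fills its place.
  obtain ⟨E, _, _, p, ρ, ev, π₁, π₂, -, hev, H, -, -⟩ := exists_isBoolean f g (0 : B →ₗ[ℂ] R)
  refine ⟨ev ∘ₗ LinearMap.mulLeft ℂ p ∘ₗ LinearMap.mulRight ℂ p ∘ₗ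
    ((FreeProd.lift π₁ π₂ : FreeProd A B →ₙₐ[ℂ] E) : FreeProd A B →ₗ[ℂ] E), fun ε δ w r h => ?_⟩
  have := H.altWord h
  rw [mul_assoc] at this
  change ev (p * (FreeProd.lift π₁ π₂ w * p)) = r
  rw [this, hev]

/-- The Boolean product of linear maps into an algebra: the linear map on the free product whose
value on an alternating product is the product of the values of the factors. -/
def boolProd (f : A →ₗ[ℂ] R) (g : B →ₗ[ℂ] R) : FreeProd A B →ₗ[ℂ] R := (exists_boolProd f g).choose

theorem AltWord.boolProd_eq {f : A →ₗ[ℂ] R} {g : B →ₗ[ℂ] R} {ε δ : Bool} {w : FreeProd A B} {r : R}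
    (h : AltWord f g ε δ w r) : boolProd f g w = r :=
  (exists_boolProd f g).choose_spec ε δ w r h

theorem boolProd_unique {f : A →ₗ[ℂ] R} {g : B →ₗ[ℂ] R} {M : Type*} [AddCommGroup M] [Module ℂ M]
    {F : FreeProd A B →ₗ[ℂ] M} {h : R →ₗ[ℂ] M} (H : ∀ ε δ w r, AltWord f g ε δ w r → F w = h r)
    (x : FreeProd A B) : F x = h (boolProd f g x) := by
  induction x using AltWord.span_induction f g with
  | halt ε δ w r hw => rw [hw.boolProd_eq]; exact H _ _ _ _ hw
  | h0 => simp
  | hadd x y hx hy => simp [hx, hy]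
  | hsmul c x hx => simp [hx]

theorem IsBoolean.apply {E : Type u} [Ring E] [Algebra ℂ E] {p : E} {ρ : R →ₗ[ℂ] E}
    {f : A →ₗ[ℂ] R} {g : B →ₗ[ℂ] R} {π₁ : A →ₙₐ[ℂ] E} {π₂ : B →ₙₐ[ℂ] E}
    (H : IsBoolean p ρ f g π₁ π₂) (x : FreeProd A B) :
    p * FreeProd.lift π₁ π₂ x * p = ρ (boolProd f g x) :=
  boolProd_unique (F := LinearMap.mulRight ℂ p ∘ₗ LinearMap.mulLeft ℂ p ∘ₗ
    ((FreeProd.lift π₁ π₂ : FreeProd A B →ₙₐ[ℂ] E) : FreeProd A B →ₗ[ℂ] E)) (h := ρ)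
    (fun _ _ _ _ hw => H.altWord hw) x

/-- Both sides are compressions of one and the same homomorphism, induced by three pairwise Boolean
independent representations. Independence from the third representation passes from two of them to
the homomorphism they induce, because only the factor adjacent to the change of algebra matters. -/
theorem boolProd_assoc (f : A →ₗ[ℂ] R) (g : B →ₗ[ℂ] R) (h : C →ₗ[ℂ] R)
    (x : FreeProd (FreeProd A B) C) :
    boolProd (boolProd f g) h x = boolProd f (boolProd g h) (FreeProd.assoc A B C x) := by
  obtain ⟨E, _, _, p, ρ, ev, π₁, π₂, π₃, hev, H₁₂, H₁₃, H₂₃⟩ := exists_isBoolean f g h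
  have HL : IsBoolean p ρ (boolProd f g) h (FreeProd.lift π₁ π₂) π₃ :=
    { idem := H₁₂.idem
      map_mul := H₁₂.map_mul
      left := H₁₂.apply
      right := H₁₃.right
      left_right := fun x c => by
        induction x using FreeProd.induction with
        | hl a => rw [FreeProd.lift_inl]; exact H₁₃.left_right a c
        | hr b => rw [FreeProd.lift_inr]; exact H₂₃.left_right b c
        | h0 => simp
        | hadd x y hx hy => rw [map_add, add_mul, add_mul, add_mul, hx, hy]
        | hmul x y hx hy => rw [_root_.map_mul, mul_assoc, hy]; simp only [mul_assoc]
        | hsmul k x hx => rw [map_smul, smul_mul_assoc, smul_mul_assoc, smul_mul_assoc, hx]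
      right_left := fun c x => by
        induction x using FreeProd.induction with
        | hl a => rw [FreeProd.lift_inl]; exact H₁₃.right_left c a
        | hr b => rw [FreeProd.lift_inr]; exact H₂₃.right_left c b
        | h0 => simp
        | hadd x y hx hy => rw [map_add, mul_add, mul_add, hx, hy]
        | hmul x y hx hy => rw [_root_.map_mul, ← mul_assoc, hx, mul_assoc]
        | hsmul k x hx => rw [map_smul, mul_smul_comm, mul_smul_comm, hx] }
  have HR : IsBoolean p ρ f (boolProd g h) π₁ (FreeProd.lift π₂ π₃) :=
    { idem := H₁₂.idem
      map_mul := H₁₂.map_mul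
      left := H₁₂.left
      right := H₂₃.apply
      right_left := fun x c => by
        induction x using FreeProd.induction with
        | hl a => rw [FreeProd.lift_inl]; exact H₁₂.right_left a c
        | hr b => rw [FreeProd.lift_inr]; exact H₁₃.right_left b c
        | h0 => simp
        | hadd x y hx hy => rw [map_add, add_mul, add_mul, add_mul, hx, hy]
        | hmul x y hx hy => rw [_root_.map_mul, mul_assoc, hy]; simp only [mul_assoc]
        | hsmul k x hx => rw [map_smul, smul_mul_assoc, smul_mul_assoc, smul_mul_assoc, hx]
      left_right := fun c x => by
        induction x using FreeProd.induction with
        | hl a => rw [FreeProd.lift_inl]; exact H₁₂.left_right c a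
        | hr b => rw [FreeProd.lift_inr]; exact H₁₃.left_right c b
        | h0 => simp
        | hadd x y hx hy => rw [map_add, mul_add, mul_add, hx, hy]
        | hmul x y hx hy => rw [_root_.map_mul, ← mul_assoc, hx, mul_assoc]
        | hsmul k x hx => rw [map_smul, mul_smul_comm, mul_smul_comm, hx] }
  have e : FreeProd.lift π₁ (FreeProd.lift π₂ π₃) (FreeProd.assoc A B C x) =
      FreeProd.lift (FreeProd.lift π₁ π₂) π₃ x := by
    have : (FreeProd.lift π₁ (FreeProd.lift π₂ π₃)).comp (FreeProd.assoc A B C) =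
        FreeProd.lift (FreeProd.lift π₁ π₂) π₃ := by
      refine FreeProd.hom_ext (fun w => ?_) (by simp [FreeProd.assoc])
      simp only [FreeProd.assoc, NonUnitalAlgHom.comp_apply, FreeProd.lift_inl]
      exact congrArg (fun F => F w) (FreeProd.hom_ext (f := (FreeProd.lift π₁
        (FreeProd.lift π₂ π₃)).comp (FreeProd.lift FreeProd.inl (FreeProd.inr.comp FreeProd.inl)))
        (g := FreeProd.lift π₁ π₂) (by simp) (by simp))
    exact congrArg (fun F => F x) this
  rw [← hev (boolProd (boolProd f g) h x), ← HL.apply, ← e, HR.apply, hev]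

theorem boolProd_map {A' B' : Type u}
    [NonUnitalRing A'] [Module ℂ A'] [IsScalarTower ℂ A' A'] [SMulCommClass ℂ A' A']
    [NonUnitalRing B'] [Module ℂ B'] [IsScalarTower ℂ B' B'] [SMulCommClass ℂ B' B']
    (f : A →ₗ[ℂ] R) (g : B →ₗ[ℂ] R) (i : A' →ₙₐ[ℂ] A) (j : B' →ₙₐ[ℂ] B) (x : FreeProd A' B') :
    boolProd f g (FreeProd.map i j x) =
      boolProd (f ∘ₗ (i : A' →ₗ[ℂ] A)) (g ∘ₗ (j : B' →ₗ[ℂ] B)) x := by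
  refine boolProd_unique (F := boolProd f g ∘ₗ ((FreeProd.map i j : FreeProd A' B' →ₙₐ[ℂ] _) :
    FreeProd A' B' →ₗ[ℂ] FreeProd A B)) (h := LinearMap.id) (fun ε δ w r hw => ?_) x
  refine AltWord.boolProd_eq (ε := ε) (δ := δ) ?_
  change AltWord f g ε δ (FreeProd.map i j w) r
  induction hw with
  | inl a => rw [FreeProd.map_inl]; exact .inl _
  | inr b => rw [FreeProd.map_inr]; exact .inr _
  | inl_mul a _ ih => rw [_root_.map_mul, FreeProd.map_inl]; exact .inl_mul _ ih
  | inr_mul b _ ih => rw [_root_.map_mul, FreeProd.map_inr]; exact .inr_mul _ ih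

theorem map_boolProd {R' : Type u}
    [NonUnitalRing R'] [Module ℂ R'] [IsScalarTower ℂ R' R'] [SMulCommClass ℂ R' R']
    (f : A →ₗ[ℂ] R) (g : B →ₗ[ℂ] R) (h : R →ₙₐ[ℂ] R') (x : FreeProd A B) :
    h (boolProd f g x) = boolProd ((h : R →ₗ[ℂ] R') ∘ₗ f) ((h : R →ₗ[ℂ] R') ∘ₗ g) x := by
  refine (boolProd_unique (F := boolProd ((h : R →ₗ[ℂ] R') ∘ₗ f) ((h : R →ₗ[ℂ] R') ∘ₗ g))
    (h := (h : R →ₗ[ℂ] R')) (fun ε δ w r hw => ?_) x).symm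
  refine AltWord.boolProd_eq (ε := ε) (δ := δ) ?_
  change AltWord _ _ ε δ w (h r)
  induction hw with
  | inl a => exact .inl _
  | inr b => exact .inr _
  | inl_mul a _ ih => rw [_root_.map_mul]; exact .inl_mul _ ih
  | inr_mul b _ ih => rw [_root_.map_mul]; exact .inr_mul _ ih

/-- For multiplicative maps the Boolean product is the usual extension. This is why the construction
on the free cover below becomes the given comultiplication after projection to `B`. -/
theorem boolProd_hom (f : A →ₙₐ[ℂ] R) (g : B →ₙₐ[ℂ] R) (x : FreeProd A B) :
    boolProd (f : A →ₗ[ℂ] R) (g : B →ₗ[ℂ] R) x = FreeProd.lift f g x := by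
  refine (boolProd_unique (F := ((FreeProd.lift f g : FreeProd A B →ₙₐ[ℂ] R) :
    FreeProd A B →ₗ[ℂ] R)) (h := LinearMap.id) (fun ε δ w r hw => ?_) x).symm
  change FreeProd.lift f g w = r
  induction hw with
  | inl a => exact FreeProd.lift_inl f g a
  | inr b => exact FreeProd.lift_inr f g b
  | inl_mul a _ ih => rw [_root_.map_mul, FreeProd.lift_inl, ih]; rfl
  | inr_mul b _ ih => rw [_root_.map_mul, FreeProd.lift_inr, ih]; rfl

theorem boolProd_zero_right (f : A →ₗ[ℂ] R) (x : FreeProd A B) :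
    boolProd f (0 : B →ₗ[ℂ] R) x = f (FreeProd.lift (NonUnitalAlgHom.id ℂ A) 0 x) := by
  set q : FreeProd A B →ₙₐ[ℂ] A := FreeProd.lift (NonUnitalAlgHom.id ℂ A) 0 with hq
  refine (boolProd_unique (F := f ∘ₗ (q : FreeProd A B →ₗ[ℂ] A)) (h := LinearMap.id)
    (fun ε δ w r hw => ?_) x).symm
  change f (q w) = r
  have hz : ∀ {ε δ w r}, AltWord f (0 : B →ₗ[ℂ] R) ε δ w r → ε = false → q w = 0 ∧ r = 0 := by
    intro ε δ w r hw hε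
    cases hw with
    | inl a => exact absurd hε (by simp)
    | inr b => simp [hq]
    | inl_mul a h => exact absurd hε (by simp)
    | inr_mul b h => simp [hq]
  cases hw with
  | inl a => simp [hq]
  | inr b => simp [hq]
  | inl_mul a h => rw [_root_.map_mul, (hz h rfl).1, (hz h rfl).2]; simp
  | inr_mul b h => simp [hq]

theorem boolProd_zero_left (g : B →ₗ[ℂ] R) (x : FreeProd A B) :
    boolProd (0 : A →ₗ[ℂ] R) g x = g (FreeProd.lift 0 (NonUnitalAlgHom.id ℂ B) x) := by
  set q : FreeProd A B →ₙₐ[ℂ] B := FreeProd.lift 0 (NonUnitalAlgHom.id ℂ B) with hq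
  refine (boolProd_unique (F := g ∘ₗ (q : FreeProd A B →ₗ[ℂ] B)) (h := LinearMap.id)
    (fun ε δ w r hw => ?_) x).symm
  change g (q w) = r
  have hz : ∀ {ε δ w r}, AltWord (0 : A →ₗ[ℂ] R) g ε δ w r → ε = true → q w = 0 ∧ r = 0 := by
    intro ε δ w r hw hε
    cases hw with
    | inl a => simp [hq]
    | inr b => exact absurd hε (by simp)
    | inl_mul a h => simp [hq]
    | inr_mul b h => exact absurd hε (by simp)
  cases hw with
  | inl a => simp [hq]
  | inr b => simp [hq]
  | inl_mul a h => simp [hq]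
  | inr_mul b h => rw [_root_.map_mul, (hz h rfl).1, (hz h rfl).2]; simp

/-- The adjoint of an alternating word is the reversed word of adjoints, again alternating. -/
theorem boolProd_star [StarRing A] [StarModule ℂ A] [StarRing B] [StarModule ℂ B] [StarRing R]
    [StarModule ℂ R] (f : A →ₗ[ℂ] R) (g : B →ₗ[ℂ] R) (hf : ∀ a, f (star a) = star (f a))
    (hg : ∀ b, g (star b) = star (g b)) (x : FreeProd A B) :
    boolProd f g (star x) = star (boolProd f g x) := by
  have key : ∀ {ε δ w r}, AltWord f g ε δ w r → AltWord f g δ ε (star w) (star r) := by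
    intro ε δ w r hw
    induction hw with
    | inl a => rw [FreeProd.star_inl, ← hf]; exact .inl _
    | inr b => rw [FreeProd.star_inr, ← hg]; exact .inr _
    | inl_mul a _ ih => rw [star_mul, star_mul, FreeProd.star_inl, ← hf]; exact ih.mul_inl rfl _
    | inr_mul b _ ih => rw [star_mul, star_mul, FreeProd.star_inr, ← hg]; exact ih.mul_inr rfl _
  induction x using AltWord.span_induction f g with
  | halt ε δ w r hw => rw [hw.boolProd_eq, (key hw).boolProd_eq]
  | h0 => simp
  | hadd x y hx hy => rw [star_add, map_add, hx, hy, map_add, star_add]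
  | hsmul c x hx => rw [star_smul, map_smul, hx, map_smul, star_smul]

end BoolProd

end

end NCProb

namespace NCProb

noncomputable section

open scoped TensorProduct ComplexOrder

set_option linter.unusedSectionVars false

/-! ## Dual semigroup structures on the faces -/

theorem FreeProd.map_star {A B A' B' : Type u}
    [NonUnitalRing A] [Module ℂ A] [IsScalarTower ℂ A A] [SMulCommClass ℂ A A]
    [NonUnitalRing B] [Module ℂ B] [IsScalarTower ℂ B B] [SMulCommClass ℂ B B]
    [NonUnitalRing A'] [Module ℂ A'] [IsScalarTower ℂ A' A'] [SMulCommClass ℂ A' A']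
    [NonUnitalRing B'] [Module ℂ B'] [IsScalarTower ℂ B' B'] [SMulCommClass ℂ B' B']
    [StarRing A] [StarModule ℂ A] [StarRing B] [StarModule ℂ B]
    [StarRing A'] [StarModule ℂ A'] [StarRing B'] [StarModule ℂ B']
    {j₁ : A →ₙₐ[ℂ] A'} {j₂ : B →ₙₐ[ℂ] B'} (h₁ : ∀ a, j₁ (star a) = star (j₁ a))
    (h₂ : ∀ b, j₂ (star b) = star (j₂ b)) (x : FreeProd A B) :
    FreeProd.map j₁ j₂ (star x) = star (FreeProd.map j₁ j₂ x) := by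
  induction x using FreeProd.induction with
  | hl a => simp [FreeProd.star_inl, h₁]
  | hr b => simp [FreeProd.star_inr, h₂]
  | h0 => simp
  | hadd x y hx hy => rw [star_add, map_add, hx, hy, map_add, star_add]
  | hmul x y hx hy => rw [star_mul, map_mul, hx, hy, map_mul, star_mul]
  | hsmul c x hx => rw [star_smul, map_smul, hx, map_smul, star_smul]

namespace FacedAlg

variable {m : ℕ} (B : FacedAlg.{u} m) (k : Fin m)

/-- The inclusion of a face. -/
def faceIncl : B.face k →ₙₐ[ℂ] B := NonUnitalSubalgebraClass.subtype (B.face k)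

@[simp] theorem faceIncl_apply (b : B.face k) : B.faceIncl k b = b := rfl

/-- Free generation allows the identity to be prescribed on one face and 0 on the others. -/
theorem exists_faceRetract : ∃ r : B →ₙₐ[ℂ] B.face k, ∀ b : B.face k, r b = b := by
  classical
  obtain ⟨r, hr, -⟩ := B.freely (B.face k) fun l =>
    if h : l = k then NonUnitalSubalgebra.inclusion (le_of_eq (by rw [h])) else 0
  refine ⟨r, fun b => ?_⟩
  rw [hr k b, dif_pos rfl]
  rfl

/-- The projection onto a face which annihilates the other faces. -/
def faceRetract : B →ₙₐ[ℂ] B.face k := (B.exists_faceRetract k).choose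

@[simp] theorem faceRetract_apply (b : B.face k) : B.faceRetract k b = b :=
  (B.exists_faceRetract k).choose_spec b

theorem faceRetract_comp_faceIncl :
    (B.faceRetract k).comp (B.faceIncl k) = NonUnitalAlgHom.id ℂ (B.face k) :=
  NonUnitalAlgHom.ext fun b => by simp

/-- The restriction of the comultiplication to a face. -/
def faceComul (Λ : B →ₙₐ[ℂ] FreeProd B B) : B.face k →ₙₐ[ℂ] FreeProd (B.face k) (B.face k) :=
  (FreeProd.map (B.faceRetract k) (B.faceRetract k)).comp (Λ.comp (B.faceIncl k))

theorem map_faceRetract_map_faceIncl (x : FreeProd (B.face k) (B.face k)) :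
    FreeProd.map (B.faceRetract k) (B.faceRetract k)
      (FreeProd.map (B.faceIncl k) (B.faceIncl k) x) = x := by
  rw [FreeProd.map_map, faceRetract_comp_faceIncl, FreeProd.map_id]

theorem map_faceIncl_injective :
    Function.Injective (FreeProd.map (B.faceIncl k) (B.faceIncl k)) :=
  Function.LeftInverse.injective (B.map_faceRetract_map_faceIncl k)

/-- It suffices to check generators. This identifies the subalgebra `prodFace B B k` of B ⊔ B with
the free product of the face with itself, so that `Λ` can be restricted to the face. -/
theorem map_faceIncl_map_faceRetract (x : FreeProd B B) (hx : x ∈ prodFace B B k) :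
    FreeProd.map (B.faceIncl k) (B.faceIncl k)
      (FreeProd.map (B.faceRetract k) (B.faceRetract k) x) = x := by
  unfold prodFace at hx
  induction hx using NonUnitalAlgebra.adjoin_induction with
  | mem x hm =>
    rcases hm with hm | hm
    · obtain ⟨a, ha, rfl⟩ := hm
      simp [B.faceRetract_apply k ⟨a, ha⟩]
    · obtain ⟨b, hb, rfl⟩ := hm
      simp [B.faceRetract_apply k ⟨b, hb⟩]
  | add x y _ _ h1 h2 => rw [map_add, map_add, h1, h2]
  | zero => simp
  | mul x y _ _ h1 h2 => rw [map_mul, map_mul, h1, h2]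
  | smul c x _ h => rw [map_smul, map_smul, h]

variable {B} {Λ : B →ₙₐ[ℂ] FreeProd B B}

theorem map_faceComul (hΛ : IsDualSemigroup B Λ) (b : B.face k) :
    FreeProd.map (B.faceIncl k) (B.faceIncl k) (B.faceComul k Λ b) = Λ b :=
  B.map_faceIncl_map_faceRetract k _ (hΛ.faced k b b.2)

/-- Coassociativity of `Λ` is compressed by the retraction in all three places; on the face, `Λ`
factors through the inclusions, which the retraction cancels. -/
theorem faceComul_coassoc (hΛ : IsDualSemigroup B Λ) (b : B.face k) :
    FreeProd.assoc _ _ _ (FreeProd.map (B.faceComul k Λ) (NonUnitalAlgHom.id ℂ _)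
      (B.faceComul k Λ b)) =
    FreeProd.map (NonUnitalAlgHom.id ℂ _) (B.faceComul k Λ) (B.faceComul k Λ b) := by
  set r := B.faceRetract k
  set i := B.faceIncl k
  have h0 := congrArg (fun F => FreeProd.map r (FreeProd.map r r) (F (b : B))) hΛ.coassoc
  have e1 : ∀ x : FreeProd (FreeProd B B) B,
      FreeProd.map r (FreeProd.map r r) (FreeProd.assoc B B B x) =
        FreeProd.assoc _ _ _ (FreeProd.map (FreeProd.map r r) r x) := by
    intro x
    induction x using FreeProd.induction with
    | hl y =>
      induction y using FreeProd.induction with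
      | hl a => simp [FreeProd.assoc]
      | hr b => simp [FreeProd.assoc]
      | h0 => simp
      | hadd x y hx hy => simp only [map_add, hx, hy]
      | hmul x y hx hy => simp only [map_mul, hx, hy]
      | hsmul c x hx => simp only [map_smul, hx]
    | hr b => simp [FreeProd.assoc]
    | h0 => simp
    | hadd x y hx hy => simp only [map_add, hx, hy]
    | hmul x y hx hy => simp only [map_mul, hx, hy]
    | hsmul c x hx => simp only [map_smul, hx]
  have e2 : ((FreeProd.map r r).comp Λ).comp i = B.faceComul k Λ := rfl
  have e3 : (r.comp (NonUnitalAlgHom.id ℂ B)).comp i = NonUnitalAlgHom.id ℂ _ :=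
    B.faceRetract_comp_faceIncl k
  have e4 : Λ (b : B) = FreeProd.map i i (B.faceComul k Λ b) := (map_faceComul k hΛ b).symm
  simp only [NonUnitalAlgHom.comp_apply] at h0
  rw [e1, e4, FreeProd.map_map, FreeProd.map_map, FreeProd.map_map, FreeProd.map_map] at h0
  rw [e2, e3] at h0
  exact h0

theorem faceComul_counit_right (hΛ : IsDualSemigroup B Λ) (b : B.face k) :
    FreeProd.lift (NonUnitalAlgHom.id ℂ _) 0 (B.faceComul k Λ b) = b := by
  have h0 := congrArg (fun F => B.faceRetract k (F (b : B))) hΛ.counit_right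
  have e1 : ∀ x : FreeProd B B, B.faceRetract k (FreeProd.lift (NonUnitalAlgHom.id ℂ B) 0 x) =
      FreeProd.lift (NonUnitalAlgHom.id ℂ _) 0
        (FreeProd.map (B.faceRetract k) (B.faceRetract k) x) := fun x =>
    congrArg (fun F => F x) (FreeProd.hom_ext
      (f := (B.faceRetract k).comp (FreeProd.lift (NonUnitalAlgHom.id ℂ B) 0))
      (g := (FreeProd.lift (NonUnitalAlgHom.id ℂ _) 0).comp
        (FreeProd.map (B.faceRetract k) (B.faceRetract k))) (by simp) (by simp))
  simp only [NonUnitalAlgHom.comp_apply] at h0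
  rw [e1] at h0
  exact h0.trans (by simp)

theorem faceComul_counit_left (hΛ : IsDualSemigroup B Λ) (b : B.face k) :
    FreeProd.lift 0 (NonUnitalAlgHom.id ℂ _) (B.faceComul k Λ b) = b := by
  have h0 := congrArg (fun F => B.faceRetract k (F (b : B))) hΛ.counit_left
  have e1 : ∀ x : FreeProd B B, B.faceRetract k (FreeProd.lift 0 (NonUnitalAlgHom.id ℂ B) x) =
      FreeProd.lift 0 (NonUnitalAlgHom.id ℂ _)
        (FreeProd.map (B.faceRetract k) (B.faceRetract k) x) := fun x =>
    congrArg (fun F => F x) (FreeProd.hom_ext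
      (f := (B.faceRetract k).comp (FreeProd.lift 0 (NonUnitalAlgHom.id ℂ B)))
      (g := (FreeProd.lift 0 (NonUnitalAlgHom.id ℂ _)).comp
        (FreeProd.map (B.faceRetract k) (B.faceRetract k))) (by simp) (by simp))
  simp only [NonUnitalAlgHom.comp_apply] at h0
  rw [e1] at h0
  exact h0.trans (by simp)

end FacedAlg

namespace FacedStarAlg

variable {m : ℕ} (B : FacedStarAlg.{u} m) (k : Fin m)

instance : StarRing (B.face k) where
  star b := ⟨star b.1, B.star_mem_face k b b.2⟩
  star_involutive b := Subtype.ext (star_star b.1)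
  star_mul a b := Subtype.ext (star_mul a.1 b.1)
  star_add a b := Subtype.ext (star_add a.1 b.1)

instance : StarModule ℂ (B.face k) := ⟨fun c b => Subtype.ext (star_smul c b.1)⟩

theorem faceComul_star {Λ : B →ₙₐ[ℂ] FreeProd B B} (hΛ : IsStarDualSemigroup B Λ)
    (b : B.face k) : B.faceComul k Λ (star b) = star (B.faceComul k Λ b) := by
  apply B.map_faceIncl_injective k
  rw [FacedAlg.map_faceComul k hΛ.toIsDualSemigroup,
    FreeProd.map_star (fun _ => rfl) (fun _ => rfl), FacedAlg.map_faceComul k hΛ.toIsDualSemigroup]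
  exact hΛ.map_star b

end FacedStarAlg

end

end NCProb

namespace NCProb

noncomputable section

open scoped TensorProduct ComplexOrder

set_option linter.unusedSectionVars false

/-! ## A free cover of a dual semigroup -/

theorem boolProd_mem {A B R : Type u}
    [NonUnitalRing A] [Module ℂ A] [IsScalarTower ℂ A A] [SMulCommClass ℂ A A]
    [NonUnitalRing B] [Module ℂ B] [IsScalarTower ℂ B B] [SMulCommClass ℂ B B]
    [NonUnitalRing R] [Module ℂ R] [IsScalarTower ℂ R R] [SMulCommClass ℂ R R]
    {f : A →ₗ[ℂ] R} {g : B →ₗ[ℂ] R} {S : NonUnitalSubalgebra ℂ R} (hf : ∀ a, f a ∈ S)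
    (hg : ∀ b, g b ∈ S) (x : FreeProd A B) : boolProd f g x ∈ S := by
  induction x using AltWord.span_induction f g with
  | halt ε δ w r hw =>
    rw [hw.boolProd_eq]
    induction hw with
    | inl a => exact hf a
    | inr b => exact hg b
    | inl_mul a _ ih => exact mul_mem (hf a) ih
    | inr_mul b _ ih => exact mul_mem (hg b) ih
  | h0 => rw [map_zero]; exact zero_mem _
  | hadd x y hx hy => rw [map_add]; exact add_mem hx hy
  | hsmul c x hx => rw [map_smul]; exact SMulMemClass.smul_mem _ hx

namespace FacedAlg

variable {m : ℕ} (B : FacedAlg.{u} m)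

/-- The letters of the free cover: bases of the faces. -/
def CoverLetter : Type u := Σ k, Module.Basis.ofVectorSpaceIndex ℂ (B.face k)

/-- The face of a letter. -/
def coverColour (x : B.CoverLetter) : Fin m := x.1

/-- The free nonunital algebra generated by the vector spaces underlying the faces of `B`. -/
abbrev CoverAlg : Type u := WordAlg B.CoverLetter

/-- The embedding of a face into the free cover; it is linear but not multiplicative. -/
def toCover (k : Fin m) : B.face k →ₗ[ℂ] B.CoverAlg :=
  (Module.Basis.ofVectorSpace ℂ (B.face k)).constr ℂ fun i => WordAlg.letter ⟨k, i⟩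

variable {B}

theorem letter_eq_toCover (x : B.CoverLetter) : WordAlg.letter x =
    B.toCover x.1 (Module.Basis.ofVectorSpace ℂ (B.face x.1) x.2) := by
  rw [toCover, Module.Basis.constr_basis]
  rfl

section lift

variable {C : Type*} [NonUnitalRing C] [Module ℂ C] [IsScalarTower ℂ C C] [SMulCommClass ℂ C C]

/-- The homomorphism on the free cover which extends linear maps on the faces. -/
def coverLift (g : ∀ k, B.face k →ₗ[ℂ] C) : B.CoverAlg →ₙₐ[ℂ] C :=
  WordAlg.lift fun x => g x.1 (Module.Basis.ofVectorSpace ℂ (B.face x.1) x.2)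

@[simp] theorem coverLift_toCover (g : ∀ k, B.face k →ₗ[ℂ] C) (k : Fin m) (b : B.face k) :
    coverLift g (B.toCover k b) = g k b := by
  have : (coverLift g : B.CoverAlg →ₗ[ℂ] C) ∘ₗ B.toCover k = g k :=
    (Module.Basis.ofVectorSpace ℂ (B.face k)).ext fun i => by
      change coverLift g (B.toCover k _) = _
      rw [toCover, Module.Basis.constr_basis]
      exact WordAlg.lift_letter _ _
  exact congrArg (fun F => F b) this

theorem cover_hom_ext {f g : B.CoverAlg →ₙₐ[ℂ] C}
    (h : ∀ k (b : B.face k), f (B.toCover k b) = g (B.toCover k b)) : f = g :=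
  WordAlg.hom_ext fun x => by rw [letter_eq_toCover]; exact h _ _

end lift

/-- Induction: the free cover is generated by the faces of `B`. -/
theorem cover_induction {p : B.CoverAlg → Prop} (hs : ∀ k b, p (B.toCover k b)) (h0 : p 0)
    (hadd : ∀ x y, p x → p y → p (x + y)) (hmul : ∀ x y, p x → p y → p (x * y))
    (hsmul : ∀ (c : ℂ) x, p x → p (c • x)) (x : B.CoverAlg) : p x :=
  WordAlg.letter_induction (fun x => by rw [letter_eq_toCover]; exact hs _ _) h0 hadd hmul hsmul x

theorem toCover_mem_face (k : Fin m) (b : B.face k) :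
    B.toCover k b ∈ WordAlg.face B.coverColour k := by
  let e := Module.Basis.ofVectorSpace ℂ (B.face k)
  have hb : b ∈ Submodule.span ℂ (Set.range e) := by rw [e.span_eq]; trivial
  induction hb using Submodule.span_induction with
  | mem b hb =>
    obtain ⟨i, rfl⟩ := hb
    have : B.toCover k (e i) = WordAlg.letter ⟨k, i⟩ := by
      rw [toCover, Module.Basis.constr_basis]
    rw [this]
    exact WordAlg.letter_mem_face B.coverColour (⟨k, i⟩ : B.CoverLetter)
  | zero => rw [map_zero]; exact zero_mem _
  | add x y _ _ hx hy => rw [map_add]; exact add_mem hx hy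
  | smul c x _ hx => rw [map_smul]; exact SMulMemClass.smul_mem _ hx

theorem coverLift_isFacedHom {A : FacedAlg.{u} m} {g : ∀ k, B.face k →ₗ[ℂ] A}
    (h : ∀ k b, g k b ∈ A.face k) :
    IsFacedHom (A := WordAlg.faced B.coverColour) (coverLift g) :=
  WordAlg.isFacedHom fun x => by
    rw [letter_eq_toCover, coverLift_toCover]
    exact h _ _

/-- The canonical homomorphism from the free cover of `B` onto `B`. -/
def coverMap : B.CoverAlg →ₙₐ[ℂ] B := coverLift fun k => (B.faceIncl k : B.face k →ₗ[ℂ] B)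

@[simp] theorem coverMap_toCover (k : Fin m) (b : B.face k) : coverMap (B.toCover k b) = b := by
  rw [coverMap, coverLift_toCover]
  rfl

theorem coverMap_isFacedHom : IsFacedHom (A := WordAlg.faced B.coverColour) (B := B) coverMap :=
  coverLift_isFacedHom fun _ b => b.2

theorem coverMap_surjective : Function.Surjective (coverMap (B := B)) := by
  intro b
  have hb : b ∈ NonUnitalAlgebra.adjoin ℂ (⋃ k, (B.face k : Set B)) := by
    rw [B.adjoin_faces]; trivial
  induction hb using NonUnitalAlgebra.adjoin_induction with
  | mem b hb =>
    obtain ⟨k, hk⟩ := Set.mem_iUnion.1 hb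
    exact ⟨B.toCover k ⟨b, hk⟩, coverMap_toCover _ _⟩
  | zero => exact ⟨0, map_zero _⟩
  | add x y _ _ hx hy =>
    obtain ⟨x, rfl⟩ := hx
    obtain ⟨y, rfl⟩ := hy
    exact ⟨x + y, map_add _ _ _⟩
  | mul x y _ _ hx hy =>
    obtain ⟨x, rfl⟩ := hx
    obtain ⟨y, rfl⟩ := hy
    exact ⟨x * y, map_mul _ _ _⟩
  | smul c x _ hx =>
    obtain ⟨x, rfl⟩ := hx
    exact ⟨c • x, map_smul _ _ _⟩

/-- The embedding of a face into the first factor of the free square of the free cover. -/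
abbrev toCoverInl (k : Fin m) : B.face k →ₗ[ℂ] FreeProd B.CoverAlg B.CoverAlg :=
  ((FreeProd.inl : B.CoverAlg →ₙₐ[ℂ] FreeProd B.CoverAlg B.CoverAlg) : B.CoverAlg →ₗ[ℂ] _) ∘ₗ
    B.toCover k

/-- The embedding of a face into the second factor of the free square of the free cover. -/
abbrev toCoverInr (k : Fin m) : B.face k →ₗ[ℂ] FreeProd B.CoverAlg B.CoverAlg :=
  ((FreeProd.inr : B.CoverAlg →ₙₐ[ℂ] FreeProd B.CoverAlg B.CoverAlg) : B.CoverAlg →ₗ[ℂ] _) ∘ₗ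
    B.toCover k

/-- The comultiplication of the free cover of a dual semigroup. -/
def coverComul (Λ : B →ₙₐ[ℂ] FreeProd B B) :
    B.CoverAlg →ₙₐ[ℂ] FreeProd B.CoverAlg B.CoverAlg :=
  coverLift fun k => boolProd (toCoverInl k) (toCoverInr k) ∘ₗ
    (B.faceComul k Λ : B.face k →ₗ[ℂ] FreeProd (B.face k) (B.face k))

variable {Λ : B →ₙₐ[ℂ] FreeProd B B}

theorem coverComul_toCover (k : Fin m) (b : B.face k) : coverComul Λ (B.toCover k b) =
    boolProd (toCoverInl k) (toCoverInr k) (B.faceComul k Λ b) := by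
  rw [coverComul, coverLift_toCover]
  rfl

theorem coverComul_isFacedHom : IsFacedHom (A := WordAlg.faced B.coverColour)
    (B := (WordAlg.faced B.coverColour).prod (WordAlg.faced B.coverColour)) (coverComul Λ) :=
  coverLift_isFacedHom (A := (WordAlg.faced B.coverColour).prod (WordAlg.faced B.coverColour))
    fun k _ => boolProd_mem
      (fun _ => inl_mem_face (WordAlg.faced B.coverColour) (WordAlg.faced B.coverColour) k _
        (toCover_mem_face k _))
      (fun _ => inr_mem_face (WordAlg.faced B.coverColour) (WordAlg.faced B.coverColour) k _
        (toCover_mem_face k _)) _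

/-- After projection to `B` the embeddings of a face become multiplicative, so the Boolean product
collapses to the canonical map into B ⊔ B, and the restricted comultiplication becomes `Λ`. -/
theorem map_coverMap_coverComul (hΛ : IsDualSemigroup B Λ) (x : B.CoverAlg) :
    FreeProd.map coverMap coverMap (coverComul Λ x) = Λ (coverMap x) := by
  refine congrArg (fun F => F x) (cover_hom_ext (f := (FreeProd.map coverMap coverMap).comp
    (coverComul Λ)) (g := Λ.comp coverMap) fun k b => ?_)
  change FreeProd.map coverMap coverMap (coverComul Λ (B.toCover k b)) =
    Λ (coverMap (B.toCover k b))
  rw [coverComul_toCover, map_boolProd, coverMap_toCover, ← map_faceComul k hΛ]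
  refine Eq.trans ?_ (boolProd_hom (FreeProd.inl.comp (B.faceIncl k))
    (FreeProd.inr.comp (B.faceIncl k)) _)
  congr 2
  · ext c
    change FreeProd.map coverMap coverMap (FreeProd.inl (B.toCover k c)) = FreeProd.inl _
    rw [FreeProd.map_inl, coverMap_toCover]
    rfl
  · ext c
    change FreeProd.map coverMap coverMap (FreeProd.inr (B.toCover k c)) = FreeProd.inr _
    rw [FreeProd.map_inr, coverMap_toCover]
    rfl

/-- On a face, both sides are threefold Boolean products of the embeddings `f₁`, `f₂`, `f₃` into the
three copies of the cover. They differ only in bracketing, which `boolProd_assoc` and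
coassociativity on the face compensate. -/
theorem coverComul_coassoc (hΛ : IsDualSemigroup B Λ) :
    (FreeProd.assoc _ _ _).comp
      ((FreeProd.map (coverComul Λ) (NonUnitalAlgHom.id ℂ B.CoverAlg)).comp (coverComul Λ)) =
    (FreeProd.map (NonUnitalAlgHom.id ℂ B.CoverAlg) (coverComul Λ)).comp (coverComul Λ) := by
  refine cover_hom_ext fun k b => ?_
  let f₁ : B.face k →ₗ[ℂ] FreeProd B.CoverAlg (FreeProd B.CoverAlg B.CoverAlg) :=
    ((FreeProd.inl : B.CoverAlg →ₙₐ[ℂ] FreeProd B.CoverAlg (FreeProd B.CoverAlg B.CoverAlg)) :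
      B.CoverAlg →ₗ[ℂ] _) ∘ₗ B.toCover k
  let f₂ : B.face k →ₗ[ℂ] FreeProd B.CoverAlg (FreeProd B.CoverAlg B.CoverAlg) :=
    ((FreeProd.inr : FreeProd B.CoverAlg B.CoverAlg →ₙₐ[ℂ]
      FreeProd B.CoverAlg (FreeProd B.CoverAlg B.CoverAlg)) :
        FreeProd B.CoverAlg B.CoverAlg →ₗ[ℂ] _) ∘ₗ toCoverInl k
  let f₃ : B.face k →ₗ[ℂ] FreeProd B.CoverAlg (FreeProd B.CoverAlg B.CoverAlg) :=
    ((FreeProd.inr : FreeProd B.CoverAlg B.CoverAlg →ₙₐ[ℂ]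
      FreeProd B.CoverAlg (FreeProd B.CoverAlg B.CoverAlg)) :
        FreeProd B.CoverAlg B.CoverAlg →ₗ[ℂ] _) ∘ₗ toCoverInr k
  have hl : (FreeProd.assoc _ _ _).comp
      ((FreeProd.map (coverComul Λ) (NonUnitalAlgHom.id ℂ B.CoverAlg)).comp (coverComul Λ))
        (B.toCover k b) = boolProd (boolProd f₁ f₂) f₃
      (FreeProd.map (B.faceComul k Λ) (NonUnitalAlgHom.id ℂ _) (B.faceComul k Λ b)) := by
    change ((FreeProd.assoc _ _ _).comp
      (FreeProd.map (coverComul Λ) (NonUnitalAlgHom.id ℂ B.CoverAlg))) (coverComul Λ _) = _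
    rw [coverComul_toCover, map_boolProd, boolProd_map]
    congr 2
    · ext c
      change FreeProd.assoc _ _ _ (FreeProd.map _ _ (FreeProd.inl (B.toCover k c))) =
        boolProd f₁ f₂ (B.faceComul k Λ c)
      rw [FreeProd.map_inl, coverComul_toCover]
      change ((FreeProd.assoc _ _ _).comp FreeProd.inl) (boolProd _ _ _) = _
      rw [map_boolProd]
      congr 2
      · ext c
        simp [FreeProd.assoc, f₁]
      · ext c
        simp [FreeProd.assoc, f₂]
    · ext c
      simp [FreeProd.assoc, f₃]
  have hr : (FreeProd.map (NonUnitalAlgHom.id ℂ B.CoverAlg) (coverComul Λ)).comp (coverComul Λ)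
        (B.toCover k b) = boolProd f₁ (boolProd f₂ f₃)
      (FreeProd.map (NonUnitalAlgHom.id ℂ _) (B.faceComul k Λ) (B.faceComul k Λ b)) := by
    change FreeProd.map _ _ (coverComul Λ _) = _
    rw [coverComul_toCover, map_boolProd, boolProd_map]
    congr 2
    · ext c
      simp [f₁]
    · ext c
      change FreeProd.map _ _ (FreeProd.inr (B.toCover k c)) =
        boolProd f₂ f₃ (B.faceComul k Λ c)
      rw [FreeProd.map_inr, coverComul_toCover]
      exact map_boolProd _ _ _ _
  rw [hl, hr, boolProd_assoc, faceComul_coassoc k hΛ]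

theorem coverComul_counit_right (hΛ : IsDualSemigroup B Λ) :
    (FreeProd.lift (NonUnitalAlgHom.id ℂ B.CoverAlg) 0).comp (coverComul Λ) =
      NonUnitalAlgHom.id ℂ B.CoverAlg := by
  refine cover_hom_ext fun k b => ?_
  change FreeProd.lift (NonUnitalAlgHom.id ℂ B.CoverAlg) 0 (coverComul Λ _) = B.toCover k b
  rw [coverComul_toCover, map_boolProd]
  have h1 : ((FreeProd.lift (NonUnitalAlgHom.id ℂ B.CoverAlg) 0 :
      FreeProd B.CoverAlg B.CoverAlg →ₙₐ[ℂ] _) : FreeProd B.CoverAlg B.CoverAlg →ₗ[ℂ] B.CoverAlg) ∘ₗ toCoverInl k =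
      B.toCover k := by ext c; simp
  have h2 : ((FreeProd.lift (NonUnitalAlgHom.id ℂ B.CoverAlg) 0 :
      FreeProd B.CoverAlg B.CoverAlg →ₙₐ[ℂ] _) : FreeProd B.CoverAlg B.CoverAlg →ₗ[ℂ] B.CoverAlg) ∘ₗ toCoverInr k = 0 := by
    ext c; simp
  rw [h1, h2, boolProd_zero_right, faceComul_counit_right k hΛ]

theorem coverComul_counit_left (hΛ : IsDualSemigroup B Λ) :
    (FreeProd.lift 0 (NonUnitalAlgHom.id ℂ B.CoverAlg)).comp (coverComul Λ) =
      NonUnitalAlgHom.id ℂ B.CoverAlg := by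
  refine cover_hom_ext fun k b => ?_
  change FreeProd.lift 0 (NonUnitalAlgHom.id ℂ B.CoverAlg) (coverComul Λ _) = B.toCover k b
  rw [coverComul_toCover, map_boolProd]
  have h1 : ((FreeProd.lift 0 (NonUnitalAlgHom.id ℂ B.CoverAlg) :
      FreeProd B.CoverAlg B.CoverAlg →ₙₐ[ℂ] _) : FreeProd B.CoverAlg B.CoverAlg →ₗ[ℂ] B.CoverAlg) ∘ₗ toCoverInl k = 0 := by
    ext c; simp
  have h2 : ((FreeProd.lift 0 (NonUnitalAlgHom.id ℂ B.CoverAlg) :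
      FreeProd B.CoverAlg B.CoverAlg →ₙₐ[ℂ] _) : FreeProd B.CoverAlg B.CoverAlg →ₗ[ℂ] B.CoverAlg) ∘ₗ toCoverInr k =
      B.toCover k := by ext c; simp
  rw [h1, h2, boolProd_zero_left, faceComul_counit_left k hΛ]

theorem isDualSemigroup_coverComul (hΛ : IsDualSemigroup B Λ) :
    IsDualSemigroup (WordAlg.faced B.coverColour) (coverComul Λ) where
  faced := coverComul_isFacedHom
  coassoc := coverComul_coassoc hΛ
  counit_right := coverComul_counit_right hΛ
  counit_left := coverComul_counit_left hΛ

end FacedAlg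

/-! ### The involution of the free cover -/

namespace FacedStarAlg

variable {m : ℕ} (B : FacedStarAlg.{u} m)

/-- The conjugate linear antihomomorphism of the free cover of `B` which extends the involutions
of the faces, as a homomorphism. -/
def coverStarHom : B.CoverAlg →ₙₐ[ℂ] ConjOp B.CoverAlg :=
  FacedAlg.coverLift fun k =>
    { toFun := fun b => ConjOp.op (B.toCover k (star b))
      map_add' := fun a b => ConjOp.unop_injective <| by
        simp [ConjOp.unop_add, ConjOp.unop_op]
      map_smul' := fun c b => ConjOp.unop_injective <| by
        simp [ConjOp.unop_smul, ConjOp.unop_op] }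

instance : Star B.CoverAlg := ⟨fun x => (B.coverStarHom x).unop⟩

theorem cover_star_def (x : B.CoverAlg) : star x = (B.coverStarHom x).unop := rfl

@[simp] theorem star_toCover (k : Fin m) (b : B.face k) :
    star (B.toCover k b) = B.toCover k (star b) := by
  rw [cover_star_def, coverStarHom, FacedAlg.coverLift_toCover]
  rfl

theorem cover_star_smul (c : ℂ) (x : B.CoverAlg) : star (c • x) = star c • star x := by
  rw [cover_star_def, map_smul]; rfl

theorem cover_star_add (x y : B.CoverAlg) : star (x + y) = star x + star y := by
  rw [cover_star_def, map_add]; rfl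

theorem cover_star_mul (x y : B.CoverAlg) : star (x * y) = star y * star x := by
  rw [cover_star_def, map_mul]; rfl

theorem cover_star_zero : star (0 : B.CoverAlg) = 0 := by
  rw [cover_star_def, map_zero]; rfl

/-- The involution of the free cover. -/
instance : StarRing B.CoverAlg where
  star_involutive x := by
    induction x using FacedAlg.cover_induction with
    | hs k b => simp
    | h0 => rw [cover_star_zero, cover_star_zero]
    | hadd x y hx hy => rw [cover_star_add, cover_star_add, hx, hy]
    | hmul x y hx hy => rw [cover_star_mul, cover_star_mul, hx, hy]
    | hsmul c x hx => rw [cover_star_smul, cover_star_smul, hx, star_star]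
  star_mul := B.cover_star_mul
  star_add := B.cover_star_add

instance : StarModule ℂ B.CoverAlg := ⟨B.cover_star_smul⟩

theorem star_mem_coverFace (k : Fin m) (x : B.CoverAlg)
    (hx : x ∈ WordAlg.face B.coverColour k) : star x ∈ WordAlg.face B.coverColour k := by
  unfold WordAlg.face at hx
  induction hx using NonUnitalAlgebra.adjoin_induction with
  | mem x hm =>
    obtain ⟨x, rfl, rfl⟩ := hm
    rw [FacedAlg.letter_eq_toCover, star_toCover]
    exact FacedAlg.toCover_mem_face _ _
  | add x y hx hy h1 h2 => rw [star_add]; exact add_mem h1 h2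
  | zero => rw [star_zero]; exact zero_mem _
  | mul x y hx hy h1 h2 => rw [star_mul]; exact mul_mem h2 h1
  | smul c x hx h => rw [star_smul]; exact SMulMemClass.smul_mem _ h

/-- The free cover as a faced `*`-algebra. -/
abbrev cover : FacedStarAlg.{u} m where
  toFacedAlg := WordAlg.faced B.coverColour
  instStar := inferInstanceAs (StarRing B.CoverAlg)
  instStarModule := inferInstanceAs (StarModule ℂ B.CoverAlg)
  star_mem_face := B.star_mem_coverFace

theorem coverMap_star (x : B.CoverAlg) :
    FacedAlg.coverMap (star x) = star (FacedAlg.coverMap x : B) := by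
  induction x using FacedAlg.cover_induction with
  | hs k b => rw [star_toCover, FacedAlg.coverMap_toCover, FacedAlg.coverMap_toCover]; rfl
  | h0 => simp
  | hadd x y hx hy => rw [star_add, map_add, map_add, star_add, hx, hy]
  | hmul x y hx hy => rw [star_mul, map_mul, map_mul, star_mul, hx, hy]
  | hsmul c x hx => rw [star_smul, map_smul, map_smul, star_smul, hx]

theorem coverComul_star {Λ : B →ₙₐ[ℂ] FreeProd B B} (hΛ : IsStarDualSemigroup B Λ)
    (x : B.CoverAlg) : FacedAlg.coverComul Λ (star x) = star (FacedAlg.coverComul Λ x) := by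
  induction x using FacedAlg.cover_induction with
  | hs k b =>
    rw [star_toCover, FacedAlg.coverComul_toCover, FacedAlg.coverComul_toCover,
      faceComul_star B k hΛ]
    refine boolProd_star _ _ (fun a => ?_) (fun a => ?_) _
    · change FreeProd.inl (B.toCover k (star a)) = star (FreeProd.inl (B.toCover k a))
      rw [FreeProd.star_inl, star_toCover]
    · change FreeProd.inr (B.toCover k (star a)) = star (FreeProd.inr (B.toCover k a))
      rw [FreeProd.star_inr, star_toCover]
  | h0 => simp
  | hadd x y hx hy => rw [star_add, map_add, map_add, star_add, hx, hy]
  | hmul x y hx hy => rw [star_mul, map_mul, map_mul, star_mul, hx, hy]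
  | hsmul c x hx => rw [star_smul, map_smul, map_smul, star_smul, hx]

theorem isStarDualSemigroup_coverComul {Λ : B →ₙₐ[ℂ] FreeProd B B}
    (hΛ : IsStarDualSemigroup B Λ) : IsStarDualSemigroup B.cover (FacedAlg.coverComul Λ) where
  toIsDualSemigroup := FacedAlg.isDualSemigroup_coverComul hΛ.toIsDualSemigroup
  map_star := B.coverComul_star hΛ

end FacedStarAlg

end

end NCProb

namespace NCProb

noncomputable section

open scoped TensorProduct ComplexOrder

set_option linter.unusedSectionVars false

/-! ## States which approximate a generating functional -/

section GenOp

variable {B : Type u} [NonUnitalRing B] [Module ℂ B] [IsScalarTower ℂ B B] [SMulCommClass ℂ B B]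

/-- The action of `b` on `ℂ ⊕ B` which belongs to the functional `ω` at time `t`. -/
def genOp (t : ℂ) (ω : B →ₗ[ℂ] ℂ) : B →ₗ[ℂ] Module.End ℂ (ℂ × B) :=
  LinearMap.mk₂ ℂ (fun b v => (t * (ω b * v.1 + ω (b * v.2)), v.1 • b + b * v.2))
    (fun b b' v => by
      ext
      · simp only [map_add, add_mul, Prod.mk_add_mk]; ring
      · simp only [smul_add, add_mul, Prod.mk_add_mk]; abel)
    (fun c b v => by
      ext
      · simp only [map_smul, smul_mul_assoc, smul_eq_mul, Prod.smul_mk]; ring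
      · simp only [smul_mul_assoc, Prod.smul_mk, smul_add, smul_comm v.1 c b])
    (fun b v w => by
      ext
      · simp only [map_add, mul_add, Prod.mk_add_mk, Prod.fst_add, Prod.snd_add]; ring
      · simp only [mul_add, add_smul, Prod.mk_add_mk, Prod.fst_add, Prod.snd_add]; abel)
    (fun c b v => by
      ext
      · simp only [map_smul, mul_smul_comm, smul_eq_mul, Prod.smul_mk, Prod.smul_fst,
          Prod.smul_snd]; ring
      · simp only [mul_smul_comm, Prod.smul_mk, Prod.smul_fst, Prod.smul_snd, smul_add,
          smul_assoc])

theorem genOp_apply (t : ℂ) (ω : B →ₗ[ℂ] ℂ) (b : B) (v : ℂ × B) :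
    genOp t ω b v = (t * (ω b * v.1 + ω (b * v.2)), v.1 • b + b * v.2) := rfl

/-- The functional `(z, c) ↦ ω (z e + e c)`. -/
def genEval (ω : B →ₗ[ℂ] ℂ) (e : B) (v : ℂ × B) : ℂ := ω e * v.1 + ω (e * v.2)

/-- The operators are multiplicative only up to a term of order t. This recursion isolates the error
and drives the limit t → 0. -/
theorem genEval_genOp (t : ℂ) (ω : B →ₗ[ℂ] ℂ) (e b : B) (v : ℂ × B) :
    genEval ω e (genOp t ω b v) = t * (ω e * genEval ω b v) + genEval ω (e * b) v := by
  simp only [genEval, genOp_apply, mul_add, map_add, mul_smul_comm, map_smul, smul_eq_mul,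
    mul_assoc]
  ring

variable [StarRing B] [StarModule ℂ B]

/-- The sesquilinear form on `ℂ ⊕ B` which belongs to the functional `ω` at time `t`. -/
def genForm (t : ℂ) (ω : B →ₗ[ℂ] ℂ) (u v : ℂ × B) : ℂ := star u.1 * v.1 + t * ω (star u.2 * v.2)

theorem genForm_add_left (t : ℂ) (ω : B →ₗ[ℂ] ℂ) (u u' v : ℂ × B) :
    genForm t ω (u + u') v = genForm t ω u v + genForm t ω u' v := by
  simp only [genForm, Prod.fst_add, Prod.snd_add, star_add, add_mul, map_add]
  ring

theorem genForm_add_right (t : ℂ) (ω : B →ₗ[ℂ] ℂ) (u v v' : ℂ × B) :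
    genForm t ω u (v + v') = genForm t ω u v + genForm t ω u v' := by
  simp only [genForm, Prod.fst_add, Prod.snd_add, mul_add, map_add]
  ring

theorem genForm_smul_left (t : ℂ) (ω : B →ₗ[ℂ] ℂ) (c : ℂ) (u v : ℂ × B) :
    genForm t ω (c • u) v = star c * genForm t ω u v := by
  simp only [genForm, Prod.smul_fst, Prod.smul_snd, star_smul, smul_mul_assoc, map_smul,
    smul_eq_mul, star_mul']
  ring

theorem genForm_smul_right (t : ℂ) (ω : B →ₗ[ℂ] ℂ) (c : ℂ) (u v : ℂ × B) :
    genForm t ω u (c • v) = c * genForm t ω u v := by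
  simp only [genForm, Prod.smul_fst, Prod.smul_snd, mul_smul_comm, map_smul, smul_eq_mul]
  ring

theorem genForm_vacuum (t : ℂ) (ω : B →ₗ[ℂ] ℂ) (v : ℂ × B) : genForm t ω (1, 0) v = v.1 := by
  simp [genForm]

theorem genForm_self_nonneg {t : ℂ} (ht : 0 ≤ t) {ω : B →ₗ[ℂ] ℂ} (hω : ∀ b, 0 ≤ ω (star b * b))
    (v : ℂ × B) : 0 ≤ genForm t ω v v :=
  add_nonneg (star_mul_self_nonneg v.1) (mul_nonneg ht (hω v.2))

/-- The annihilation part t ω(b c) of the operator is adjoint to its creation part z b with respect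
to the form, and t ω(b) z and b c pass to the operator of `star b` because ω is hermitian. Since
`genOp` is linear in `b` but not multiplicative, it defines a *-representation of the free cover and
not of `B`. -/
theorem genForm_genOp {t : ℂ} (ht : star t = t) {ω : B →ₗ[ℂ] ℂ}
    (hω : ∀ b, ω (star b) = star (ω b)) (b : B) (u v : ℂ × B) :
    genForm t ω (genOp t ω b u) v = genForm t ω u (genOp t ω (star b) v) := by
  have h1 : star (ω (b * u.2)) = ω (star u.2 * star b) := by rw [← star_mul, hω]
  simp only [genForm, genOp_apply, star_mul', star_add, ht, h1, ← hω b, star_smul, star_mul,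
    add_mul, mul_add, smul_mul_assoc, mul_smul_comm, map_add, map_smul, smul_eq_mul, mul_assoc]
  ring

end GenOp

/-! ### Vacuum states of the free cover and their first-order limit -/

namespace FacedStarAlg

open Filter Topology

variable {m d : ℕ} (B : FacedStarAlg.{u} m)

/-- The representation of the free cover on `ℂ ⊕ B`. -/
def genRep (t : ℂ) (ω : B →ₗ[ℂ] ℂ) : B.CoverAlg →ₙₐ[ℂ] Module.End ℂ (ℂ × B) :=
  FacedAlg.coverLift fun k => genOp t ω ∘ₗ (B.faceIncl k : B.face k →ₗ[ℂ] B)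

theorem genRep_toCover (t : ℂ) (ω : B →ₗ[ℂ] ℂ) (k : Fin m) (b : B.face k) :
    B.genRep t ω (B.toCover k b) = genOp t ω (b : B) := by
  rw [genRep, FacedAlg.coverLift_toCover]
  rfl

theorem genRep_letter (t : ℂ) (ω : B →ₗ[ℂ] ℂ) (x : B.CoverLetter) :
    B.genRep t ω (WordAlg.letter x) = genOp t ω (FacedAlg.coverMap (WordAlg.letter x) : B) := by
  rw [FacedAlg.letter_eq_toCover, genRep_toCover, FacedAlg.coverMap_toCover]

theorem genForm_genRep {t : ℂ} (ht : star t = t) {ω : B →ₗ[ℂ] ℂ}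
    (hω : ∀ b, ω (star b) = star (ω b)) (x : B.CoverAlg) (u v : ℂ × B) :
    genForm t ω (B.genRep t ω x u) v = genForm t ω u (B.genRep t ω (star x) v) := by
  induction x using FacedAlg.cover_induction generalizing u v with
  | hs k b => rw [star_toCover, genRep_toCover, genRep_toCover]; exact genForm_genOp ht hω _ _ _
  | h0 => simp [genForm]
  | hadd x y hx hy =>
    rw [star_add, map_add, map_add, LinearMap.add_apply, LinearMap.add_apply, genForm_add_left,
      genForm_add_right, hx, hy]
  | hmul x y hx hy =>
    rw [star_mul, map_mul, map_mul, Module.End.mul_apply, Module.End.mul_apply, hx, hy]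
  | hsmul c x hx =>
    rw [star_smul, map_smul, map_smul, LinearMap.smul_apply, LinearMap.smul_apply,
      genForm_smul_left, genForm_smul_right, hx]

/-- The vacuum functional of the representations of the free cover which belong to the components
of `ψ` at time `t`. -/
def genState (t : ℂ) (ψ : Functional d B) : Functional d B.CoverAlg :=
  LinearMap.pi fun k => LinearMap.fst ℂ ℂ B ∘ₗ LinearMap.applyₗ ((1, 0) : ℂ × B) ∘ₗ
    (B.genRep t (LinearMap.proj k ∘ₗ ψ) : B.CoverAlg →ₗ[ℂ] Module.End ℂ (ℂ × B))

theorem genState_apply (t : ℂ) (ψ : Functional d B) (x : B.CoverAlg) (k : Fin d) :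
    B.genState t ψ x k = (B.genRep t (LinearMap.proj k ∘ₗ ψ) x (1, 0)).1 := rfl

/-- The unital extension at `star x * x` is the form evaluated at the vector obtained from the
vacuum by `x`. The form is positive semidefinite because only positivity of ψ on elements `star b *
b` enters, so no bound of ψ(b) by ψ(b*b) is needed. -/
theorem isRestrictedState_genState {t : ℂ} (ht : 0 ≤ t) {ψ : Functional d B}
    (hψ : IsRestrictedGenerating ψ) : IsRestrictedState (B.genState t ψ) := by
  intro k x
  set ω : B →ₗ[ℂ] ℂ := LinearMap.proj k ∘ₗ ψ with hω
  have hs : star t = t := (IsSelfAdjoint.of_nonneg ht).star_eq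
  have hψs : ∀ b, ω (star b) = star (ω b) := hψ.1 k
  have h := genForm_self_nonneg ht (ω := ω) (hψ.2 k)
    (x.fst • ((1, 0) : ℂ × B) + B.genRep t ω x.snd (1, 0))
  have h1 : genForm t ω (B.genRep t ω x.snd (1, 0)) (1, 0) = B.genState t ψ (star x.snd) k := by
    rw [B.genForm_genRep hs hψs, genForm_vacuum, genState_apply]
  have h2 : genForm t ω (B.genRep t ω x.snd (1, 0)) (B.genRep t ω x.snd (1, 0)) =
      B.genState t ψ (star x.snd * x.snd) k := by
    rw [B.genForm_genRep hs hψs, genForm_vacuum, genState_apply, map_mul]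
    rfl
  have h3 : (B.genRep t ω x.snd (1, 0)).1 = B.genState t ψ x.snd k := rfl
  simp only [genForm_add_left, genForm_add_right, h2, genForm_smul_right, h1, genForm_smul_left,
    genForm_vacuum, h3] at h
  refine h.trans_eq ?_
  simp only [unitalExt, Unitization.fst_mul, Unitization.snd_mul, Unitization.fst_star,
    Unitization.snd_star, map_add, map_smul, Pi.add_apply, Pi.smul_apply, smul_eq_mul]
  ring

/-- On the vacuum, a word yields t times the value of ψ at its product in `B`, up to higher order in
t. The outermost letter supplies the factor t = 1/n, which cancels n; in the remaining letters the
limit t → 0 may be taken. -/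
theorem tendsto_genState (ψ : Functional d B) (x : B.CoverAlg) (k : Fin d) :
    Tendsto (fun n : ℕ => (n : ℂ) * B.genState ((n : ℂ)⁻¹) ψ x k) atTop
      (𝓝 (ψ (FacedAlg.coverMap x) k)) := by
  set ω : B →ₗ[ℂ] ℂ := LinearMap.proj k ∘ₗ ψ with hω
  have ht : Tendsto (fun n : ℕ => ((n : ℂ)⁻¹)) atTop (𝓝 0) := tendsto_inv_atTop_nhds_zero_nat
  have hstep : ∀ (b : B) (u : ℕ → ℂ × B) (z : ℂ),
      Tendsto (fun n => genEval ω b (u n)) atTop (𝓝 z) →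
      Tendsto (fun n : ℕ => (n : ℂ) * (genOp ((n : ℂ)⁻¹) ω b (u n)).1) atTop (𝓝 z) := by
    intro b u z h
    refine h.congr' ?_
    filter_upwards [eventually_ne_atTop 0] with n hn
    have : (n : ℂ) ≠ 0 := Nat.cast_ne_zero.2 hn
    rw [genOp_apply]
    change _ = (n : ℂ) * ((n : ℂ)⁻¹ * genEval ω b (u n))
    field_simp
  have hvac : ∀ b : B, genEval ω b ((1, 0) : ℂ × B) = ω b := fun b => by simp [genEval]
  -- The induction has to allow an arbitrary left factor `e`, since each step absorbs one letter
  -- into it. The last letter is treated separately because it acts on the vacuum and `word []` is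
  -- 0, not a unit.
  have hev : ∀ l ≠ [], ∀ e : B, Tendsto (fun n : ℕ => genEval ω e
      (B.genRep ((n : ℂ)⁻¹) ω (WordAlg.word l) (1, 0))) atTop
        (𝓝 (ω (e * FacedAlg.coverMap (WordAlg.word l)))) := by
    intro l
    induction l with
    | nil => exact fun h => absurd rfl h
    | cons y l ih =>
      intro _ e
      rcases eq_or_ne l [] with rfl | hl
      · simp only [WordAlg.word_singleton, genRep_letter, genEval_genOp, hvac]
        simpa using (ht.mul_const (ω e * ω (FacedAlg.coverMap (WordAlg.letter y)))).add_const
          (ω (e * FacedAlg.coverMap (WordAlg.letter y)))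
      · simp only [WordAlg.word_cons y hl, map_mul, genRep_letter, Module.End.mul_apply,
          genEval_genOp]
        have := (ht.mul ((ih hl (FacedAlg.coverMap (WordAlg.letter y))).const_mul (ω e))).add
          (ih hl (e * FacedAlg.coverMap (WordAlg.letter y)))
        rw [zero_mul, zero_add, mul_assoc] at this
        exact this
  induction x using WordAlg.word_induction with
  | hw l hl =>
    obtain ⟨y, l, rfl⟩ := List.exists_cons_of_ne_nil hl
    simp only [genState_apply, ← hω]
    change Tendsto _ _ (𝓝 (ω (FacedAlg.coverMap (WordAlg.word (y :: l)))))
    rcases eq_or_ne l [] with rfl | hl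
    · simp only [WordAlg.word_singleton, genRep_letter]
      refine hstep _ _ _ ?_
      simp only [hvac]
      exact tendsto_const_nhds
    · simp only [WordAlg.word_cons y hl, map_mul, genRep_letter, Module.End.mul_apply]
      exact hstep _ _ _ (hev l hl _)
  | h0 => simp
  | hadd x y hx hy => simpa [mul_add] using hx.add hy
  | hsmul c x hx => simpa [mul_left_comm] using hx.const_mul c

end FacedStarAlg

end

end NCProb

namespace NCProb

noncomputable section

open scoped TensorProduct ComplexOrder

set_option linter.unusedSectionVars false

/-! ## Positivity of convolution powers and of convolution exponentials -/

theorem FacedAlg.map_isFacedHom {m : ℕ} {A₁ A₂ B₁ B₂ : FacedAlg.{u} m} {j₁ : A₁ →ₙₐ[ℂ] B₁}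
    {j₂ : A₂ →ₙₐ[ℂ] B₂} (h₁ : IsFacedHom j₁) (h₂ : IsFacedHom j₂) :
    IsFacedHom (A := A₁.prod A₂) (B := B₁.prod B₂) (FreeProd.map j₁ j₂) := by
  intro k x hx
  change x ∈ prodFace A₁ A₂ k at hx
  unfold prodFace at hx
  induction hx using NonUnitalAlgebra.adjoin_induction with
  | mem x hm =>
    rcases hm with hm | hm
    · obtain ⟨a, ha, rfl⟩ := hm
      rw [FreeProd.map_inl]
      exact inl_mem_face _ _ k _ (h₁ k a ha)
    · obtain ⟨b, hb, rfl⟩ := hm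
      rw [FreeProd.map_inr]
      exact inr_mem_face _ _ k _ (h₂ k b hb)
  | add x y _ _ hx hy => rw [map_add]; exact add_mem hx hy
  | zero => rw [map_zero]; exact zero_mem _
  | mul x y _ _ hx hy => rw [map_mul]; exact mul_mem hx hy
  | smul c x _ hx => rw [map_smul]; exact SMulMemClass.smul_mem _ hx

theorem IsRestrictedState.pullback {d : ℕ} {A B : Type u}
    [NonUnitalRing A] [Module ℂ A] [NonUnitalRing B] [Module ℂ B] [StarRing A] [StarRing B]
    {φ : Functional d B} (hφ : IsRestrictedState φ) {j : A →ₙₐ[ℂ] B}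
    (hj : ∀ a, j (star a) = star (j a)) : IsRestrictedState (φ.pullback j) := by
  intro k x
  refine (hφ k (Unitization.inl x.fst + Unitization.inr (j x.snd))).trans_eq ?_
  simp [unitalExt, Functional.pullback, hj]

/-- Every element of the unitization of `B` lifts to the unitization of `A`, so no test of
positivity is lost. -/
theorem isRestrictedState_of_pullback {d : ℕ} {A B : Type u}
    [NonUnitalRing A] [Module ℂ A] [NonUnitalRing B] [Module ℂ B] [StarRing A] [StarRing B]
    {φ : Functional d B} {j : A →ₙₐ[ℂ] B} (hj : ∀ a, j (star a) = star (j a))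
    (hs : Function.Surjective j) (hφ : IsRestrictedState (φ.pullback j)) :
    IsRestrictedState φ := by
  intro k x
  obtain ⟨a, ha⟩ := hs x.snd
  refine (hφ k (Unitization.inl x.fst + Unitization.inr a)).trans_eq ?_
  simp [unitalExt, Functional.pullback, hj, ha]

theorem IsRestrictedState.of_tendsto {d : ℕ} {A : Type u} [NonUnitalRing A] [Module ℂ A]
    [StarRing A] {φ : ℕ → Functional d A} {η : Functional d A}
    (hφ : ∀ n, IsRestrictedState (φ n))
    (h : ∀ a k, Filter.Tendsto (fun n => φ n a k) Filter.atTop (nhds (η a k))) :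
    IsRestrictedState η := fun k x =>
  ge_of_tendsto' ((h (star x * x).snd k).const_add (star x * x).fst) fun n => hφ n k x

/-! ### Iterated comultiplications -/

namespace FacedStarAlg

variable {m : ℕ} (B : FacedStarAlg.{u} m)

/-- The iterated comultiplications. -/
def powComul (Λ : B →ₙₐ[ℂ] FreeProd B B) : ∀ n : ℕ, B →ₙₐ[ℂ] B.pow n
  | 0 => (0 : B →ₙₐ[ℂ] (FacedStarAlg.zero : FacedStarAlg.{u} m))
  | n + 1 => (FreeProd.map (powComul Λ n) (NonUnitalAlgHom.id ℂ B)).comp Λ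

variable {B} {Λ : B →ₙₐ[ℂ] FreeProd B B}

theorem powComul_isFacedHom (hΛ : IsDualSemigroup B.toFacedAlg Λ) (n : ℕ) :
    FacedAlg.IsFacedHom (A := B.toFacedAlg) (B := (B.pow n).toFacedAlg) (B.powComul Λ n) := by
  induction n with
  | zero => exact fun k a _ => trivial
  | succ n ih =>
    exact fun k a ha => FacedAlg.map_isFacedHom ih
      (UniversalProduct.id_isFacedHom B.toFacedAlg) k _ (hΛ.faced k a ha)

theorem powComul_star (hΛ : IsStarDualSemigroup B Λ) (n : ℕ) (b : B) :
    B.powComul Λ n (star b) = star (B.powComul Λ n b) := by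
  induction n generalizing b with
  | zero => rfl
  | succ n ih =>
    change FreeProd.map (B.powComul Λ n) (NonUnitalAlgHom.id ℂ B) (Λ (star b)) =
      star (FreeProd.map (B.powComul Λ n) (NonUnitalAlgHom.id ℂ B) (Λ b))
    rw [hΛ.map_star, FreeProd.map_star ih fun _ => rfl]

end FacedStarAlg

/-! ### Convolution powers, exponentials and the two implications -/

namespace UniversalProduct

open Filter Topology

variable {m d : ℕ} (P : UniversalProduct.{u} m d)

/-- This is where half positivity enters: a convolution power is a power for the universal product,
pulled back along a *-homomorphism. -/
theorem starPow_eq_pow {B : FacedStarAlg.{u} m} {Λ : B →ₙₐ[ℂ] FreeProd B B}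
    (hΛ : IsDualSemigroup B.toFacedAlg Λ) (φ : Functional d B) (n : ℕ) :
    P.starPow (B := B.toFacedAlg) Λ φ n = (P.pow φ n).pullback (B.powComul Λ n) := by
  induction n with
  | zero => rfl
  | succ n ih =>
    have h := P.universality B.toFacedAlg B.toFacedAlg (B.pow n).toFacedAlg B.toFacedAlg
      (P.pow φ n) φ (B.powComul Λ n) (NonUnitalAlgHom.id ℂ B)
      (FacedStarAlg.powComul_isFacedHom hΛ n) (id_isFacedHom B.toFacedAlg)
    rw [starPow, ih]
    exact congrArg (fun F => Functional.pullback F Λ) h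

theorem starPow_pullback {A B : FacedAlg.{u} m} {Λ' : A →ₙₐ[ℂ] FreeProd A A}
    {Λ : B →ₙₐ[ℂ] FreeProd B B} {j : A →ₙₐ[ℂ] B} (hj : FacedAlg.IsFacedHom j)
    (h : ∀ a, FreeProd.map j j (Λ' a) = Λ (j a)) (φ : Functional d B) (n : ℕ) :
    P.starPow Λ' (φ.pullback j) n = (P.starPow Λ φ n).pullback j := by
  induction n with
  | zero => rfl
  | succ n ih =>
    rw [starPow, ih, star, P.universality A A B B _ φ j j hj hj]
    ext a k
    exact congrArg (fun x => P.prod B B (P.starPow Λ φ n) φ x k) (h a)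

variable {P}

theorem IsPositive.isHalfPositive (hP : P.IsPositive) : P.IsHalfPositive := by
  intro A φ hφ n
  induction n with
  | zero =>
    intro k x
    -- The zeroth power is the zero functional on the zero algebra, so only the scalar part remains.
    change 0 ≤ Star.star x.fst * x.fst + 0
    rw [add_zero]
    exact star_mul_self_nonneg x.fst
  | succ n ih => exact hP (A.pow n) A (P.pow φ n) φ ih hφ

theorem IsHalfPositive.isRestrictedState_starPow (hP : P.IsHalfPositive)
    {B : FacedStarAlg.{u} m} {Λ : B →ₙₐ[ℂ] FreeProd B B} (hΛ : IsStarDualSemigroup B Λ)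
    {φ : Functional d B} (hφ : IsRestrictedState φ) (n : ℕ) :
    IsRestrictedState (P.starPow (B := B.toFacedAlg) Λ φ n) := by
  rw [P.starPow_eq_pow hΛ.toIsDualSemigroup]
  exact IsRestrictedState.pullback (hP B φ hφ n) (FacedStarAlg.powComul_star hΛ n)

theorem exists_lachs_eq {A : Type u} [NonUnitalRing A] [Module ℂ A] (S : LachsAlg d A →ₐ[ℂ] ℂ) :
    ∃ η : Functional d A, lachs η = S := by
  obtain ⟨η, hη⟩ := Functional.exists_tr_eq (S.toLinearMap ∘ₗ SymmetricAlgebra.ι ℂ (Fin d → A))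
  refine ⟨η, SymmetricAlgebra.algHom_ext ?_⟩
  rw [lachs, hη]
  ext x
  simp

theorem lachs_ι_single {A : Type u} [NonUnitalRing A] [Module ℂ A] (φ : Functional d A) (a : A)
    (k : Fin d) : lachs φ (SymmetricAlgebra.ι ℂ _ (Pi.single k a)) = φ a k := by
  simp [lachs, Functional.tr_single]

theorem tendsto_natCast_mul_inv_smul {A : Type u} [NonUnitalRing A] [Module ℂ A]
    (ψ : Functional d A) (a : A) (k : Fin d) :
    Tendsto (fun n : ℕ => (n : ℂ) * ((n : ℂ)⁻¹ • ψ) a k) atTop (𝓝 (ψ a k)) := by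
  refine tendsto_const_nhds.congr' ?_
  filter_upwards [eventually_ne_atTop 0] with n hn
  have : (n : ℂ) ≠ 0 := Nat.cast_ne_zero.2 hn
  simp [this]

variable (P) in
/-- Every functional on a dual semigroup has a convolution exponential, and it is the limit of
convolution powers. -/
theorem exists_isConvExp {B : FacedAlg.{u} m} {Λ : B →ₙₐ[ℂ] FreeProd B B}
    (hΛ : IsDualSemigroup B Λ) (ψ : Functional d B) :
    ∃ η : Functional d B, P.IsConvExp Λ ψ η ∧ ∀ φ : ℕ → Functional d B,
      (∀ b k, Tendsto (fun n : ℕ => (n : ℂ) * φ n b k) atTop (𝓝 (ψ b k))) →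
      ∀ b k, Tendsto (fun n => P.starPow Λ (φ n) n b k) atTop (𝓝 (η b k)) := by
  obtain ⟨σ, hσ⟩ := P.exists_isLachsTransformation B B
  -- The sequence ψ/n is the simplest one with the required limit; positivity plays no role for
  -- existence.
  choose s hs ht using fun x => exists_hasSum_and_tendsto P hΛ hσ (tendsto_natCast_mul_inv_smul ψ) x
  -- The limit of characters is a character, which is what allows the exponential to be written as
  -- S(ηᵗʳ).
  let S : LachsAlg d B →ₐ[ℂ] ℂ :=
    { toFun := s
      map_one' := tendsto_nhds_unique (ht 1) (by simp)
      map_mul' := fun x y => tendsto_nhds_unique (ht (x * y)) (by simpa using (ht x).mul (ht y))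
      map_zero' := tendsto_nhds_unique (ht 0) (by simp)
      map_add' := fun x y => tendsto_nhds_unique (ht (x + y)) (by simpa using (ht x).add (ht y))
      commutes' := fun c => tendsto_nhds_unique (ht _) (by simp) }
  obtain ⟨η, hη⟩ := exists_lachs_eq S
  have hηs : ∀ x, lachs η x = s x := fun x => congrArg (fun F => F x) hη
  refine ⟨η, ⟨σ, hσ, fun x => by rw [hηs]; exact hs x⟩, fun φ hφ b k => ?_⟩
  obtain ⟨z, hz, hz'⟩ := exists_hasSum_and_tendsto P hΛ hσ hφ
    (SymmetricAlgebra.ι ℂ _ (Pi.single k b))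
  -- The limit for an arbitrary sequence is the sum of the same exponential series, so it agrees
  -- with the one for ψ/n.
  rw [hz.unique (hs _), ← hηs] at hz'
  simpa only [lachs_ι_single] using hz'

theorem IsHalfPositive.isSchoenberg (hP : P.IsHalfPositive) : P.IsSchoenberg := by
  intro B Λ hΛ ψ hψ
  obtain ⟨η, hη, hlim⟩ := P.exists_isConvExp hΛ.toIsDualSemigroup ψ
  refine ⟨η, hη, isRestrictedState_of_pullback B.coverMap_star FacedAlg.coverMap_surjective ?_⟩
  have hF := B.isStarDualSemigroup_coverComul hΛ
  obtain ⟨θ, -, hθ⟩ := P.exists_isConvExp hF.toIsDualSemigroup (ψ.pullback FacedAlg.coverMap)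
  -- On both levels the sequence ψ/n is used; the cover map intertwines the comultiplications, hence
  -- the convolution powers, and the limits agree.
  have hθη : η.pullback FacedAlg.coverMap = θ := by
    refine LinearMap.ext fun x => funext fun k => ?_
    refine tendsto_nhds_unique (hlim _ (tendsto_natCast_mul_inv_smul ψ) (FacedAlg.coverMap x) k) ?_
    refine (hθ (fun n => ((n : ℂ)⁻¹ • ψ).pullback FacedAlg.coverMap)
      (fun x k => tendsto_natCast_mul_inv_smul ψ _ k) x k).congr fun n => ?_
    rw [P.starPow_pullback (A := B.cover.toFacedAlg) (B := B.toFacedAlg)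
      FacedAlg.coverMap_isFacedHom (FacedAlg.map_coverMap_coverComul hΛ.toIsDualSemigroup)]
    rfl
  rw [hθη]
  -- The same θ is now computed as a limit along the vacuum states at time 1/n, whose convolution
  -- powers are restricted states. For n = 0 the time is 0, which is also admissible.
  refine IsRestrictedState.of_tendsto (fun n => ?_)
    (hθ (fun n => B.genState ((n : ℂ)⁻¹) ψ) (B.tendsto_genState ψ))
  refine hP.isRestrictedState_starPow hF (B.isRestrictedState_genState ?_ hψ) n
  rw [← Complex.ofReal_natCast, ← Complex.ofReal_inv]
  exact Complex.zero_le_real.2 (by positivity)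

end UniversalProduct

end

end NCProb

theorem theorem5 {m d : ℕ} (P : NCProb.UniversalProduct.{u} m d) :
    (P.IsPositive → P.IsHalfPositive) ∧ (P.IsHalfPositive → P.IsSchoenberg) := by
  exact ⟨fun hP => hP.isHalfPositive, fun hP => hP.isSchoenberg⟩
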